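/- **Potentials and co-potentials of Killing–Yano brackets.** Let $M$ be a smooth $n$-dimensional pseudo-Riemannian manifold of arbitrary signature with Levi-Civita connection $\nabla$. Let $X_a$ be a local frame with dual coframe $e^a$, with indices raised and lowered by the metric and $\nabla_a=\nabla_{X_a}$, $\nabla_aX_b=0=\nabla_ae^b$ (the index $a$ being a tensor index). Forms are smooth and may be inhomogeneous; juxtaposition denotes the Clifford product of forms, determined by $\theta\varphi=\theta\wedge\varphi+\theta^\sharp\lrcorner\varphi$ for $1$-forms $\theta$, and $[A,B]=AB-BA$. The operator $\pi$ multiplies a $p$-form by $p$, and a function $f(\pi)$ multiplies a $p$-form by $f(p)$. Put $d=e^a\wedge\nabla_a$, $\delta=-X^a\lrcorner\nabla_a$, and define the contracted wedge product by $$\alpha\wedge_0\beta=\alpha\wedge\beta,\qquad \alpha\wedge_{k}\beta=(X_a\lrcorner\alpha)\wedge_{k-1}(X^a\lrcorner\beta)\quad(k\ge1).$$ A form $\varphi$ is conformal Killing–Yano (CKY) if $\nabla_a\varphi-\frac1{\pi+1}X_a\lrcorner d\varphi+\frac1{n-\pi+1}e_a\wedge\delta\varphi=0$; it is Killing–Yano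 (KY) if moreover $\delta\varphi=0$, and closed conformal Killing–Yano (CCKY) if moreover $d\varphi=0$. For a KY form $\kappa$ put $\kappa^a=X^a\lrcorner\kappa$, $\tilde\kappa=\frac{\pi-1}{2\pi}d\kappa$, and for a CCKY form $\varphi$ put $\varphi^a=e^a\wedge\varphi$, $\tilde\varphi=-\frac{n-\pi-1}{2(n-\pi)}\delta\varphi$. For odd KY forms $\kappa,\lambda,\mu$ and even CCKY forms $\alpha,\beta,\varphi$ (that is, all homogeneous parts have odd, respectively even, degree) the Killing–Yano brackets are the forms $$[\kappa,\lambda]_{KY}=\tfrac1\pi\,e_b\wedge\{\kappa^a\nabla_a\lambda^b-\lambda^a\nabla_a\kappa^b+[\kappa^b,\tilde\lambda]+[\tilde\kappa,\lambda^b]\},$$ $$[\mu,\varphi]_{KY}=\tfrac1{n-\pi}\,X_b\lrcorner\{\mu^a\nabla_a\varphi^b-\varphi^a\nabla_a\mu^b+[\mu^b,\tilde\varphi]-[\varphi^b,\tilde\mu]\},$$ $$[\alpha,\beta]_{KY}=\tfrac1\pi\,e_b\wedge\{\alpha^a\nabla_a\beta^b-\beta^a\nabla_a\alpha^b+[\alpha^b,\tilde\beta]-[\beta^b,\tilde\alpha]\}.$$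 1. If $[X^a\lrcorner\kappa,\,X_a\lrcorner\lambda]=0$, then $$[\kappa,\lambda]_{KY}=-\frac1\pi\,\delta\sum_{k\ge0}\frac{(-1)^k}{(2k+1)!}\,(\pi\kappa)\wedge_{2k}(\pi\lambda).$$ 2. If $[X^a\lrcorner\mu,\,e_a\wedge\varphi]=0$, then $$[\mu,\varphi]_{KY}=\frac1{n-\pi}\,d\sum_{k\ge0}\frac{(-1)^k}{(2k+1)!}\,\bigl((\pi-2k)^{-1}\pi\mu\bigr)\wedge_{2k+1}\bigl((n-\pi)\varphi\bigr).$$ 3. If $[e^a\wedge\alpha,\,e_a\wedge\beta]=0$ and the denominators below cannot vanish, then $$[\alpha,\beta]_{KY}=\frac1\pi\,\delta\sum_{k\ge0}\frac{(-1)^k}{(2k+1)!}\,\frac1{n-\pi-2k}\Bigl(\bigl((n-\pi)\alpha\bigr)\wedge_{2k+1}\bigl((n-\pi)\beta\bigr)\Bigr).$$ Here the denominators cannot vanish if $n-(p+q-2(2k+1))-2k\ne0$ for all $k\ge0$ and all degrees $p,q$ of non-zero homogeneous parts of $(n-\pi)\alpha$ and $(n-\pi)\beta$, respectively. This condition holds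 whenever $n$ is odd, and whenever $p+q\le n$ for all degrees $p$ of $\alpha$ and $q$ of $\beta$. All sums are finite. In 1 and 3 the argument of the outer prefactor $1/\pi$ has no part of degree $0$, and in 2 the argument of the outer prefactor $1/(n-\pi)$ has no part of degree $n$, so these prefactors are well defined. -/

import Mathlib

open scoped Manifold ContDiff ExteriorAlgebra

noncomputable section

namespace KillingYano

/-! ### Exterior algebra of forms on a vector space -/

section LinearAlgebra

variable {V : Type*} [AddCommGroup V] [Module ℝ V]

/-- Inhomogeneous forms on `V`: the exterior algebra of the dual space. Multiplication is the
wedge product. -/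
abbrev FormsOn (V : Type*) [AddCommGroup V] [Module ℝ V] : Type _ :=
  ExteriorAlgebra ℝ (Module.Dual ℝ V)

/-- A covector regarded as a form of degree one. -/
def oneForm (θ : Module.Dual ℝ V) : FormsOn V := ExteriorAlgebra.ι ℝ θ

/-- The inner derivative `v ⌟ φ`: the antiderivation with `v ⌟ θ = θ v` on covectors. -/
def hook (v : V) : FormsOn V →ₗ[ℝ] FormsOn V :=
  CliffordAlgebra.contractLeft (Q := (0 : QuadraticForm ℝ (Module.Dual ℝ V)))
    (Module.Dual.eval ℝ V v)

/-- The homogeneous part of degree `p`. -/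
def homPart (p : ℕ) : FormsOn V →ₗ[ℝ] FormsOn V :=
  GradedAlgebra.proj (fun i : ℕ => ⋀[ℝ]^i (Module.Dual ℝ V)) p

/-- Pull-back of forms along a linear map. -/
def pullForm {W : Type*} [AddCommGroup W] [Module ℝ W] (f : V →ₗ[ℝ] W) :
    FormsOn W →ₗ[ℝ] FormsOn V :=
  (ExteriorAlgebra.map f.dualMap).toLinearMap

variable [FiniteDimensional ℝ V] (B : LinearMap.BilinForm ℝ V) (hB : B.Nondegenerate)

/-- The quadratic form `θ ↦ g(θ♯, θ♯)` of the inverse metric on the dual space. -/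
def cometric : QuadraticForm ℝ (Module.Dual ℝ V) :=
  B.toQuadraticMap.comp (B.toDual hB).symm.toLinearMap

/-- The Clifford product of forms, transported through the canonical identification of the
Clifford algebra of the inverse metric (`θ θ = g(θ♯, θ♯)`) with the exterior algebra. -/
def cliffordMul (α β : FormsOn V) : FormsOn V :=
  CliffordAlgebra.equivExterior (cometric B hB)
    ((CliffordAlgebra.equivExterior (cometric B hB)).symm α *
      (CliffordAlgebra.equivExterior (cometric B hB)).symm β)

/-- The contracted wedge product: `α ∧₀ β = α ∧ β` and
`α ∧ₖ₊₁ β = ∑ₐ (Xₐ ⌟ α) ∧ₖ (Xᵃ ⌟ β)`, for a basis `Xₐ` of `V` and its metric dual basis `Xᵃ`. -/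
def contractedWedge {n : ℕ} (X : Module.Basis (Fin n) ℝ V) :
    ℕ → FormsOn V → FormsOn V → FormsOn V
  | 0, α, β => α * β
  | k + 1, α, β =>
    ∑ a, contractedWedge X k (hook (X a) α) (hook (B.dualBasis hB X a) β)

end LinearAlgebra

/-! ### The Levi-Civita connection in coordinates -/

section Coordinates

variable {n : ℕ}

/-- The model space `ℝⁿ`. -/
abbrev Model (n : ℕ) : Type := EuclideanSpace ℝ (Fin n)

/-- The coordinate basis of `ℝⁿ`. -/
def coordBasis (n : ℕ) : Module.Basis (Fin n) ℝ (Model n) :=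
  (EuclideanSpace.basisFun (Fin n) ℝ).toBasis

/-- The basis `dx^I` of the exterior algebra. -/
def formBasis (n : ℕ) : Module.Basis (Finset (Fin n)) ℝ (FormsOn (Model n)) :=
  (coordBasis n).dualBasis.ExteriorAlgebra

/-- Componentwise derivative at `y` of a field of forms on `ℝⁿ` in the direction `v`. -/
def partialForm (W : Model n → FormsOn (Model n)) (y v : Model n) : FormsOn (Model n) :=
  ∑ I : Finset (Fin n),
    fderiv ℝ (fun z => (formBasis n).repr (W z) I) y v • formBasis n I

/-- Derivative of a scalar function in the direction of the coordinate `a`. -/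
def partialScalar (a : Fin n) (f : Model n → ℝ) (y : Model n) : ℝ :=
  fderiv ℝ f y (coordBasis n a)

/-- The Christoffel symbols `Γᶜₐᵦ` of a field `G` of metric components. -/
def christoffel (G : Model n → Matrix (Fin n) (Fin n) ℝ) (y : Model n) (c a b : Fin n) : ℝ :=
  (1 / 2) * ∑ d, (G y)⁻¹ c d *
    (partialScalar a (fun z => G z d b) y + partialScalar b (fun z => G z a d) y
      - partialScalar d (fun z => G z a b) y)

/-- The covariant derivative `∇ᵥ W = ∂ᵥ W - ∑ vᵃ Γᶜₐᵦ dxᵇ ∧ (∂_c ⌟ W)` of a field of forms. -/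
def nablaCoord (G : Model n → Matrix (Fin n) (Fin n) ℝ) (W : Model n → FormsOn (Model n))
    (y v : Model n) : FormsOn (Model n) :=
  partialForm W y v -
    ∑ c, oneForm (∑ a, ∑ b, (v a * christoffel G y c a b) • (coordBasis n).coord b) *
      hook (coordBasis n c) (W y)

end Coordinates

/-! ### Pseudo-Riemannian manifolds and differential forms -/

section Manifold

variable {n : ℕ} {M : Type*} [TopologicalSpace M] [ChartedSpace (Model n) M]

instance finiteDimensional_tangentSpace (x : M) : FiniteDimensional ℝ (TangentSpace (𝓡 n) x) :=
  inferInstanceAs (FiniteDimensional ℝ (Model n))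

/-- The derivative at `y` of the inverse of the chart at `x₀`. -/
def chartInvDeriv (x₀ : M) (y : Model n) :
    Model n →ₗ[ℝ] TangentSpace (𝓡 n) ((extChartAt (𝓡 n) x₀).symm y) :=
  (mfderiv 𝓘(ℝ, Model n) (𝓡 n) (extChartAt (𝓡 n) x₀).symm y).toLinearMap

/-- The derivative at `x` of the chart at `x`. -/
def chartDeriv (x : M) : TangentSpace (𝓡 n) x →ₗ[ℝ] Model n :=
  (mfderiv (𝓡 n) 𝓘(ℝ, Model n) (extChartAt (𝓡 n) x) x).toLinearMap

variable (n M) in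
/-- A smooth pseudo-Riemannian metric, of arbitrary signature. -/
structure PseudoRiemannianMetric [IsManifold (𝓡 n) ∞ M] where
  /-- The bilinear form on each tangent space. -/
  inner (x : M) : TangentSpace (𝓡 n) x →L[ℝ] TangentSpace (𝓡 n) x →L[ℝ] ℝ
  symm (x : M) (v w : TangentSpace (𝓡 n) x) : inner x v w = inner x w v
  nondegenerate (x : M) (v : TangentSpace (𝓡 n) x) (hv : ∀ w, inner x v w = 0) : v = 0
  contMDiff : ContMDiff (𝓡 n) ((𝓡 n).prod 𝓘(ℝ, Model n →L[ℝ] Model n →L[ℝ] ℝ)) ∞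
    (fun x => Bundle.TotalSpace.mk' (Model n →L[ℝ] Model n →L[ℝ] ℝ) x (inner x))

variable (n M) in
/-- Inhomogeneous differential forms on `M` (no regularity is required here). -/
abbrev DiffForm : Type _ := ∀ x : M, FormsOn (TangentSpace (𝓡 n) x)

namespace DiffForm

/-- The homogeneous part of degree `p` of a differential form. -/
def part (p : ℕ) (φ : DiffForm n M) : DiffForm n M := fun x => homPart p (φ x)

/-- The function `f(π)` of the degree operator `π`: it multiplies the part of degree `p`
by `f p`. Degrees above `n` do not occur. -/
def deg (f : ℕ → ℝ) (φ : DiffForm n M) : DiffForm n M :=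
  ∑ p ∈ Finset.range (n + 1), f p • part p φ

/-- All homogeneous parts of the form have odd degree. -/
def IsOdd (φ : DiffForm n M) : Prop := ∀ p, Even p → part p φ = 0

/-- All homogeneous parts of the form have even degree. -/
def IsEven (φ : DiffForm n M) : Prop := ∀ p, Odd p → part p φ = 0

/-- The local representative of a form in the chart at `x₀`: its pull-back along the inverse
chart, a field of forms on the chart domain in `ℝⁿ`. -/
def inChart (φ : DiffForm n M) (x₀ : M) (y : Model n) : FormsOn (Model n) :=
  pullForm (chartInvDeriv x₀ y) (φ ((extChartAt (𝓡 n) x₀).symm y))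

/-- A form is smooth if its components in all charts are smooth. -/
def IsSmooth (φ : DiffForm n M) : Prop :=
  ∀ (x₀ : M) (I : Finset (Fin n)),
    ContDiffOn ℝ ∞ (fun y => (formBasis n).repr (inChart φ x₀ y) I) (extChartAt (𝓡 n) x₀).target

end DiffForm

/-- The coordinate frame `Xₐ` of the tangent space at `x` belonging to the chart at `x`. -/
def frame (x : M) : Module.Basis (Fin n) ℝ (TangentSpace (𝓡 n) x) := coordBasis n

namespace PseudoRiemannianMetric

variable [IsManifold (𝓡 n) ∞ M] (g : PseudoRiemannianMetric n M)

/-- The metric at `x` as a bilinear form. -/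
def bilin (x : M) : LinearMap.BilinForm ℝ (TangentSpace (𝓡 n) x) :=
  LinearMap.mk₂ ℝ (fun v w => g.inner x v w) (by simp) (by simp) (by simp) (by simp)

theorem bilin_nondegenerate (x : M) : (g.bilin x).Nondegenerate :=
  ⟨fun v hv => g.nondegenerate x v hv,
    fun v hv => g.nondegenerate x v fun w => (g.symm x v w).trans (hv w)⟩

/-- The metric components in the chart at `x₀`. -/
def gram (x₀ : M) (y : Model n) : Matrix (Fin n) (Fin n) ℝ :=
  Matrix.of fun a b =>
    g.inner ((extChartAt (𝓡 n) x₀).symm y)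
      (chartInvDeriv x₀ y (coordBasis n a)) (chartInvDeriv x₀ y (coordBasis n b))

/-- The Levi-Civita covariant derivative `∇ᵥ φ` at `x`, computed in the chart at `x` and
pulled back to `M`. -/
def nabla (φ : DiffForm n M) (x : M) (v : TangentSpace (𝓡 n) x) :
    FormsOn (TangentSpace (𝓡 n) x) :=
  pullForm (chartDeriv x)
    (nablaCoord (g.gram x) (DiffForm.inChart φ x) (extChartAt (𝓡 n) x x) (chartDeriv x v))

/-- The frame `Xₐ` at `x`. -/
def lowerX (x : M) (a : Fin n) : TangentSpace (𝓡 n) x := frame x a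

/-- The metric dual frame `Xᵃ = gᵃᵇ X_b` at `x`. -/
def upperX (x : M) (a : Fin n) : TangentSpace (𝓡 n) x :=
  (g.bilin x).dualBasis (g.bilin_nondegenerate x) (frame x) a

/-- The canonical one-forms `eᵃ` at `x`, with `X_b ⌟ eᵃ = δᵃ_b`. -/
def upperE (x : M) (a : Fin n) : FormsOn (TangentSpace (𝓡 n) x) := oneForm ((frame x).coord a)

/-- The one-forms `eₐ = gₐᵦ eᵇ` at `x`. -/
def lowerE (x : M) (a : Fin n) : FormsOn (TangentSpace (𝓡 n) x) :=
  oneForm (g.bilin x (frame x a))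

/-- The Clifford product of differential forms. -/
def cliff (α β : DiffForm n M) : DiffForm n M :=
  fun x => cliffordMul (g.bilin x) (g.bilin_nondegenerate x) (α x) (β x)

/-- The Clifford commutator of differential forms. -/
def comm (α β : DiffForm n M) : DiffForm n M := g.cliff α β - g.cliff β α

/-- The contracted wedge product of differential forms. -/
def cwedge (k : ℕ) (α β : DiffForm n M) : DiffForm n M :=
  fun x => contractedWedge (g.bilin x) (g.bilin_nondegenerate x) (frame x) k (α x) (β x)

/-- `∇ₐ φ`. -/
def nablaX (a : Fin n) (φ : DiffForm n M) : DiffForm n M :=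
  fun x => g.nabla φ x (lowerX x a)

/-- `Xₐ ⌟ φ`. -/
def hookLower (a : Fin n) (φ : DiffForm n M) : DiffForm n M := fun x => hook (lowerX x a) (φ x)

/-- `Xᵃ ⌟ φ`. -/
def hookUpper (a : Fin n) (φ : DiffForm n M) : DiffForm n M :=
  fun x => hook (g.upperX x a) (φ x)

/-- `eₐ ∧ φ`. -/
def wedgeLower (a : Fin n) (φ : DiffForm n M) : DiffForm n M := fun x => g.lowerE x a * φ x

/-- `eᵃ ∧ φ`. -/
def wedgeUpper (a : Fin n) (φ : DiffForm n M) : DiffForm n M := fun x => upperE x a * φ x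

/-- The exterior derivative `d = eᵃ ∧ ∇ₐ`. -/
def d (φ : DiffForm n M) : DiffForm n M := ∑ a, wedgeUpper a (g.nablaX a φ)

/-- The co-differential `δ = - Xᵃ ⌟ ∇ₐ`. -/
def codiff (φ : DiffForm n M) : DiffForm n M := -∑ a, g.hookUpper a (g.nablaX a φ)

/-- The twistor operator
`Tₐ φ = ∇ₐ φ - (π + 1)⁻¹ Xₐ ⌟ dφ + (n - π + 1)⁻¹ eₐ ∧ δφ`. -/
def twistor (a : Fin n) (φ : DiffForm n M) : DiffForm n M :=
  g.nablaX a φ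
    - DiffForm.deg (fun p => 1 / ((p : ℝ) + 1)) (hookLower a (g.d φ))
    + DiffForm.deg (fun p => 1 / ((n : ℝ) - p + 1)) (g.wedgeLower a (g.codiff φ))

/-- Conformal Killing-Yano forms. -/
def IsCKY (φ : DiffForm n M) : Prop := φ.IsSmooth ∧ ∀ a, g.twistor a φ = 0

/-- Killing-Yano forms: co-closed conformal Killing-Yano forms. -/
def IsKY (φ : DiffForm n M) : Prop := g.IsCKY φ ∧ g.codiff φ = 0

/-- Closed conformal Killing-Yano forms. -/
def IsCCKY (φ : DiffForm n M) : Prop := g.IsCKY φ ∧ g.d φ = 0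

/-- `κ̃ = (π - 1) / (2π) dκ` for a Killing-Yano form `κ`. -/
def tildeK (κ : DiffForm n M) : DiffForm n M :=
  DiffForm.deg (fun p => ((p : ℝ) - 1) / (2 * p)) (g.d κ)

/-- `φ̃ = - (n - π - 1) / (2 (n - π)) δφ` for a closed conformal Killing-Yano form `φ`. -/
def tildeM (φ : DiffForm n M) : DiffForm n M :=
  DiffForm.deg (fun p => -(((n : ℝ) - p - 1) / (2 * ((n : ℝ) - p)))) (g.codiff φ)

/-- The Killing-Yano bracket of two odd Killing-Yano forms,
`π⁻¹ e_b ∧ {κᵃ (∇ₐ λᵇ) - λᵃ (∇ₐ κᵇ) + [κᵇ, λ̃] + [κ̃, λᵇ]}` with `κᵃ = Xᵃ ⌟ κ`, `λᵃ = Xᵃ ⌟ λ`;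
as `∇ₐ Xᵇ = 0`, `∇ₐ λᵇ = Xᵇ ⌟ ∇ₐ λ`. Juxtaposition is the Clifford product. -/
def bracketKK (κ lam : DiffForm n M) : DiffForm n M :=
  DiffForm.deg (fun p => 1 / (p : ℝ)) (∑ b, g.wedgeLower b (
    (∑ a, (g.cliff (g.hookUpper a κ) (g.hookUpper b (g.nablaX a lam))
        - g.cliff (g.hookUpper a lam) (g.hookUpper b (g.nablaX a κ))))
      + g.comm (g.hookUpper b κ) (g.tildeK lam) + g.comm (g.tildeK κ) (g.hookUpper b lam)))

/-- The Killing-Yano bracket of an odd Killing-Yano and an even closed conformal Killing-Yano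
form, `(n - π)⁻¹ X_b ⌟ {μᵃ (∇ₐ φᵇ) - φᵃ (∇ₐ μᵇ) + [μᵇ, φ̃] - [φᵇ, μ̃]}` with `μᵃ = Xᵃ ⌟ μ`,
`φᵃ = eᵃ ∧ φ`; as `∇ₐ eᵇ = 0`, `∇ₐ φᵇ = eᵇ ∧ ∇ₐ φ`. -/
def bracketKM (μ φ : DiffForm n M) : DiffForm n M :=
  DiffForm.deg (fun p => 1 / ((n : ℝ) - p)) (∑ b, hookLower b (
    (∑ a, (g.cliff (g.hookUpper a μ) (wedgeUpper b (g.nablaX a φ))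
        - g.cliff (wedgeUpper a φ) (g.hookUpper b (g.nablaX a μ))))
      + g.comm (g.hookUpper b μ) (g.tildeM φ) - g.comm (wedgeUpper b φ) (g.tildeK μ)))

/-- The Killing-Yano bracket of two even closed conformal Killing-Yano forms,
`π⁻¹ e_b ∧ {αᵃ (∇ₐ βᵇ) - βᵃ (∇ₐ αᵇ) + [αᵇ, β̃] - [βᵇ, α̃]}` with `αᵃ = eᵃ ∧ α`, `βᵃ = eᵃ ∧ β`. -/
def bracketMM (α β : DiffForm n M) : DiffForm n M :=
  DiffForm.deg (fun p => 1 / (p : ℝ)) (∑ b, g.wedgeLower b (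
    (∑ a, (g.cliff (wedgeUpper a α) (wedgeUpper b (g.nablaX a β))
        - g.cliff (wedgeUpper a β) (wedgeUpper b (g.nablaX a α))))
      + g.comm (wedgeUpper b α) (g.tildeM β) - g.comm (wedgeUpper b β) (g.tildeM α)))

/-! The (co-)potentials. The sums over `k` are finite: contracted wedge products of order larger
than `n` vanish, so that the summation may stop at `k = n`. -/

/-- `∑ₖ (-1)ᵏ / (2k+1)! (π κ) ∧₂ₖ (π λ)`. -/
def potentialKK (κ lam : DiffForm n M) : DiffForm n M :=
  ∑ k ∈ Finset.range (n + 1), ((-1 : ℝ) ^ k / ((2 * k + 1).factorial : ℝ)) •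
    g.cwedge (2 * k) (DiffForm.deg (fun p => (p : ℝ)) κ) (DiffForm.deg (fun p => (p : ℝ)) lam)

/-- `∑ₖ (-1)ᵏ / (2k+1)! ((π - 2k)⁻¹ π μ) ∧₂ₖ₊₁ ((n - π) φ)`. -/
def potentialKM (μ φ : DiffForm n M) : DiffForm n M :=
  ∑ k ∈ Finset.range (n + 1), ((-1 : ℝ) ^ k / ((2 * k + 1).factorial : ℝ)) •
    g.cwedge (2 * k + 1) (DiffForm.deg (fun p => ((p : ℝ) - 2 * k)⁻¹ * p) μ)
      (DiffForm.deg (fun p => (n : ℝ) - p) φ)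

/-- `∑ₖ (-1)ᵏ / (2k+1)! (n - π - 2k)⁻¹ (((n - π) α) ∧₂ₖ₊₁ ((n - π) β))`. -/
def potentialMM (α β : DiffForm n M) : DiffForm n M :=
  ∑ k ∈ Finset.range (n + 1), ((-1 : ℝ) ^ k / ((2 * k + 1).factorial : ℝ)) •
    DiffForm.deg (fun p => ((n : ℝ) - p - 2 * k)⁻¹)
      (g.cwedge (2 * k + 1) (DiffForm.deg (fun p => (n : ℝ) - p) α)
        (DiffForm.deg (fun p => (n : ℝ) - p) β))

end PseudoRiemannianMetric

/-- None of the denominators `n - π - 2k` in the co-potential of `α` and `β` can vanish: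
the product of order `2k+1` of parts of degrees `p` and `q` has degree `p + q - 2 (2k+1)`, and
`n - (p + q - 2 (2k+1)) - 2k ≠ 0` for all degrees `p` of `(n - π) α` and `q` of `(n - π) β`. -/
def DenominatorsNonvanishing (α β : DiffForm n M) : Prop :=
  ∀ p q k : ℕ,
    DiffForm.part p (DiffForm.deg (fun r => (n : ℝ) - r) α) ≠ 0 →
    DiffForm.part q (DiffForm.deg (fun r => (n : ℝ) - r) β) ≠ 0 →
    (n : ℤ) - ((p : ℤ) + q - 2 * (2 * k + 1)) - 2 * k ≠ 0

end Manifold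

end KillingYano

end

open KillingYano

open scoped Manifold ContDiff ExteriorAlgebra

set_option linter.unusedSectionVars false

noncomputable section

namespace KillingYano

/-! ### Exterior and inner multiplication inside a Clifford algebra -/

section Clifford

variable {W : Type*} [AddCommGroup W] [Module ℝ W] {Q : QuadraticForm ℝ W}

open CliffordAlgebra (ι involute involute_ι)

/-! An odd KY form (`σ = false`) satisfies ∇_a φ = X_a ⌟ Φ with Φ = π⁻¹ dφ, and an even CCKY form
(`σ = true`) satisfies ∇_a φ = e_a ∧ Φ with Φ = -(n - π)⁻¹ δφ. Write φ^a for X^a ⌟ φ, respectively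
e^a ∧ φ, and N_σ for the number operator π, respectively n - π. Then the tilde form is ½ (N_σ - 1) Φ
in both cases, and the three brackets are instances of a single computation.

Inside the Clifford algebra, the wedge product and the inner derivative by a vector e are ½ (e x ±
η(x) e), where η is the main involution. The Leibniz rules of these operators show that one half of
a bracket, φ^a ∇_a ψ^b + [φ^b, ψ̃] contracted with e_b ∧ or X_b ⌟, equals ½ [N_σ φ, (N_τ - 1) Ψ] - ½
e^b C(φ, ∇_b ψ) with C(α, β) = [α^a, β_a] (`sum_cliffOp_bracket`, `HasTwistor.sum_halfBracket`). The
operation C is parallel, because 4 C(α, β) = [Tα, β] + [α, Tβ] + T[α, β] + n [α, β] with Tx = e^a x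
e_a = (n - 2π)(-1)^π x (`sum_commHom_formOp`). It is also antisymmetric, so differentiating the
assumption C(φ, ψ) = 0 gives C(φ, ∇_b ψ) = C(ψ, ∇_b φ). These terms cancel between the two halves,
and only algebraic commutators remain (`HasTwistor.sum_bracket`).

On the other side, the Clifford product expands in contracted wedge products (`cliffHom_eq`), and on
forms of definite parity a commutator is, up to sign, twice the sum over even or over odd orders.
The derivative of a potential is found by the Leibniz rule. Contracting it with the frame shifts the
order by at most one and produces number operators, and the coefficients of the potentials are such
that the same sums appear (`sum_hook_potKK`, `sum_oneForm_mul_potKM_right`,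
`sum_oneForm_mul_potKM_left`, `sum_hook_potMM`).

The Leibniz rule for contracted wedge products is a coordinate computation resting on metric
compatibility of the Christoffel symbols (`fderiv_inv_metric`, `partialForm_cwMat`,
`isParallelBilin_cwAt`). Clifford products, C and the potentials are built from contracted wedge
products and degree operators and inherit it. -/

theorem contractLeft_mul (f : Module.Dual ℝ W) (a b : CliffordAlgebra Q) :
    CliffordAlgebra.contractLeft f (a * b) =
      CliffordAlgebra.contractLeft f a * b + involute a * CliffordAlgebra.contractLeft f b := by
  induction a using CliffordAlgebra.left_induction with
  | algebraMap r => simp [CliffordAlgebra.contractLeft_algebraMap_mul]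
  | add x y hx hy => simp only [add_mul, map_add, hx, hy]; abel
  | ι_mul x w hx =>
    rw [mul_assoc, CliffordAlgebra.contractLeft_ι_mul, hx, CliffordAlgebra.contractLeft_ι_mul,
      map_mul, involute_ι]
    simp only [mul_add, sub_mul, smul_mul_assoc, mul_assoc, neg_mul]
    abel

theorem involute_contractLeft (f : Module.Dual ℝ W) (a : CliffordAlgebra Q) :
    involute (CliffordAlgebra.contractLeft f a) =
      -CliffordAlgebra.contractLeft f (involute a) := by
  induction a using CliffordAlgebra.left_induction with
  | algebraMap r => simp
  | add x y hx hy => simp only [map_add, hx, hy]; abel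
  | ι_mul x w hx =>
    simp only [CliffordAlgebra.contractLeft_ι_mul, map_mul, map_sub, map_smul, involute_ι, hx,
      neg_mul, map_neg, mul_neg]
    abel

/-- The operators `½ (w a + σ η(a) w)`: the exterior product with `w` for `σ = 1`, the inner
derivative by the dual vector of `w` for `σ = -1`. -/
def cliffOp (σ : ℝ) : W →ₗ[ℝ] CliffordAlgebra Q →ₗ[ℝ] CliffordAlgebra Q :=
  (1 / 2 : ℝ) • ((LinearMap.mul ℝ (CliffordAlgebra Q)).comp (ι Q) +
    σ • ((LinearMap.mul ℝ (CliffordAlgebra Q)).flip.comp (ι Q)).compl₂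
      (involute (Q := Q)).toLinearMap)

theorem cliffOp_apply (σ : ℝ) (w : W) (a : CliffordAlgebra Q) :
    cliffOp σ w a = (1 / 2 : ℝ) • (ι Q w * a + σ • (involute a * ι Q w)) := rfl

/-- The inner terms ½ σ η(a) w b cancel. Only the product of the two signs is prescribed on the
left, so an operator applied to a product has two Leibniz rules, one for each way to split its sign.
-/
theorem cliffOp_mul (σ τ : ℝ) (w : W) (a b : CliffordAlgebra Q) :
    cliffOp (-(σ * τ)) w (a * b) = cliffOp σ w a * b - σ • (involute a * cliffOp τ w b) := by
  simp only [cliffOp_apply, map_mul, add_mul, mul_add, smul_mul_assoc, mul_smul_comm, smul_add,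
    mul_assoc]
  module

theorem ι_mul_eq_cliffOp (σ : ℝ) (w : W) (a : CliffordAlgebra Q) :
    ι Q w * a = cliffOp σ w a + cliffOp (-σ) w a := by
  simp only [cliffOp_apply]
  module

theorem involute_cliffOp (σ : ℝ) (w : W) (a : CliffordAlgebra Q) :
    involute (cliffOp σ w a) = -cliffOp σ w (involute a) := by
  simp only [cliffOp_apply, map_smul, map_add, map_mul, involute_ι]
  simp only [mul_neg, neg_mul]
  module

/-- After symmetrising in `w` and `w'` the mixed terms cancel. What is left is the scalar w w' + w'
w acting from the left, minus σ² = 1 times the same scalar acting from the right. -/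
theorem cliffOp_cliffOp_anticomm {σ : ℝ} (hσ : σ * σ = 1) (w w' : W) (a : CliffordAlgebra Q) :
    cliffOp σ w (cliffOp σ w' a) = -cliffOp σ w' (cliffOp σ w a) := by
  have h1 : ι Q w * (ι Q w' * a) + ι Q w' * (ι Q w * a)
      = (QuadraticMap.polar Q w w') • a := by
    rw [← mul_assoc, ← mul_assoc, ← add_mul, CliffordAlgebra.ι_mul_ι_add_swap, Algebra.smul_def]
  have h2 : a * (ι Q w * ι Q w') + a * (ι Q w' * ι Q w)
      = (QuadraticMap.polar Q w w') • a := by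
    rw [← mul_add, CliffordAlgebra.ι_mul_ι_add_swap, Algebra.smul_def, Algebra.commutes]
  have h3 := h1.trans h2.symm
  rw [eq_neg_iff_add_eq_zero]
  simp only [cliffOp_apply, map_smul, map_add, map_mul, involute_ι, smul_add,
    mul_assoc, neg_mul, mul_neg, CliffordAlgebra.involute_involute]
  have h4 := eq_sub_of_add_eq h3
  rw [h4]
  rcases mul_self_eq_one_iff.mp hσ with rfl | rfl <;> module

/-- For an element of this parity `cliffOp σ w` is half the commutator with `w`. -/
theorem mul_ι_eq_cliffOp {σ : ℝ} (hσ : σ * σ = 1) (w : W) {a : CliffordAlgebra Q}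
    (ha : involute a = -(σ • a)) :
    ι Q w * a = (2 : ℝ) • cliffOp σ w a + a * ι Q w := by
  simp only [cliffOp_apply, ha, neg_mul, smul_neg, smul_mul_assoc, smul_smul, hσ]
  module

variable {n : ℕ}

/-- A symmetric tensor is contracted with an anticommuting pair of operators. -/
theorem sum_cliffOp_cliffOp_eq_zero {σ : ℝ} (hσ : σ * σ = 1) {u v : Fin n → W}
    (hswap : ∀ f : W →ₗ[ℝ] W →ₗ[ℝ] CliffordAlgebra Q,
      ∑ a, f (u a) (v a) = ∑ a, f (v a) (u a)) (x : CliffordAlgebra Q) :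
    ∑ b, cliffOp σ (u b) (cliffOp σ (v b) x) = 0 := by
  have h := hswap ((cliffOp σ).compl₁₂ LinearMap.id ((cliffOp σ).flip x))
  simp only [LinearMap.compl₁₂_apply, LinearMap.id_apply, LinearMap.flip_apply] at h
  have h2 : ∑ b, cliffOp σ (v b) (cliffOp σ (u b) x)
      = -∑ b, cliffOp σ (u b) (cliffOp σ (v b) x) := by
    rw [← Finset.sum_neg_distrib]
    exact Finset.sum_congr rfl fun b _ => cliffOp_cliffOp_anticomm hσ _ _ _
  rw [h2] at h
  have h3 : (2 : ℝ) • ∑ b, cliffOp σ (u b) (cliffOp σ (v b) x) = 0 := by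
    rw [two_smul]; nth_rewrite 1 [h]; exact neg_add_cancel _
  exact (smul_eq_zero.mp h3).resolve_left two_ne_zero

/-- The algebraic part common to the three brackets. -/
theorem sum_cliffOp_bracket {σ τ : ℝ} (hσ : σ * σ = 1) (hτ : τ * τ = 1) {u v : Fin n → W}
    (hswap : ∀ f : W →ₗ[ℝ] W →ₗ[ℝ] CliffordAlgebra Q,
      ∑ a, f (u a) (v a) = ∑ a, f (v a) (u a))
    {α β β' : CliffordAlgebra Q} (hα : involute α = σ • α)
    (hβ' : involute β' = -(τ • β'))
    (hN : ∀ w, ∑ b, cliffOp (-τ) (u b) (cliffOp τ (v b) (cliffOp τ w β))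
      = (2 : ℝ) • cliffOp τ w β') :
    ∑ b, cliffOp (σ * τ) (u b)
        (∑ a, cliffOp σ (v a) α * cliffOp τ (v b) (cliffOp τ (u a) β) +
          (cliffOp σ (v b) α * β' - β' * cliffOp σ (v b) α)) =
      (∑ b, cliffOp (-σ) (u b) (cliffOp σ (v b) α)) * β' -
        β' * (∑ b, cliffOp (-σ) (u b) (cliffOp σ (v b) α)) -
      (1 / 2 : ℝ) • ∑ b, ι Q (v b) * ∑ a, (cliffOp σ (v a) α * cliffOp τ (u a) (cliffOp τ (u b) β) -
        cliffOp τ (u a) (cliffOp τ (u b) β) * cliffOp σ (v a) α) := by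
  have hα' : ∀ w, involute (cliffOp σ w α) = -(σ • cliffOp σ w α) := by
    intro w; rw [involute_cliffOp, hα, map_smul]
  -- The sign σ τ is split in two ways. `r1` leaves `cliffOp (-τ)` on the second factor, where it
  -- will complete the number operator of `hN`; `r2` and `r3` leave `cliffOp (-σ)` on the factor
  -- `cliffOp σ x α`, where it completes the number operator on `α`.
  have r1 : ∀ w x y, cliffOp (σ * τ) w (cliffOp σ x α * y) =
      cliffOp σ w (cliffOp σ x α) * y + cliffOp σ x α * cliffOp (-τ) w y := by
    intro w x y
    have := cliffOp_mul σ (-τ) w (cliffOp σ x α) y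
    rw [hα', neg_mul, smul_neg, smul_mul_assoc, smul_smul, hσ, mul_neg, neg_neg] at this
    rw [this]; module
  have r2 : ∀ w x y, cliffOp (σ * τ) w (cliffOp σ x α * y) =
      cliffOp (-σ) w (cliffOp σ x α) * y - cliffOp σ x α * cliffOp τ w y := by
    intro w x y
    have := cliffOp_mul (-σ) τ w (cliffOp σ x α) y
    rw [hα', neg_mul, neg_mul, neg_neg, smul_mul_assoc, smul_neg, neg_smul, neg_neg, smul_smul,
      hσ] at this
    rw [this]; module
  have r3 : ∀ w y, cliffOp (σ * τ) w (β' * y) =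
      cliffOp τ w β' * y + β' * cliffOp (-σ) w y := by
    intro w y
    have := cliffOp_mul τ (-σ) w β' y
    rw [hβ', neg_mul, smul_mul_assoc, smul_neg, smul_smul, hτ] at this
    rw [show σ * τ = -(τ * -σ) by ring, this]; module
  have hsw : ∀ x z, ∑ b, cliffOp σ (v b) (cliffOp σ x α) * cliffOp τ (u b) z =
      ∑ b, cliffOp σ (u b) (cliffOp σ x α) * cliffOp τ (v b) z := by
    intro x z
    have h := hswap ((LinearMap.mul ℝ (CliffordAlgebra Q)).compl₁₂
      ((cliffOp σ).flip (cliffOp σ x α)) ((cliffOp τ).flip z))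
    simpa using h.symm
  have hswN : ∀ z : CliffordAlgebra Q, ∑ b, cliffOp (-τ) (v b) (cliffOp τ (u b) z) =
      ∑ b, cliffOp (-τ) (u b) (cliffOp τ (v b) z) := by
    intro z
    have h := hswap ((cliffOp (-τ)).compl₁₂ LinearMap.id ((cliffOp τ).flip z))
    simpa using h.symm
  -- Clifford multiplication by `v b` is the sum of its two operators. The one of sign τ
  -- anticommutes with its neighbour and sums to zero; the one of sign -τ forms the number operator
  -- evaluated in `hN`.
  have hZ : ∀ a, ∑ b, ι Q (v b) * cliffOp τ (u a) (cliffOp τ (u b) β) =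
      -((2 : ℝ) • cliffOp τ (u a) β') := by
    intro a
    have : ∀ b, ι Q (v b) * cliffOp τ (u a) (cliffOp τ (u b) β) =
        -(cliffOp τ (v b) (cliffOp τ (u b) (cliffOp τ (u a) β)) +
          cliffOp (-τ) (v b) (cliffOp τ (u b) (cliffOp τ (u a) β))) := by
      intro b
      rw [cliffOp_cliffOp_anticomm hτ (u a) (u b), mul_neg, ι_mul_eq_cliffOp τ]
    simp only [this, Finset.sum_neg_distrib, Finset.sum_add_distrib]
    rw [hswN, hN, sum_cliffOp_cliffOp_eq_zero hτ (fun f => (hswap f).symm), zero_add]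
  -- `v b` is moved past `cliffOp σ (v a) α` at the cost of a commutator term, so that it meets the
  -- second factor and `hZ` applies.
  have hC : ∑ b, ι Q (v b) * ∑ a, (cliffOp σ (v a) α * cliffOp τ (u a) (cliffOp τ (u b) β) -
        cliffOp τ (u a) (cliffOp τ (u b) β) * cliffOp σ (v a) α) =
      ∑ a, (-((2 : ℝ) • ∑ b, cliffOp σ (u b) (cliffOp σ (v a) α) *
          cliffOp τ (v b) (cliffOp τ (u a) β)) +
        (-((2 : ℝ) • (cliffOp σ (v a) α * cliffOp τ (u a) β')) +
          (2 : ℝ) • (cliffOp τ (u a) β' * cliffOp σ (v a) α))) := by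
    simp only [Finset.mul_sum]
    rw [Finset.sum_comm]
    refine Finset.sum_congr rfl fun a _ => ?_
    have h1 : ∀ b, ι Q (v b) * (cliffOp σ (v a) α * cliffOp τ (u a) (cliffOp τ (u b) β) -
        cliffOp τ (u a) (cliffOp τ (u b) β) * cliffOp σ (v a) α) =
        -((2 : ℝ) • (cliffOp σ (v b) (cliffOp σ (v a) α) *
          cliffOp τ (u b) (cliffOp τ (u a) β))) +
        (cliffOp σ (v a) α * (ι Q (v b) * cliffOp τ (u a) (cliffOp τ (u b) β)) -
        (ι Q (v b) * cliffOp τ (u a) (cliffOp τ (u b) β)) * cliffOp σ (v a) α) := by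
      intro b
      rw [mul_sub, ← mul_assoc, mul_ι_eq_cliffOp hσ (v b) (hα' (v a)), add_mul, smul_mul_assoc,
        cliffOp_cliffOp_anticomm hτ (u b) (u a)]
      simp only [mul_assoc, mul_neg, smul_neg, neg_neg]
      abel
    simp only [h1]
    rw [Finset.sum_add_distrib, Finset.sum_sub_distrib, ← Finset.mul_sum, ← Finset.sum_mul, hZ,
      Finset.sum_neg_distrib, ← Finset.smul_sum, hsw]
    simp only [mul_neg, neg_mul, mul_smul_comm, smul_mul_assoc]
    abel
  have hL : ∀ b, cliffOp (σ * τ) (u b)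
        (∑ a, cliffOp σ (v a) α * cliffOp τ (v b) (cliffOp τ (u a) β) +
          (cliffOp σ (v b) α * β' - β' * cliffOp σ (v b) α)) =
      ∑ a, cliffOp σ (u b) (cliffOp σ (v a) α) * cliffOp τ (v b) (cliffOp τ (u a) β) +
      ∑ a, cliffOp σ (v a) α * cliffOp (-τ) (u b) (cliffOp τ (v b) (cliffOp τ (u a) β)) +
      (cliffOp (-σ) (u b) (cliffOp σ (v b) α) * β' - cliffOp σ (v b) α * cliffOp τ (u b) β' -
      (cliffOp τ (u b) β' * cliffOp σ (v b) α + β' * cliffOp (-σ) (u b) (cliffOp σ (v b) α))) := by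
    intro b
    rw [map_add, map_sub, map_sum, r2, r3]
    simp only [r1, Finset.sum_add_distrib]
  rw [hC]
  simp only [hL, Finset.sum_add_distrib, Finset.sum_sub_distrib, Finset.sum_neg_distrib,
    ← Finset.smul_sum, ← Finset.sum_mul, ← Finset.mul_sum]
  have h2 : ∑ b, ∑ a, cliffOp σ (v a) α * cliffOp (-τ) (u b) (cliffOp τ (v b) (cliffOp τ (u a) β))
      = (2 : ℝ) • ∑ a, cliffOp σ (v a) α * cliffOp τ (u a) β' := by
    rw [Finset.sum_comm, Finset.smul_sum]
    refine Finset.sum_congr rfl fun a _ => ?_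
    rw [← Finset.mul_sum, hN, mul_smul_comm]
  rw [h2, Finset.sum_comm (f := fun b a => cliffOp σ (u b) (cliffOp σ (v a) α) *
    cliffOp τ (v b) (cliffOp τ (u a) β))]
  module

end Clifford

end KillingYano

namespace KillingYano

/-! ### Exterior and inner products -/

section Forms

variable {V : Type*} [AddCommGroup V] [Module ℝ V]

open CliffordAlgebra (ι involute involute_ι)

/-- The main involution `(-1)^π` of forms. -/
def gradeInv : FormsOn V →ₐ[ℝ] FormsOn V :=
  CliffordAlgebra.involute (Q := (0 : QuadraticForm ℝ (Module.Dual ℝ V)))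

theorem gradeInv_oneForm (θ : Module.Dual ℝ V) : gradeInv (oneForm θ) = -oneForm θ :=
  involute_ι θ

theorem gradeInv_gradeInv (α : FormsOn V) : gradeInv (gradeInv α) = α :=
  CliffordAlgebra.involute_involute α

theorem hook_oneForm_mul (v : V) (θ : Module.Dual ℝ V) (α : FormsOn V) :
    hook v (oneForm θ * α) = θ v • α - oneForm θ * hook v α :=
  CliffordAlgebra.contractLeft_ι_mul _ _ _

theorem hook_mul (v : V) (α β : FormsOn V) :
    hook v (α * β) = hook v α * β + gradeInv α * hook v β :=
  contractLeft_mul _ _ _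

theorem hook_algebraMap (v : V) (r : ℝ) : hook v (algebraMap ℝ (FormsOn V) r) = 0 :=
  CliffordAlgebra.contractLeft_algebraMap _ _ _

theorem gradeInv_hook (v : V) (α : FormsOn V) : gradeInv (hook v α) = -hook v (gradeInv α) :=
  involute_contractLeft _ _

theorem hook_hook_anticomm (v w : V) (α : FormsOn V) :
    hook v (hook w α) = -hook w (hook v α) :=
  CliffordAlgebra.contractLeft_comm _ _ _

theorem hook_add_left (v w : V) (α : FormsOn V) : hook (v + w) α = hook v α + hook w α := by
  simp [hook]

theorem hook_smul_left (r : ℝ) (v : V) (α : FormsOn V) : hook (r • v) α = r • hook v α := by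
  simp [hook]

/-- The inner derivative as a bilinear map. -/
def hookHom : V →ₗ[ℝ] FormsOn V →ₗ[ℝ] FormsOn V :=
  LinearMap.mk₂ ℝ (fun v α => hook v α) hook_add_left hook_smul_left
    (fun v => map_add (hook v)) (fun r v => map_smul (hook v) r)

@[simp] theorem hookHom_apply (v : V) (α : FormsOn V) : hookHom v α = hook v α := rfl

theorem oneForm_smul (r : ℝ) (θ : Module.Dual ℝ V) : oneForm (r • θ) = r • oneForm θ :=
  map_smul _ _ _

theorem oneForm_sum {ι : Type*} (s : Finset ι) (θ : ι → Module.Dual ℝ V) :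
    oneForm (∑ i ∈ s, θ i) = ∑ i ∈ s, oneForm (θ i) :=
  map_sum _ _ _

theorem oneForm_mul_gradeInv (θ : Module.Dual ℝ V) (α : FormsOn V) :
    oneForm θ * gradeInv α = α * oneForm θ := by
  induction α using CliffordAlgebra.left_induction with
  | algebraMap r =>
    rw [AlgHom.commutes]; exact (Algebra.commutes _ _).symm
  | add x y hx hy => rw [map_add, mul_add, hx, hy, add_mul]
  | ι_mul x w hx =>
    change oneForm θ * gradeInv (oneForm w * x) = oneForm w * x * oneForm θ
    rw [map_mul, gradeInv_oneForm, mul_assoc, ← hx, ← mul_assoc, ← mul_assoc]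
    congr 1
    rw [mul_neg, neg_eq_iff_add_eq_zero]
    exact ExteriorAlgebra.ι_add_mul_swap θ w

/-- Operators on forms are compared below through their behaviour under left wedge multiplication by
a covector. -/
theorem forms_induction {C : FormsOn V → Prop} (algebraMap : ∀ r : ℝ, C (algebraMap ℝ _ r))
    (add : ∀ x y, C x → C y → C (x + y)) (oneForm_mul : ∀ θ x, C x → C (oneForm θ * x))
    (x : FormsOn V) : C x := by
  induction x using CliffordAlgebra.left_induction with
  | algebraMap r => exact algebraMap r
  | add x y hx hy => exact add x y hx hy
  | ι_mul x θ h => exact oneForm_mul θ x h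

/-! ### Homogeneous parts -/

theorem homPart_oneForm_mul_succ (p : ℕ) (θ : Module.Dual ℝ V) (α : FormsOn V) :
    homPart (p + 1) (oneForm θ * α) = oneForm θ * homPart p α := by
  have hθ : oneForm θ ∈ (fun i : ℕ => ⋀[ℝ]^i (Module.Dual ℝ V)) 1 := by
    simp [oneForm, ExteriorAlgebra.exteriorPower]
  simp only [homPart, GradedAlgebra.proj_apply]
  rw [add_comm p 1]
  exact DirectSum.coe_decompose_mul_add_of_left_mem (fun i : ℕ => ⋀[ℝ]^i (Module.Dual ℝ V)) hθ

theorem homPart_oneForm_mul_zero (θ : Module.Dual ℝ V) (α : FormsOn V) :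
    homPart 0 (oneForm θ * α) = 0 := by
  have hθ : oneForm θ ∈ (fun i : ℕ => ⋀[ℝ]^i (Module.Dual ℝ V)) 1 := by
    simp [oneForm, ExteriorAlgebra.exteriorPower]
  simp only [homPart, GradedAlgebra.proj_apply]
  exact DirectSum.coe_decompose_mul_of_left_mem_of_not_le
    (fun i : ℕ => ⋀[ℝ]^i (Module.Dual ℝ V)) hθ (by simp)

theorem homPart_algebraMap (p : ℕ) (r : ℝ) :
    homPart p (algebraMap ℝ (FormsOn V) r) = if p = 0 then algebraMap ℝ (FormsOn V) r else 0 := by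
  simp only [homPart, GradedAlgebra.proj_apply]
  have h0 : algebraMap ℝ (FormsOn V) r ∈ (fun i : ℕ => ⋀[ℝ]^i (Module.Dual ℝ V)) 0 := by
    simp [ExteriorAlgebra.exteriorPower]
  split_ifs with h
  · subst h; exact DirectSum.decompose_of_mem_same (fun i : ℕ => ⋀[ℝ]^i (Module.Dual ℝ V)) h0
  · exact DirectSum.decompose_of_mem_ne (fun i : ℕ => ⋀[ℝ]^i (Module.Dual ℝ V)) h0 (Ne.symm h)

theorem homPart_homPart (p q : ℕ) (α : FormsOn V) :
    homPart p (homPart q α) = if p = q then homPart q α else 0 := by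
  simp only [homPart, GradedAlgebra.proj_apply]
  split_ifs with h
  · subst h
    exact DirectSum.decompose_of_mem_same (fun i : ℕ => ⋀[ℝ]^i (Module.Dual ℝ V))
      (SetLike.coe_mem _)
  · exact DirectSum.decompose_of_mem_ne (fun i : ℕ => ⋀[ℝ]^i (Module.Dual ℝ V))
      (SetLike.coe_mem _) (Ne.symm h)

theorem form_ext {α β : FormsOn V} (h : ∀ p, homPart p α = homPart p β) : α = β := by
  apply (DirectSum.decompose (fun i : ℕ => ⋀[ℝ]^i (Module.Dual ℝ V))).injective
  refine DFinsupp.ext fun p => Subtype.ext ?_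
  simpa [homPart, GradedAlgebra.proj_apply] using h p

theorem homPart_hook (p : ℕ) (v : V) (α : FormsOn V) :
    homPart p (hook v α) = hook v (homPart (p + 1) α) := by
  induction α using forms_induction generalizing p with
  | algebraMap r => simp [homPart_algebraMap, hook_algebraMap]
  | add x y hx hy => simp only [map_add, hx, hy]
  | oneForm_mul θ x hx =>
    rw [hook_oneForm_mul, homPart_oneForm_mul_succ, hook_oneForm_mul, map_sub, map_smul]
    cases p with
    | zero =>
      rw [homPart_oneForm_mul_zero]
      have : hook v (homPart 0 x) = 0 := by
        clear hx
        induction x using forms_induction with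
        | algebraMap r => simp [homPart_algebraMap, hook_algebraMap]
        | add x y hx hy => simp only [map_add, hx, hy, add_zero]
        | oneForm_mul θ x hx => simp [homPart_oneForm_mul_zero]
      rw [this, mul_zero]
    | succ p => rw [homPart_oneForm_mul_succ, hx]

theorem hook_homPart_zero (v : V) (α : FormsOn V) : hook v (homPart 0 α) = 0 := by
  induction α using forms_induction with
  | algebraMap r => simp [homPart_algebraMap, hook_algebraMap]
  | add x y hx hy => simp only [map_add, hx, hy, add_zero]
  | oneForm_mul θ x hx => simp [homPart_oneForm_mul_zero]

theorem homPart_gradeInv (p : ℕ) (α : FormsOn V) :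
    homPart p (gradeInv α) = (-1 : ℝ) ^ p • homPart p α := by
  induction α using forms_induction generalizing p with
  | algebraMap r =>
    rw [AlgHom.commutes, homPart_algebraMap]
    split_ifs with h
    · subst h; simp
    · simp
  | add x y hx hy => simp only [map_add, hx, hy, smul_add]
  | oneForm_mul θ x hx =>
    cases p with
    | zero => rw [map_mul, gradeInv_oneForm, neg_mul, map_neg]; simp [homPart_oneForm_mul_zero]
    | succ p =>
      rw [map_mul, gradeInv_oneForm, neg_mul, map_neg, homPart_oneForm_mul_succ,
        homPart_oneForm_mul_succ, hx, pow_succ, mul_smul_comm]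
      simp

end Forms

end KillingYano

namespace KillingYano

/-! ### Metric dual bases -/

section DualBasis

variable {V : Type*} [AddCommGroup V] [Module ℝ V] [FiniteDimensional ℝ V]
  {E : Type*} [AddCommGroup E] [Module ℝ E]
  (B : LinearMap.BilinForm ℝ V) (hB : B.Nondegenerate) {n : ℕ} (X : Module.Basis (Fin n) ℝ V)

theorem sum_apply_smul_dualBasis (v : V) : ∑ a, B v (X a) • B.dualBasis hB X a = v := by
  conv_rhs => rw [← (B.dualBasis hB X).sum_repr v]
  simp only [LinearMap.BilinForm.dualBasis_repr_apply]

theorem coord_eq_apply_dualBasis (a : Fin n) : X.coord a = B (B.dualBasis hB X a) := by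
  refine X.ext fun b => ?_
  rw [LinearMap.BilinForm.apply_dualBasis_left, Module.Basis.coord_apply, X.repr_self,
    Finsupp.single_apply]

variable {B}

theorem sum_apply_dualBasis_smul (hs : B.IsSymm) (v : V) :
    ∑ a, B v (B.dualBasis hB X a) • X a = v := by
  have h := sum_apply_smul_dualBasis B hB (B.dualBasis hB X) v
  rwa [LinearMap.BilinForm.dualBasis_dualBasis hB hs] at h

/-- The tensor X_a ⊗ X^a is the inverse metric: the coefficients of X_a in the basis `Y` are its
pairings with Y^b, and moved to the other slot they reassemble Y^b. Contractions are thereby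
independent of the frame, which at each point is merely that of the chart centred there. -/
theorem sum_basis_dualBasis_eq (hs : B.IsSymm) (Y : Module.Basis (Fin n) ℝ V)
    (f : V →ₗ[ℝ] V →ₗ[ℝ] E) :
    ∑ a, f (X a) (B.dualBasis hB X a) = ∑ b, f (Y b) (B.dualBasis hB Y b) := by
  have h1 : ∀ a, f (X a) (B.dualBasis hB X a) =
      ∑ b, f (Y b) (B (B.dualBasis hB Y b) (X a) • B.dualBasis hB X a) := by
    intro a
    conv_lhs => rw [← sum_apply_dualBasis_smul hB Y hs (X a)]
    simp only [map_sum, LinearMap.sum_apply, map_smul, LinearMap.smul_apply]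
    exact Finset.sum_congr rfl fun b _ => by rw [hs.eq]
  simp only [h1]
  rw [Finset.sum_comm]
  refine Finset.sum_congr rfl fun b _ => ?_
  rw [← map_sum, sum_apply_smul_dualBasis]

theorem sum_basis_dualBasis_swap (hs : B.IsSymm) (f : V →ₗ[ℝ] V →ₗ[ℝ] E) :
    ∑ a, f (X a) (B.dualBasis hB X a) = ∑ a, f (B.dualBasis hB X a) (X a) := by
  have h := sum_basis_dualBasis_eq hB X hs (B.dualBasis hB X) f
  rwa [LinearMap.BilinForm.dualBasis_dualBasis hB hs] at h

/-- This is X^a = g^{ab} X_b, the form in which the dual frame enters coordinate computations.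
Naming the basis vectors by a separate function `Y` lets them be images of coordinate vectors. -/
theorem dualBasis_eq_sum_inv_gram (Y : Fin n → V) (hY : ⇑X = Y) (a : Fin n) :
    B.dualBasis hB X a = ∑ b, (Matrix.of fun c d => B (Y c) (Y d))⁻¹ a b • Y b := by
  subst hY
  set G : Matrix (Fin n) (Fin n) ℝ := Matrix.of fun c d => B (X c) (X d) with hG
  have h1 : ∀ c, X c = ∑ d, G c d • B.dualBasis hB X d := fun c =>
    (sum_apply_smul_dualBasis B hB X (X c)).symm
  have hdet : IsUnit G.det := by
    have h2 : (Matrix.of fun c d => X.repr (B.dualBasis hB X c) d) * G = 1 := by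
      ext c d
      have h3 : B (B.dualBasis hB X c) (X d) = _ := LinearMap.BilinForm.apply_dualBasis_left hB X c d
      rw [← X.sum_repr (B.dualBasis hB X c)] at h3
      simp only [map_sum, LinearMap.sum_apply, map_smul, LinearMap.smul_apply] at h3
      rw [Matrix.mul_apply, Matrix.one_apply]
      simpa [hG, eq_comm] using h3
    exact Matrix.isUnit_det_of_left_inverse h2
  calc B.dualBasis hB X a = ∑ d, (G⁻¹ * G) a d • B.dualBasis hB X d := by
        rw [Matrix.nonsing_inv_mul G hdet]
        simp [Matrix.one_apply]
    _ = ∑ b, G⁻¹ a b • X b := by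
        simp only [Matrix.mul_apply, Finset.sum_smul]
        rw [Finset.sum_comm]
        refine Finset.sum_congr rfl fun b _ => ?_
        conv_rhs => rw [h1 b]
        simp only [Finset.smul_sum, smul_smul]

end DualBasis

/-! ### Contracted wedge products -/

section ContractedWedge

variable {V : Type*} [AddCommGroup V] [Module ℝ V] [FiniteDimensional ℝ V]
  (B : LinearMap.BilinForm ℝ V) (hB : B.Nondegenerate) {n : ℕ} (X : Module.Basis (Fin n) ℝ V)

/-- The contracted wedge product as a bilinear map. -/
def cwHom : ℕ → FormsOn V →ₗ[ℝ] FormsOn V →ₗ[ℝ] FormsOn V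
  | 0 => LinearMap.mul ℝ (FormsOn V)
  | k + 1 => ∑ a, (cwHom k).compl₁₂ (hook (X a)) (hook (B.dualBasis hB X a))

theorem cwHom_apply (k : ℕ) (α β : FormsOn V) :
    cwHom B hB X k α β = contractedWedge B hB X k α β := by
  induction k generalizing α β with
  | zero => rfl
  | succ k ih => simp [cwHom, contractedWedge, ih]

theorem cwHom_zero (α β : FormsOn V) : cwHom B hB X 0 α β = α * β := rfl

theorem cwHom_succ (k : ℕ) (α β : FormsOn V) : cwHom B hB X (k + 1) α β =
    ∑ a, cwHom B hB X k (hook (X a) α) (hook (B.dualBasis hB X a) β) := by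
  simp [cwHom]

variable {B}

theorem cwHom_succ_basis (hs : B.IsSymm) (Y : Module.Basis (Fin n) ℝ V) (k : ℕ)
    (α β : FormsOn V) : cwHom B hB X (k + 1) α β =
    ∑ a, cwHom B hB X k (hook (Y a) α) (hook (B.dualBasis hB Y a) β) := by
  rw [cwHom_succ]
  exact sum_basis_dualBasis_eq hB X hs Y
    ((cwHom B hB X k).compl₁₂ (hookHom.flip α) (hookHom.flip β))

theorem cwHom_succ_swap (hs : B.IsSymm) (k : ℕ) (α β : FormsOn V) :
    cwHom B hB X (k + 1) α β =
    ∑ a, cwHom B hB X k (hook (B.dualBasis hB X a) α) (hook (X a) β) := by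
  rw [cwHom_succ_basis hB X hs (B.dualBasis hB X), LinearMap.BilinForm.dualBasis_dualBasis hB hs]

theorem cwHom_hook_right (k : ℕ) (v : V) (α β : FormsOn V) :
    ∑ a, B v (X a) • cwHom B hB X k α (hook (B.dualBasis hB X a) β) =
      cwHom B hB X k α (hook v β) := by
  conv_rhs => rw [← sum_apply_smul_dualBasis B hB X v]
  have : hook (∑ a, B v (X a) • B.dualBasis hB X a) β =
      ∑ a, B v (X a) • hook (B.dualBasis hB X a) β := by
    simp only [← hookHom_apply, map_sum, map_smul, LinearMap.sum_apply, LinearMap.smul_apply]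
  rw [this, map_sum]
  simp only [map_smul]

theorem cwHom_hook_left (hs : B.IsSymm) (k : ℕ) (v : V) (α β : FormsOn V) :
    ∑ a, B v (B.dualBasis hB X a) • cwHom B hB X k (hook (X a) α) β =
      cwHom B hB X k (hook v α) β := by
  conv_rhs => rw [← sum_apply_dualBasis_smul hB X hs v]
  have : hook (∑ a, B v (B.dualBasis hB X a) • X a) α =
      ∑ a, B v (B.dualBasis hB X a) • hook (X a) α := by
    simp only [← hookHom_apply, map_sum, map_smul, LinearMap.sum_apply, LinearMap.smul_apply]
  rw [this, map_sum]
  simp only [map_smul, LinearMap.sum_apply, LinearMap.smul_apply]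

/-- Each contraction puts one hook on either factor, and v ⌟ anticommutes with it. On the left
factor this accumulates to (-1)^k; on the right factor the sign is compensated by the one from
moving η past the hook. -/
theorem hook_cwHom (k : ℕ) (v : V) (α β : FormsOn V) :
    hook v (cwHom B hB X k α β) =
      (-1 : ℝ) ^ k • cwHom B hB X k (hook v α) β + cwHom B hB X k (gradeInv α) (hook v β) := by
  induction k generalizing α β with
  | zero => simp [cwHom_zero, hook_mul]
  | succ k ih =>
    simp only [cwHom_succ, map_sum, ih, Finset.sum_add_distrib, Finset.smul_sum]
    congr 1
    · refine Finset.sum_congr rfl fun a _ => ?_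
      rw [hook_hook_anticomm v, map_neg, LinearMap.neg_apply, pow_succ]
      module
    · refine Finset.sum_congr rfl fun a _ => ?_
      rw [hook_hook_anticomm v, gradeInv_hook, map_neg, map_neg, LinearMap.neg_apply, neg_neg]

/-- Each of the k contractions may hit the covector, and then replaces it by v ⌟ on `β`. The
truncated `k - 1` does no harm at `k = 0`, since its coefficient vanishes. -/
theorem cwHom_oneForm_mul_left_aux (k : ℕ) (v : V) (α β : FormsOn V) :
    cwHom B hB X k (oneForm (B v) * α) β =
      (-1 : ℝ) ^ k • (oneForm (B v) * cwHom B hB X k α β) +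
        (k : ℝ) • cwHom B hB X (k - 1) α (hook v β) := by
  induction k generalizing α β with
  | zero => simp [cwHom_zero, mul_assoc]
  | succ k ih =>
    simp only [cwHom_succ, hook_oneForm_mul, map_sub, map_smul, LinearMap.sub_apply,
      LinearMap.smul_apply, Finset.sum_sub_distrib, ih, Finset.sum_add_distrib]
    rw [cwHom_hook_right, ← Finset.smul_sum, ← Finset.smul_sum, ← Finset.mul_sum,
      Nat.add_sub_cancel]
    have : (k : ℝ) • ∑ a, cwHom B hB X (k - 1) (hook (X a) α)
        (hook v (hook (B.dualBasis hB X a) β)) = -((k : ℝ) • cwHom B hB X k α (hook v β)) := by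
      cases k with
      | zero => simp
      | succ k =>
        rw [cwHom_succ, ← smul_neg, ← Finset.sum_neg_distrib, Nat.add_sub_cancel]
        congr 1
        refine Finset.sum_congr rfl fun a _ => ?_
        rw [hook_hook_anticomm v, map_neg]
    rw [this, pow_succ]
    push_cast
    module

theorem cwHom_oneForm_mul_left (k : ℕ) (v : V) (α β : FormsOn V) :
    cwHom B hB X (k + 1) (oneForm (B v) * α) β =
      (-1 : ℝ) ^ (k + 1) • (oneForm (B v) * cwHom B hB X (k + 1) α β) +
        ((k : ℝ) + 1) • cwHom B hB X k α (hook v β) := by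
  rw [cwHom_oneForm_mul_left_aux, Nat.add_sub_cancel]
  push_cast
  rfl

theorem cwHom_oneForm_mul_right_aux (hs : B.IsSymm) (k : ℕ) (v : V) (α β : FormsOn V) :
    cwHom B hB X k α (oneForm (B v) * β) =
      oneForm (B v) * cwHom B hB X k (gradeInv α) β +
        (k : ℝ) • cwHom B hB X (k - 1) (hook v α) β := by
  induction k generalizing α β with
  | zero => simp [cwHom_zero, ← mul_assoc, oneForm_mul_gradeInv]
  | succ k ih =>
    simp only [cwHom_succ, hook_oneForm_mul, map_sub, map_smul,
      Finset.sum_sub_distrib, ih, Finset.sum_add_distrib]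
    rw [cwHom_hook_left hB X hs, ← Finset.smul_sum, ← Finset.mul_sum, Nat.add_sub_cancel]
    have : (k : ℝ) • ∑ a, cwHom B hB X (k - 1) (hook v (hook (X a) α))
        (hook (B.dualBasis hB X a) β) = -((k : ℝ) • cwHom B hB X k (hook v α) β) := by
      cases k with
      | zero => simp
      | succ k =>
        rw [cwHom_succ, ← smul_neg, ← Finset.sum_neg_distrib, Nat.add_sub_cancel]
        congr 1
        refine Finset.sum_congr rfl fun a _ => ?_
        rw [hook_hook_anticomm v, map_neg, LinearMap.neg_apply]
    rw [this]
    simp only [gradeInv_hook, map_neg, LinearMap.neg_apply, Finset.sum_neg_distrib, mul_neg]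
    push_cast
    module

theorem cwHom_oneForm_mul_right (hs : B.IsSymm) (k : ℕ) (v : V) (α β : FormsOn V) :
    cwHom B hB X (k + 1) α (oneForm (B v) * β) =
      oneForm (B v) * cwHom B hB X (k + 1) (gradeInv α) β +
        ((k : ℝ) + 1) • cwHom B hB X k (hook v α) β := by
  rw [cwHom_oneForm_mul_right_aux hB X hs, Nat.add_sub_cancel]
  push_cast
  rfl

end ContractedWedge

end KillingYano

namespace KillingYano

/-! ### The Clifford product of forms -/

section CliffordForms

variable {V : Type*} [AddCommGroup V] [Module ℝ V] [FiniteDimensional ℝ V]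
  {B : LinearMap.BilinForm ℝ V} (hB : B.Nondegenerate) {n : ℕ} (X : Module.Basis (Fin n) ℝ V)

open CliffordAlgebra (ι involute involute_ι equivExterior)

/-- Identifies the contraction occurring in the change of quadratic form with the inner derivative
`hook v`. -/
theorem associated_cometric (hs : B.IsSymm) (v : V) :
    QuadraticMap.associated (R := ℝ) (cometric B hB) (B v) = Module.Dual.eval ℝ V v := by
  have h : ∀ w, (B.toDual hB).symm (B w) = w := fun w => by
    rw [LinearEquiv.symm_apply_eq]; ext; rfl
  ext θ
  obtain ⟨w, rfl⟩ := (B.toDual hB).surjective θ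
  have hw : B.toDual hB w = B w := by ext; rfl
  rw [hw, QuadraticMap.associated_apply]
  simp only [cometric, QuadraticMap.comp_apply, LinearEquiv.coe_coe, map_add, h,
    LinearMap.BilinMap.toQuadraticMap_apply, LinearMap.add_apply, Module.Dual.eval_apply]
  rw [hs.eq v w]
  simp
  ring

theorem equivExterior_ι_mul (hs : B.IsSymm) (v : V) (x : CliffordAlgebra (cometric B hB)) :
    equivExterior (cometric B hB) (ι _ (B v) * x) =
      oneForm (B v) * equivExterior (cometric B hB) x +
        hook v (equivExterior (cometric B hB) x) := by
  simp only [equivExterior, CliffordAlgebra.changeFormEquiv_apply,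
    CliffordAlgebra.changeForm_ι_mul]
  have h : QuadraticMap.associated (R := ℝ) (-cometric B hB) (B v) =
      -Module.Dual.eval ℝ V v := by
    rw [← associated_cometric hB hs]
    ext θ
    simp only [LinearMap.neg_apply, QuadraticMap.associated_apply, neg_apply]
    rw [← smul_neg]
    congr 1
    ring
  rw [h, map_neg, LinearMap.neg_apply, sub_neg_eq_add]
  rfl

theorem equivExterior_involute (x : CliffordAlgebra (cometric B hB)) :
    equivExterior (cometric B hB) (involute x) =
      gradeInv (equivExterior (cometric B hB) x) := by
  induction x using CliffordAlgebra.left_induction with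
  | algebraMap r =>
    simp only [AlgHom.commutes, equivExterior, CliffordAlgebra.changeFormEquiv_apply,
      CliffordAlgebra.changeForm_algebraMap]
  | add x y hx hy => simp only [map_add, hx, hy]
  | ι_mul x w hx =>
    simp only [equivExterior, CliffordAlgebra.changeFormEquiv_apply] at hx
    rw [map_mul, involute_ι, neg_mul, map_neg]
    simp only [equivExterior, CliffordAlgebra.changeFormEquiv_apply,
      CliffordAlgebra.changeForm_ι_mul, map_sub, hx]
    rw [map_mul]
    have h1 := involute_ι (Q := (0 : QuadraticForm ℝ (Module.Dual ℝ V))) w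
    have h2 := involute_contractLeft (Q := (0 : QuadraticForm ℝ (Module.Dual ℝ V)))
      (QuadraticMap.associated (R := ℝ) (-cometric B hB) w)
    simp only [gradeInv, h1, h2, neg_mul]
    abel

/-- By this relation ½ (v x - η(x) v) is a contraction, so that `cliffOp (-1)` is the inner
derivative and `cliffOp 1` the wedge product. -/
theorem involute_mul_ι (hs : B.IsSymm) (v : V) (x : CliffordAlgebra (cometric B hB)) :
    involute x * ι _ (B v) =
      ι _ (B v) * x - (2 : ℝ) • CliffordAlgebra.contractLeft (Module.Dual.eval ℝ V v) x := by
  induction x using CliffordAlgebra.left_induction with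
  | algebraMap r =>
    simp only [AlgHom.commutes, CliffordAlgebra.contractLeft_algebraMap, smul_zero, sub_zero]
    exact Algebra.commutes _ _
  | add x y hx hy => simp only [map_add, add_mul, mul_add, hx, hy, smul_add]; abel
  | ι_mul x w hx =>
    rw [map_mul, involute_ι, mul_assoc, hx, CliffordAlgebra.contractLeft_ι_mul,
      ← associated_cometric hB hs]
    have h : ι (cometric B hB) w * ι _ (B v) = -(ι _ (B v) * ι _ w) +
        (2 : ℝ) • algebraMap ℝ _ (QuadraticMap.associated (R := ℝ) (cometric B hB) (B v) w) := by
      rw [eq_neg_add_iff_add_eq, CliffordAlgebra.ι_mul_ι_add_swap, QuadraticMap.associated_apply]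
      rw [Algebra.smul_def, ← map_mul]
      congr 1
      simp only [QuadraticMap.polar]
      simp
    rw [mul_sub, ← mul_assoc, neg_mul, h]
    simp only [add_mul, neg_mul, smul_mul_assoc, ← Algebra.smul_def, mul_assoc, smul_sub,
      mul_smul_comm]
    module

/-- Multiplication by the dual covector of a vector (`true`) or inner derivative by the
vector (`false`). -/
def formOp (B : LinearMap.BilinForm ℝ V) : Bool → V →ₗ[ℝ] FormsOn V →ₗ[ℝ] FormsOn V
  | true => (LinearMap.mul ℝ (FormsOn V)).comp ((ExteriorAlgebra.ι ℝ).comp B)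
  | false => hookHom

theorem formOp_true (v : V) (α : FormsOn V) : formOp B true v α = oneForm (B v) * α := rfl
theorem formOp_false (v : V) (α : FormsOn V) : formOp B false v α = hook v α := rfl

/-- The sign `±1`. -/
def boolSign (σ : Bool) : ℝ := if σ then 1 else -1

theorem boolSign_mul_self (σ : Bool) : boolSign σ * boolSign σ = 1 := by
  cases σ <;> simp [boolSign]

/-- The Clifford algebra element of a form. -/
def toCliff : FormsOn V ≃ₗ[ℝ] CliffordAlgebra (cometric B hB) :=
  (equivExterior (cometric B hB)).symm

theorem toCliff_gradeInv (α : FormsOn V) : toCliff hB (gradeInv α) = involute (toCliff hB α) := by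
  rw [toCliff, LinearEquiv.symm_apply_eq, equivExterior_involute, LinearEquiv.apply_symm_apply]

theorem toCliff_hook (hs : B.IsSymm) (v : V) (α : FormsOn V) :
    toCliff hB (hook v α) = cliffOp (-1) (B v) (toCliff hB α) := by
  have h : cliffOp (-1) (B v) (toCliff hB α) =
      CliffordAlgebra.contractLeft (Module.Dual.eval ℝ V v) (toCliff hB α) := by
    rw [cliffOp_apply, involute_mul_ι hB hs]; module
  rw [h, toCliff, LinearEquiv.symm_apply_eq]
  simp only [equivExterior, CliffordAlgebra.changeFormEquiv_apply]
  rw [CliffordAlgebra.changeForm_contractLeft]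
  rw [← CliffordAlgebra.changeFormEquiv_apply, LinearEquiv.apply_symm_apply]
  rfl

theorem toCliff_oneForm_mul (hs : B.IsSymm) (v : V) (α : FormsOn V) :
    toCliff hB (oneForm (B v) * α) = cliffOp 1 (B v) (toCliff hB α) := by
  have h1 := equivExterior_ι_mul hB hs v (toCliff hB α)
  have h2 : equivExterior (cometric B hB) (toCliff hB α) = α :=
    LinearEquiv.apply_symm_apply _ _
  rw [h2] at h1
  have h3 : oneForm (B v) * α =
      equivExterior (cometric B hB) (ι _ (B v) * toCliff hB α) - hook v α :=
    eq_sub_of_add_eq h1.symm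
  rw [h3, map_sub, toCliff_hook hB hs]
  rw [show toCliff hB (equivExterior (cometric B hB) (ι _ (B v) * toCliff hB α)) =
    ι _ (B v) * toCliff hB α from LinearEquiv.symm_apply_apply _ _]
  rw [ι_mul_eq_cliffOp 1]; abel

theorem toCliff_formOp (hs : B.IsSymm) (σ : Bool) (v : V) (α : FormsOn V) :
    toCliff hB (formOp B σ v α) = cliffOp (boolSign σ) (B v) (toCliff hB α) := by
  cases σ
  · exact toCliff_hook hB hs v α
  · exact toCliff_oneForm_mul hB hs v α

variable (B) in
/-- The Clifford product of forms as a bilinear map. -/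
def cliffHom : FormsOn V →ₗ[ℝ] FormsOn V →ₗ[ℝ] FormsOn V :=
  ((LinearMap.mul ℝ (CliffordAlgebra (cometric B hB))).compl₁₂
    (toCliff hB).toLinearMap (toCliff hB).toLinearMap).compr₂
      (toCliff hB).symm.toLinearMap

theorem toCliff_cliffHom (α β : FormsOn V) :
    toCliff hB (cliffHom B hB α β) = toCliff hB α * toCliff hB β :=
  LinearEquiv.apply_symm_apply _ _

theorem toCliff_oneForm (v : V) : toCliff hB (oneForm (B v)) = ι _ (B v) := by
  rw [toCliff, LinearEquiv.symm_apply_eq]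
  simp [oneForm, equivExterior]

variable (B) in
/-- The Clifford commutator. -/
def commHom : FormsOn V →ₗ[ℝ] FormsOn V →ₗ[ℝ] FormsOn V := cliffHom B hB - (cliffHom B hB).flip

theorem commHom_apply (α β : FormsOn V) :
    commHom B hB α β = cliffHom B hB α β - cliffHom B hB β α := rfl

theorem commHom_swap (α β : FormsOn V) : commHom B hB α β = -commHom B hB β α := by
  simp [commHom_apply]

theorem sum_cliffOp_swap (hs : B.IsSymm) {Q : QuadraticForm ℝ (Module.Dual ℝ V)}
    (f : Module.Dual ℝ V →ₗ[ℝ] Module.Dual ℝ V →ₗ[ℝ] CliffordAlgebra Q) :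
    ∑ a, f (B (X a)) (B (B.dualBasis hB X a)) = ∑ a, f (B (B.dualBasis hB X a)) (B (X a)) :=
  sum_basis_dualBasis_swap hB X hs (f.compl₁₂ B B)

/-- `sum_cliffOp_bracket` transported to forms. On signs `!σ` is -σ and `σ == τ` is σ τ: the outer
operation is a wedge product for two forms of the same class and an inner derivative in the mixed
case. -/
theorem sum_formOp_bracket (hs : B.IsSymm) (σ τ : Bool) {α β β' : FormsOn V}
    (hα : gradeInv α = boolSign σ • α) (hβ' : gradeInv β' = -(boolSign τ • β'))
    (hN : ∀ v, ∑ b, formOp B (!τ) (X b) (formOp B τ (B.dualBasis hB X b) (formOp B τ v β)) =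
      (2 : ℝ) • formOp B τ v β') :
    ∑ b, formOp B (σ == τ) (X b)
        (∑ a, cliffHom B hB (formOp B σ (B.dualBasis hB X a) α)
            (formOp B τ (B.dualBasis hB X b) (formOp B τ (X a) β)) +
          commHom B hB (formOp B σ (B.dualBasis hB X b) α) β') =
      commHom B hB (∑ b, formOp B (!σ) (X b) (formOp B σ (B.dualBasis hB X b) α)) β' -
      (1 / 2 : ℝ) • ∑ b, cliffHom B hB (oneForm (B (B.dualBasis hB X b)))
        (∑ a, commHom B hB (formOp B σ (B.dualBasis hB X a) α)
          (formOp B τ (X a) (formOp B τ (X b) β))) := by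
  have hneg : ∀ σ, boolSign (!σ) = -boolSign σ := by intro σ; cases σ <;> simp [boolSign]
  have hmul : boolSign (σ == τ) = boolSign σ * boolSign τ := by
    cases σ <;> cases τ <;> simp [boolSign]
  apply (toCliff hB).injective
  simp only [map_sum (toCliff hB), map_add (toCliff hB), map_sub (toCliff hB),
    map_smul (toCliff hB), toCliff_formOp hB hs, toCliff_cliffHom,
    commHom_apply, toCliff_oneForm hB, hneg, hmul]
  have key := sum_cliffOp_bracket (boolSign_mul_self σ) (boolSign_mul_self τ)
    (u := fun a => B (X a)) (v := fun a => B (B.dualBasis hB X a))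
    (fun f => sum_cliffOp_swap hB X hs f) (α := toCliff hB α) (β := toCliff hB β)
    (β' := toCliff hB β') (by rw [← toCliff_gradeInv, hα, map_smul])
    (by rw [← toCliff_gradeInv, hβ', map_neg, map_smul]) (by
      intro w
      obtain ⟨v, rfl⟩ := (B.toDual hB).surjective w
      have hw : B.toDual hB v = B v := by ext; rfl
      have := congrArg (toCliff hB) (hN v)
      simpa only [map_sum, map_smul, toCliff_formOp hB hs, hneg, hw] using this)
  exact key

end CliffordForms

end KillingYano

namespace KillingYano

/-! ### Degree operators -/

section Degree

variable {V : Type*} [AddCommGroup V] [Module ℝ V] {n : ℕ}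

theorem homPart_basis (b : Module.Basis (Fin n) ℝ (Module.Dual ℝ V)) (p : ℕ) (s : Finset (Fin n)) :
    homPart p (b.ExteriorAlgebra s) = if s.card = p then b.ExteriorAlgebra s else 0 := by
  have hmem : b.ExteriorAlgebra s ∈ (fun i : ℕ => ⋀[ℝ]^i (Module.Dual ℝ V)) s.card := by
    have := ExteriorAlgebra.basis_eq_coe_basis b (⟨s, rfl⟩ : Set.powersetCard (Fin n) s.card)
    change b.ExteriorAlgebra s = _ at this
    rw [this]
    exact Subtype.coe_prop _
  simp only [homPart, GradedAlgebra.proj_apply]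
  split_ifs with h
  · subst h
    exact DirectSum.decompose_of_mem_same (fun i : ℕ => ⋀[ℝ]^i (Module.Dual ℝ V)) hmem
  · exact DirectSum.decompose_of_mem_ne (fun i : ℕ => ⋀[ℝ]^i (Module.Dual ℝ V)) hmem h

/-- Makes the truncation at degree `n` in `degOp` harmless. -/
theorem homPart_eq_zero_of_lt (X : Module.Basis (Fin n) ℝ V) {p : ℕ} (hp : n < p)
    (α : FormsOn V) : homPart p α = 0 := by
  have h : homPart (V := V) p = 0 := by
    refine (X.dualBasis.ExteriorAlgebra).ext fun s => ?_
    rw [homPart_basis, LinearMap.zero_apply, if_neg]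
    have := Finset.card_le_univ s
    rw [Fintype.card_fin] at this
    omega
  rw [h, LinearMap.zero_apply]

/-- A function of the degree operator. -/
def degOp (n : ℕ) (f : ℕ → ℝ) : FormsOn V →ₗ[ℝ] FormsOn V :=
  ∑ p ∈ Finset.range (n + 1), f p • homPart p

theorem homPart_degOp (X : Module.Basis (Fin n) ℝ V) (f : ℕ → ℝ) (p : ℕ) (α : FormsOn V) :
    homPart p (degOp n f α) = f p • homPart p α := by
  simp only [degOp, LinearMap.sum_apply, LinearMap.smul_apply, map_sum, map_smul, homPart_homPart,
    smul_ite, smul_zero]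
  rw [Finset.sum_ite_eq]
  split_ifs with h
  · rfl
  · rw [Finset.mem_range] at h
    rw [homPart_eq_zero_of_lt X (by omega), smul_zero]

theorem sum_homPart (X : Module.Basis (Fin n) ℝ V) (α : FormsOn V) :
    ∑ p ∈ Finset.range (n + 1), homPart p α = α := by
  refine form_ext fun p => ?_
  have := homPart_degOp X (fun _ => 1) p α
  simpa [degOp] using this

variable (X : Module.Basis (Fin n) ℝ V)
include X

theorem degOp_congr {f g : ℕ → ℝ} {α : FormsOn V}
    (h : ∀ p, homPart p α = 0 ∨ f p = g p) : degOp n f α = degOp n g α := by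
  refine form_ext fun p => ?_
  rw [homPart_degOp X, homPart_degOp X]
  rcases h p with h | h <;> rw [h]
  simp

theorem degOp_degOp (f g : ℕ → ℝ) (α : FormsOn V) :
    degOp n f (degOp n g α) = degOp n (fun p => f p * g p) α := by
  refine form_ext fun p => ?_
  simp only [homPart_degOp X, smul_smul]

theorem degOp_one (α : FormsOn V) : degOp n (fun _ => 1) α = α := by
  refine form_ext fun p => ?_
  simp only [homPart_degOp X, one_smul]

theorem hook_degOp (f : ℕ → ℝ) (v : V) (α : FormsOn V) :
    hook v (degOp n f α) = degOp n (fun p => f (p + 1)) (hook v α) := by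
  refine form_ext fun p => ?_
  simp only [homPart_degOp X, homPart_hook, map_smul]

theorem degOp_oneForm_mul (f : ℕ → ℝ) (θ : Module.Dual ℝ V) (α : FormsOn V) :
    degOp n f (oneForm θ * α) = oneForm θ * degOp n (fun p => f (p + 1)) α := by
  refine form_ext fun p => ?_
  cases p with
  | zero => simp only [homPart_degOp X, homPart_oneForm_mul_zero, smul_zero]
  | succ p => simp only [homPart_degOp X, homPart_oneForm_mul_succ, mul_smul_comm]

theorem gradeInv_eq_degOp (α : FormsOn V) : gradeInv α = degOp n (fun p => (-1) ^ p) α := by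
  refine form_ext fun p => ?_
  simp only [homPart_degOp X, homPart_gradeInv]

theorem gradeInv_degOp (f : ℕ → ℝ) (α : FormsOn V) :
    gradeInv (degOp n f α) = degOp n f (gradeInv α) := by
  rw [gradeInv_eq_degOp X, gradeInv_eq_degOp X, degOp_degOp X, degOp_degOp X]
  simp only [mul_comm]

omit X in
theorem homPart_eq_zero_of_even {α : FormsOn V} (h : gradeInv α = -α) {p : ℕ} (hp : Even p) :
    homPart p α = 0 := by
  have h1 := homPart_gradeInv p α
  rw [h, map_neg, hp.neg_one_pow, one_smul] at h1
  have h3 : (2 : ℝ) • homPart p α = 0 := by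
    rw [two_smul]; nth_rewrite 1 [← h1]; exact neg_add_cancel _
  exact (smul_eq_zero.mp h3).resolve_left two_ne_zero

omit X in
theorem homPart_eq_zero_of_odd {α : FormsOn V} (h : gradeInv α = α) {p : ℕ} (hp : Odd p) :
    homPart p α = 0 := by
  have h1 := homPart_gradeInv p α
  rw [h, hp.neg_one_pow, neg_one_smul] at h1
  have h3 : (2 : ℝ) • homPart p α = 0 := by
    rw [two_smul]; nth_rewrite 1 [h1]; exact neg_add_cancel _
  exact (smul_eq_zero.mp h3).resolve_left two_ne_zero

omit X in
theorem gradeInv_eq_neg_of_odd {α : FormsOn V} (h : ∀ p, Even p → homPart p α = 0) :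
    gradeInv α = -α := by
  refine form_ext fun p => ?_
  rw [homPart_gradeInv, map_neg]
  rcases Nat.even_or_odd p with hp | hp
  · simp [h p hp]
  · simp [hp.neg_one_pow]

omit X in
theorem gradeInv_eq_self_of_even {α : FormsOn V} (h : ∀ p, Odd p → homPart p α = 0) :
    gradeInv α = α := by
  refine form_ext fun p => ?_
  rw [homPart_gradeInv]
  rcases Nat.even_or_odd p with hp | hp
  · simp [hp.neg_one_pow]
  · simp [h p hp]

end Degree

/-! ### Number operators as contractions of exterior and inner products -/

section NumberOperator

variable {V : Type*} [AddCommGroup V] [Module ℝ V] [FiniteDimensional ℝ V]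
  {B : LinearMap.BilinForm ℝ V} (hB : B.Nondegenerate) {n : ℕ} (X : Module.Basis (Fin n) ℝ V)

/-- The left side is a derivation of the wedge product that fixes every covector, so it counts the
degree. -/
theorem sum_oneForm_mul_hook (α : FormsOn V) :
    ∑ a, oneForm (B (B.dualBasis hB X a)) * hook (X a) α = degOp n (fun p => (p : ℝ)) α := by
  refine form_ext fun p => ?_
  rw [homPart_degOp X]
  induction α using forms_induction generalizing p with
  | algebraMap r =>
    simp only [hook_algebraMap, mul_zero, Finset.sum_const_zero, map_zero, homPart_algebraMap]
    split_ifs with h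
    · simp [h]
    · simp
  | add x y hx hy =>
    simp only [map_add, mul_add, Finset.sum_add_distrib, hx, hy, smul_add]
  | oneForm_mul θ x hx =>
    have h1 : ∑ a, oneForm (B (B.dualBasis hB X a)) * hook (X a) (oneForm θ * x) =
        oneForm θ * x + oneForm θ * ∑ a, oneForm (B (B.dualBasis hB X a)) * hook (X a) x := by
      simp only [hook_oneForm_mul, mul_sub, Finset.sum_sub_distrib, mul_smul_comm]
      rw [sub_eq_add_neg, ← Finset.sum_neg_distrib, Finset.mul_sum]
      congr 1
      · simp only [← smul_mul_assoc]
        rw [← Finset.sum_mul]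
        simp only [← oneForm_smul, ← oneForm_sum, ← coord_eq_apply_dualBasis]
        congr 2
        refine X.ext fun b => ?_
        simp
      · refine Finset.sum_congr rfl fun a _ => ?_
        rw [← mul_assoc, ← mul_assoc, ← neg_mul]
        congr 1
        rw [neg_eq_iff_add_eq_zero]
        exact ExteriorAlgebra.ι_add_mul_swap _ _
    rw [h1, map_add]
    cases p with
    | zero => simp [homPart_oneForm_mul_zero]
    | succ p =>
      rw [homPart_oneForm_mul_succ, homPart_oneForm_mul_succ, hx, mul_smul_comm]
      push_cast
      module

theorem sum_oneForm_mul_hook_swap (hs : B.IsSymm) (α : FormsOn V) :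
    ∑ a, oneForm (B (X a)) * hook (B.dualBasis hB X a) α = degOp n (fun p => (p : ℝ)) α := by
  have h := sum_oneForm_mul_hook hB (B.dualBasis hB X) α
  rwa [LinearMap.BilinForm.dualBasis_dualBasis hB hs] at h

theorem sum_hook_oneForm_mul (α : FormsOn V) :
    ∑ a, hook (X a) (oneForm (B (B.dualBasis hB X a)) * α) =
      degOp n (fun p => (n : ℝ) - p) α := by
  have h1 : ∀ a, hook (X a) (oneForm (B (B.dualBasis hB X a)) * α) =
      α - oneForm (B (B.dualBasis hB X a)) * hook (X a) α := by
    intro a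
    rw [hook_oneForm_mul, LinearMap.BilinForm.apply_dualBasis_left]
    simp
  simp only [h1, Finset.sum_sub_distrib, sum_oneForm_mul_hook]
  refine form_ext fun p => ?_
  simp only [map_sub, homPart_degOp X, Finset.sum_const, Finset.card_univ, Fintype.card_fin,
    sub_smul, map_nsmul]
  rw [Nat.cast_smul_eq_nsmul ℝ n]

theorem sum_hook_oneForm_mul_swap (hs : B.IsSymm) (α : FormsOn V) :
    ∑ a, hook (B.dualBasis hB X a) (oneForm (B (X a)) * α) =
      degOp n (fun p => (n : ℝ) - p) α := by
  have h := sum_hook_oneForm_mul hB (B.dualBasis hB X) α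
  rwa [LinearMap.BilinForm.dualBasis_dualBasis hB hs] at h

/-- Symmetric indices are contracted with an anticommuting pair of inner derivatives. -/
theorem sum_hook_hook (hs : B.IsSymm) (α : FormsOn V) :
    ∑ a, hook (B.dualBasis hB X a) (hook (X a) α) = 0 := by
  have h := sum_basis_dualBasis_swap hB X hs (hookHom.compl₂ (hookHom.flip α)).flip
  simp only [LinearMap.flip_apply, LinearMap.compl₂_apply, hookHom_apply] at h
  have h2 : ∑ a, hook (X a) (hook (B.dualBasis hB X a) α) =
      -∑ a, hook (B.dualBasis hB X a) (hook (X a) α) := by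
    rw [← Finset.sum_neg_distrib]
    exact Finset.sum_congr rfl fun a _ => hook_hook_anticomm _ _ _
  rw [h2] at h
  have h3 : (2 : ℝ) • ∑ a, hook (B.dualBasis hB X a) (hook (X a) α) = 0 := by
    rw [two_smul]; nth_rewrite 1 [h]; exact neg_add_cancel _
  exact (smul_eq_zero.mp h3).resolve_left two_ne_zero

theorem sum_oneForm_mul_oneForm_mul (hs : B.IsSymm) (α : FormsOn V) :
    ∑ a, oneForm (B (B.dualBasis hB X a)) * (oneForm (B (X a)) * α) = 0 := by
  have h := sum_basis_dualBasis_swap hB X hs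
    ((formOp B true).compl₂ ((formOp B true).flip α)).flip
  simp only [LinearMap.flip_apply, LinearMap.compl₂_apply, formOp_true] at h
  have h2 : ∑ a, oneForm (B (X a)) * (oneForm (B (B.dualBasis hB X a)) * α) =
      -∑ a, oneForm (B (B.dualBasis hB X a)) * (oneForm (B (X a)) * α) := by
    rw [← Finset.sum_neg_distrib]
    refine Finset.sum_congr rfl fun a _ => ?_
    rw [← mul_assoc, ← mul_assoc, ← neg_mul]
    congr 1
    rw [eq_neg_iff_add_eq_zero]
    exact ExteriorAlgebra.ι_add_mul_swap _ _
  rw [h2] at h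
  have h3 : (2 : ℝ) • ∑ a, oneForm (B (B.dualBasis hB X a)) * (oneForm (B (X a)) * α) = 0 := by
    rw [two_smul]; nth_rewrite 1 [h]; exact neg_add_cancel _
  exact (smul_eq_zero.mp h3).resolve_left two_ne_zero

end NumberOperator

end KillingYano

namespace KillingYano

/-! ### Expansion of the Clifford product in contracted wedge products -/

section Expansion

variable {V : Type*} [AddCommGroup V] [Module ℝ V] [FiniteDimensional ℝ V]
  {B : LinearMap.BilinForm ℝ V} (hB : B.Nondegenerate) {n : ℕ} (X : Module.Basis (Fin n) ℝ V)

theorem hook_homPart (p : ℕ) (v : V) (α : FormsOn V) :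
    hook v (homPart (p + 1) α) = homPart p (hook v α) := (homPart_hook p v α).symm

theorem cwHom_homPart_eq_zero {k r : ℕ} (h : r < k) (α β : FormsOn V) :
    cwHom B hB X k (homPart r α) β = 0 := by
  induction k generalizing r α β with
  | zero => omega
  | succ k ih =>
    rw [cwHom_succ]
    refine Finset.sum_eq_zero fun a _ => ?_
    cases r with
    | zero => rw [hook_homPart_zero, map_zero, LinearMap.zero_apply]
    | succ r => rw [hook_homPart, ih (by omega)]

theorem cwHom_eq_zero_of_lt {k : ℕ} (h : n < k) (α β : FormsOn V) :
    cwHom B hB X k α β = 0 := by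
  rw [← sum_homPart X α, map_sum, LinearMap.sum_apply]
  refine Finset.sum_eq_zero fun r hr => ?_
  rw [Finset.mem_range] at hr
  exact cwHom_homPart_eq_zero hB X (by omega) α β

theorem homPart_homPart_mul_homPart (p r s : ℕ) (α β : FormsOn V) :
    homPart p (homPart r α * homPart s β) =
      if r + s = p then homPart r α * homPart s β else 0 := by
  have hmem : homPart r α * homPart s β ∈ (fun i : ℕ => ⋀[ℝ]^i (Module.Dual ℝ V)) (r + s) := by
    refine SetLike.mul_mem_graded (A := fun i : ℕ => ⋀[ℝ]^i (Module.Dual ℝ V)) ?_ ?_ <;>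
    · simp only [homPart, GradedAlgebra.proj_apply]
      exact SetLike.coe_mem _
  rw [homPart, GradedAlgebra.proj_apply]
  split_ifs with h
  · subst h
    exact DirectSum.decompose_of_mem_same (fun i : ℕ => ⋀[ℝ]^i (Module.Dual ℝ V)) hmem
  · exact DirectSum.decompose_of_mem_ne (fun i : ℕ => ⋀[ℝ]^i (Module.Dual ℝ V)) hmem h

theorem homPart_cwHom_homPart_homPart (p k r s : ℕ) (α β : FormsOn V)
    (h : r + s ≠ p + 2 * k) : homPart p (cwHom B hB X k (homPart r α) (homPart s β)) = 0 := by
  induction k generalizing r s α β with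
  | zero => rw [cwHom_zero, homPart_homPart_mul_homPart, if_neg (by omega)]
  | succ k ih =>
    rw [cwHom_succ, map_sum]
    refine Finset.sum_eq_zero fun a _ => ?_
    cases r with
    | zero => rw [hook_homPart_zero, map_zero, LinearMap.zero_apply, map_zero]
    | succ r =>
      cases s with
      | zero => rw [hook_homPart_zero, map_zero, map_zero]
      | succ s => rw [hook_homPart, hook_homPart, ih _ _ _ _ (by omega)]

/-- A contracted wedge product of order k lowers the total degree by 2k. This serves to discard the
degrees at which a denominator of the third potential vanishes. -/
theorem homPart_cwHom_eq_zero (p k : ℕ) (α β : FormsOn V)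
    (h : ∀ r s, r + s = p + 2 * k → homPart r α = 0 ∨ homPart s β = 0) :
    homPart p (cwHom B hB X k α β) = 0 := by
  rw [← sum_homPart X α, ← sum_homPart X β]
  simp only [map_sum, LinearMap.sum_apply]
  refine Finset.sum_eq_zero fun r _ => Finset.sum_eq_zero fun s _ => ?_
  by_cases hrs : s + r = p + 2 * k
  · rcases h s r hrs with h | h <;> simp [h]
  · exact homPart_cwHom_homPart_homPart hB X p k s r α β hrs

theorem mul_comm_of_gradeInv_eq_self {β : FormsOn V} (hβ : gradeInv β = β) (α : FormsOn V) :
    β * α = α * β := by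
  induction α using forms_induction with
  | algebraMap r => exact (Algebra.commutes r β).symm
  | add x y hx hy => rw [mul_add, add_mul, hx, hy]
  | oneForm_mul θ x hx =>
    rw [mul_assoc, ← hx, ← mul_assoc, ← mul_assoc, ← oneForm_mul_gradeInv, hβ]

theorem mul_comm_of_gradeInv_eq_neg {β : FormsOn V} (hβ : gradeInv β = -β) (α : FormsOn V) :
    β * α = gradeInv α * β := by
  induction α using forms_induction with
  | algebraMap r => rw [AlgHom.commutes]; exact (Algebra.commutes r β).symm
  | add x y hx hy => rw [mul_add, map_add, add_mul, hx, hy]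
  | oneForm_mul θ x hx =>
    rw [map_mul, gradeInv_oneForm, mul_assoc, ← hx, ← mul_assoc, ← mul_assoc,
      ← oneForm_mul_gradeInv, hβ]
    simp only [mul_neg, neg_mul]

/-- Graded commutativity, with a parity imposed on `β` alone. A hook flips the parity of `β` while
(-1)^k flips as well, so each of the two cases passes from `k` to `k + 1`. -/
theorem cwHom_comm_and (hs : B.IsSymm) (k : ℕ) (α β : FormsOn V) :
    (gradeInv β = (-1 : ℝ) ^ k • β → cwHom B hB X k β α = cwHom B hB X k α β) ∧
    (gradeInv β = -((-1 : ℝ) ^ k • β) →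
      cwHom B hB X k β α = (-1 : ℝ) ^ k • cwHom B hB X k (gradeInv α) β) := by
  induction k generalizing α β with
  | zero =>
    simp only [cwHom_zero, pow_zero, one_smul]
    exact ⟨fun h => mul_comm_of_gradeInv_eq_self h α, fun h => mul_comm_of_gradeInv_eq_neg h α⟩
  | succ k ih =>
    constructor
    · intro h
      rw [cwHom_succ_swap hB X hs, cwHom_succ]
      refine Finset.sum_congr rfl fun a _ => ?_
      apply (ih _ _).1
      rw [gradeInv_hook, h, pow_succ]
      simp
    · intro h
      rw [cwHom_succ_swap hB X hs, cwHom_succ, Finset.smul_sum]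
      refine Finset.sum_congr rfl fun a _ => ?_
      rw [(ih _ _).2]
      · rw [gradeInv_hook, map_neg, LinearMap.neg_apply, pow_succ]
        simp
      · rw [gradeInv_hook, h, pow_succ]
        simp

theorem cwHom_comm (hs : B.IsSymm) {k : ℕ} {α β : FormsOn V}
    (h : gradeInv β = (-1 : ℝ) ^ k • β) : cwHom B hB X k β α = cwHom B hB X k α β :=
  (cwHom_comm_and hB X hs k α β).1 h

theorem cwHom_comm' (hs : B.IsSymm) {k : ℕ} {α β : FormsOn V}
    (h : gradeInv β = -((-1 : ℝ) ^ k • β)) :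
    cwHom B hB X k β α = (-1 : ℝ) ^ k • cwHom B hB X k (gradeInv α) β :=
  (cwHom_comm_and hB X hs k α β).2 h

/-- `∑ₖ (-1)ᵏ / (2k)! α ∧₂ₖ β`. -/
def evenSum : FormsOn V →ₗ[ℝ] FormsOn V →ₗ[ℝ] FormsOn V :=
  ∑ k ∈ Finset.range (n + 1), ((-1 : ℝ) ^ k / ((2 * k).factorial : ℝ)) • cwHom B hB X (2 * k)

/-- `∑ₖ (-1)ᵏ / (2k+1)! α ∧₂ₖ₊₁ β`. -/
def oddSum : FormsOn V →ₗ[ℝ] FormsOn V →ₗ[ℝ] FormsOn V :=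
  ∑ k ∈ Finset.range (n + 1),
    ((-1 : ℝ) ^ k / ((2 * k + 1).factorial : ℝ)) • cwHom B hB X (2 * k + 1)

theorem evenSum_apply (α β : FormsOn V) : evenSum hB X α β =
    ∑ k ∈ Finset.range (n + 1),
      ((-1 : ℝ) ^ k / ((2 * k).factorial : ℝ)) • cwHom B hB X (2 * k) α β := by
  simp [evenSum]

theorem oddSum_apply (α β : FormsOn V) : oddSum hB X α β =
    ∑ k ∈ Finset.range (n + 1),
      ((-1 : ℝ) ^ k / ((2 * k + 1).factorial : ℝ)) • cwHom B hB X (2 * k + 1) α β := by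
  simp [oddSum]

theorem hook_evenSum (v : V) (α β : FormsOn V) : hook v (evenSum hB X α β) =
    evenSum hB X (hook v α) β + evenSum hB X (gradeInv α) (hook v β) := by
  simp only [evenSum_apply, map_sum, map_smul, hook_cwHom, pow_mul, neg_one_sq, one_pow, one_smul,
    smul_add, Finset.sum_add_distrib]

theorem hook_oddSum (v : V) (α β : FormsOn V) : hook v (oddSum hB X α β) =
    -oddSum hB X (hook v α) β + oddSum hB X (gradeInv α) (hook v β) := by
  have h : ∀ k : ℕ, (-1 : ℝ) ^ (2 * k + 1) = -1 := fun k => Odd.neg_one_pow ⟨k, rfl⟩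
  simp only [oddSum_apply, map_sum, map_smul, hook_cwHom, h, smul_add, Finset.sum_add_distrib,
    smul_neg, neg_smul, one_smul, Finset.sum_neg_distrib]

/-- The 2k + 1 contractions that can hit the covector turn (2k+1)! into (2k)!, which makes an even
sum out of an odd one. -/
theorem oddSum_oneForm_mul (v : V) (α β : FormsOn V) :
    oddSum hB X (oneForm (B v) * α) β =
      -(oneForm (B v) * oddSum hB X α β) + evenSum hB X α (hook v β) := by
  simp only [oddSum_apply, evenSum_apply, Finset.mul_sum, ← Finset.sum_neg_distrib,
    ← Finset.sum_add_distrib]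
  refine Finset.sum_congr rfl fun k _ => ?_
  rw [cwHom_oneForm_mul_left, pow_succ, pow_mul, neg_one_sq, one_pow, Nat.factorial_succ,
    mul_smul_comm, smul_add, smul_smul]
  have h1 : ((2 * k : ℕ) : ℝ) + 1 ≠ 0 := by positivity
  have h2 : ((2 * k).factorial : ℝ) ≠ 0 := by positivity
  have h3 : (-1 : ℝ) ^ k / (((2 * k + 1) * (2 * k).factorial : ℕ) : ℝ) * (((2 * k : ℕ) : ℝ) + 1) =
      (-1 : ℝ) ^ k / ((2 * k).factorial : ℝ) := by
    rw [Nat.cast_mul, Nat.cast_succ]; field_simp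
  rw [smul_smul, h3]
  module

theorem evenSum_oneForm_mul (v : V) (α β : FormsOn V) :
    evenSum hB X (oneForm (B v) * α) β =
      oneForm (B v) * evenSum hB X α β - oddSum hB X α (hook v β) := by
  have h1 : evenSum hB X (oneForm (B v) * α) β - oneForm (B v) * evenSum hB X α β =
      ∑ k ∈ Finset.range (n + 1), ((-1 : ℝ) ^ k / ((2 * k).factorial : ℝ) * (2 * k : ℕ)) •
        cwHom B hB X (2 * k - 1) α (hook v β) := by
    simp only [evenSum_apply, Finset.mul_sum, ← Finset.sum_sub_distrib]
    refine Finset.sum_congr rfl fun k _ => ?_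
    rw [cwHom_oneForm_mul_left_aux, pow_mul, neg_one_sq, one_pow, mul_smul_comm]
    module
  rw [sub_eq_iff_eq_add'.mp h1, sub_eq_add_neg]
  congr 1
  -- The index is shifted by one. The first term on one side carries the factor 2k = 0, and the last
  -- term on the other is a contraction of order 2n + 1 > n, hence zero.
  rw [oddSum_apply, Finset.sum_range_succ' _ n,
    Finset.sum_range_succ (fun k => ((-1 : ℝ) ^ k / ((2 * k + 1).factorial : ℝ)) •
      cwHom B hB X (2 * k + 1) α (hook v β)) n, cwHom_eq_zero_of_lt hB X (k := 2 * n + 1) (by omega)]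
  simp only [mul_zero, Nat.cast_zero, zero_smul, add_zero, smul_zero]
  rw [← Finset.sum_neg_distrib]
  refine Finset.sum_congr rfl fun k _ => ?_
  rw [show 2 * (k + 1) - 1 = 2 * k + 1 by omega, ← neg_smul]
  congr 1
  rw [show 2 * (k + 1) = (2 * k + 1) + 1 by ring, Nat.factorial_succ (2 * k + 1)]
  have h1 : ((2 * k + 1 + 1 : ℕ) : ℝ) ≠ 0 := by positivity
  have h2 : ((2 * k + 1).factorial : ℝ) ≠ 0 := by positivity
  rw [Nat.cast_mul]
  field_simp
  ring

theorem oddSum_neg_left (α β : FormsOn V) : oddSum hB X (-α) β = -oddSum hB X α β := by simp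

/-- Both sides agree on scalars and respond alike to Clifford multiplication of `α` from the left by
a covector, α ↦ v♭ ∧ α + v ⌟ α. The terms in which v acts on `β` arise on one side from contractions
hitting v♭ and on the other from the Leibniz rule for v ⌟. -/
theorem cliffHom_eq (hs : B.IsSymm) (α β : FormsOn V) :
    cliffHom B hB α β = evenSum hB X α β - oddSum hB X (gradeInv α) β := by
  obtain ⟨x, rfl⟩ := (toCliff hB).symm.surjective α
  induction x using CliffordAlgebra.left_induction with
  | algebraMap r =>
    have h1 : (toCliff hB).symm (algebraMap ℝ _ r) = algebraMap ℝ (FormsOn V) r := by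
      change CliffordAlgebra.equivExterior (cometric B hB) _ = _
      simp
    have h2 : ∀ k, 0 < k → cwHom B hB X k (algebraMap ℝ (FormsOn V) r) β = 0 := by
      intro k hk
      have := cwHom_homPart_eq_zero hB X hk (algebraMap ℝ (FormsOn V) r) β
      rwa [homPart_algebraMap, if_pos rfl] at this
    have h3 : oddSum hB X (algebraMap ℝ (FormsOn V) r) β = 0 := by
      rw [oddSum_apply]
      exact Finset.sum_eq_zero fun k _ => by rw [h2 _ (by omega), smul_zero]
    have h4 : evenSum hB X (algebraMap ℝ (FormsOn V) r) β = algebraMap ℝ (FormsOn V) r * β := by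
      rw [evenSum_apply, Finset.sum_eq_single 0]
      · simp [cwHom_zero]
      · intro k _ hk
        rw [h2 _ (by omega), smul_zero]
      · simp
    rw [h1, AlgHom.commutes, h3, h4, sub_zero]
    apply (toCliff hB).injective
    rw [toCliff_cliffHom, ← h1, LinearEquiv.apply_symm_apply, h1, ← Algebra.smul_def,
      ← Algebra.smul_def, map_smul]
  | add x y hx hy => simp only [map_add, LinearMap.add_apply, hx, hy]; abel
  | ι_mul x w hx =>
    obtain ⟨v, rfl⟩ := (B.toDual hB).surjective w
    have hw : B.toDual hB v = B v := by ext; rfl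
    rw [hw]
    set α := (toCliff hB).symm x with hα
    have h1 : (toCliff hB).symm (CliffordAlgebra.ι _ (B v) * x) =
        oneForm (B v) * α + hook v α := equivExterior_ι_mul hB hs v x
    have h2 : cliffHom B hB (oneForm (B v) * α + hook v α) β =
        oneForm (B v) * cliffHom B hB α β + hook v (cliffHom B hB α β) := by
      rw [← h1]
      apply (toCliff hB).injective
      rw [toCliff_cliffHom, map_add, toCliff_hook hB hs, toCliff_oneForm_mul hB hs,
        LinearEquiv.apply_symm_apply, toCliff_cliffHom, hα, LinearEquiv.apply_symm_apply,
        mul_assoc, ι_mul_eq_cliffOp 1]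
    rw [h1, h2, hx]
    simp only [map_add, map_sub, LinearMap.add_apply, map_mul, gradeInv_oneForm, gradeInv_hook,
      evenSum_oneForm_mul, neg_mul, oddSum_neg_left, oddSum_oneForm_mul, hook_evenSum,
      hook_oddSum, mul_sub, gradeInv_gradeInv]
    abel

theorem evenSum_swap (hs : B.IsSymm) (α : FormsOn V) {β : FormsOn V} (hβ : gradeInv β = β) :
    evenSum hB X β α = evenSum hB X α β := by
  simp only [evenSum_apply]
  refine Finset.sum_congr rfl fun k _ => ?_
  rw [cwHom_comm hB X hs]
  simp [pow_mul, hβ]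

theorem evenSum_swap' (hs : B.IsSymm) (α : FormsOn V) {β : FormsOn V} (hβ : gradeInv β = -β) :
    evenSum hB X β α = evenSum hB X (gradeInv α) β := by
  simp only [evenSum_apply]
  refine Finset.sum_congr rfl fun k _ => ?_
  rw [cwHom_comm' hB X hs] <;> simp [pow_mul, hβ]

theorem oddSum_swap (hs : B.IsSymm) (α : FormsOn V) {β : FormsOn V} (hβ : gradeInv β = -β) :
    oddSum hB X β α = oddSum hB X α β := by
  simp only [oddSum_apply]
  refine Finset.sum_congr rfl fun k _ => ?_
  rw [cwHom_comm hB X hs]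
  simp [pow_succ, pow_mul, hβ]

theorem oddSum_swap' (hs : B.IsSymm) (α : FormsOn V) {β : FormsOn V} (hβ : gradeInv β = β) :
    oddSum hB X β α = -oddSum hB X (gradeInv α) β := by
  simp only [oddSum_apply, ← Finset.sum_neg_distrib]
  refine Finset.sum_congr rfl fun k _ => ?_
  rw [cwHom_comm' hB X hs] <;> simp [pow_succ, pow_mul, hβ]

/-- Here, and for the other two parities below, exchanging the factors reproduces one of the sums in
`cliffHom_eq` and reverses the other; the commutator doubles the latter. -/
theorem commHom_odd_even (hs : B.IsSymm) {α β : FormsOn V} (hα : gradeInv α = -α)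
    (hβ : gradeInv β = β) : commHom B hB α β = (2 : ℝ) • oddSum hB X α β := by
  rw [commHom_apply, cliffHom_eq hB X hs, cliffHom_eq hB X hs, evenSum_swap hB X hs α hβ, hα, hβ,
    oddSum_swap' hB X hs α hβ, hα, oddSum_neg_left]
  module

theorem commHom_odd_odd (hs : B.IsSymm) {α β : FormsOn V} (hα : gradeInv α = -α)
    (hβ : gradeInv β = -β) : commHom B hB α β = (2 : ℝ) • evenSum hB X α β := by
  rw [commHom_apply, cliffHom_eq hB X hs, cliffHom_eq hB X hs, evenSum_swap' hB X hs α hβ, hα, hβ,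
    oddSum_neg_left, oddSum_neg_left, oddSum_swap hB X hs α hβ, map_neg, LinearMap.neg_apply]
  module

theorem commHom_even_even (hs : B.IsSymm) {α β : FormsOn V} (hα : gradeInv α = α)
    (hβ : gradeInv β = β) : commHom B hB α β = -((2 : ℝ) • oddSum hB X α β) := by
  rw [commHom_apply, cliffHom_eq hB X hs, cliffHom_eq hB X hs, evenSum_swap hB X hs α hβ, hα, hβ,
    oddSum_swap' hB X hs α hβ, hα]
  module

end Expansion

end KillingYano

namespace KillingYano

/-! ### Pointwise identities for the brackets and the potentials -/

section Pointwise

variable {V : Type*} [AddCommGroup V] [Module ℝ V] [FiniteDimensional ℝ V]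
  {B : LinearMap.BilinForm ℝ V} (hB : B.Nondegenerate) {n : ℕ} (X : Module.Basis (Fin n) ℝ V)

/-- The eigenvalue on forms of degree `p` of `∑ₐ Xᵃ ⌟ eₐ ∧` (`true`) or `∑ₐ eᵃ ∧ Xₐ ⌟` (`false`). -/
def numDeg (n : ℕ) (σ : Bool) (p : ℕ) : ℝ := if σ then (n : ℝ) - p else p

theorem sum_formOp_formOp (hs : B.IsSymm) (σ : Bool) (α : FormsOn V) :
    ∑ b, formOp B (!σ) (X b) (formOp B σ (B.dualBasis hB X b) α) = degOp n (numDeg n σ) α := by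
  cases σ
  · exact sum_oneForm_mul_hook_swap hB X hs α
  · exact sum_hook_oneForm_mul hB X α

include X in
theorem gradeInv_degOp_of_eq {c : ℝ} (f : ℕ → ℝ) {α : FormsOn V} (h : gradeInv α = c • α) :
    gradeInv (degOp n f α) = c • degOp n f α := by
  rw [gradeInv_degOp X, h, map_smul]

/-- The operator `formOp B τ v` lowers the eigenvalue of N_τ by one in both classes. Hence ½ (N_τ -
1) β solves the condition of `sum_formOp_bracket`, which explains the coefficients in the tilde
forms. -/
theorem sum_formOp_bracket_degOp (hs : B.IsSymm) (σ τ : Bool) {α β : FormsOn V}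
    (hα : gradeInv α = boolSign σ • α) (hβ : gradeInv β = -(boolSign τ • β)) :
    ∑ b, formOp B (σ == τ) (X b)
        (∑ a, cliffHom B hB (formOp B σ (B.dualBasis hB X a) α)
            (formOp B τ (B.dualBasis hB X b) (formOp B τ (X a) β)) +
          commHom B hB (formOp B σ (B.dualBasis hB X b) α)
            (degOp n (fun p => (numDeg n τ p - 1) / 2) β)) =
      (1 / 2 : ℝ) • commHom B hB (degOp n (numDeg n σ) α)
        (degOp n (fun p => numDeg n τ p - 1) β) -
      (1 / 2 : ℝ) • ∑ b, cliffHom B hB (oneForm (B (B.dualBasis hB X b)))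
        (∑ a, commHom B hB (formOp B σ (B.dualBasis hB X a) α)
          (formOp B τ (X a) (formOp B τ (X b) β))) := by
  rw [sum_formOp_bracket hB X hs σ τ hα, sum_formOp_formOp hB X hs]
  · congr 1
    rw [← map_smul]
    congr 1
    refine form_ext fun p => ?_
    rw [map_smul, homPart_degOp X, homPart_degOp X, smul_smul]
    ring_nf
  · rw [← neg_smul] at hβ ⊢
    exact gradeInv_degOp_of_eq X _ hβ
  · intro v
    rw [sum_formOp_formOp hB X hs]
    refine form_ext fun p => ?_
    rw [homPart_degOp X, map_smul]
    cases τ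
    · rw [formOp_false, formOp_false, homPart_hook, homPart_hook, homPart_degOp X, map_smul,
        smul_smul]
      simp only [numDeg, Bool.false_eq_true, if_false]
      congr 1
      push_cast
      ring
    · rw [formOp_true, formOp_true]
      cases p with
      | zero => simp only [homPart_oneForm_mul_zero, smul_zero]
      | succ p =>
        rw [homPart_oneForm_mul_succ, homPart_oneForm_mul_succ, homPart_degOp X, mul_smul_comm,
          smul_smul]
        simp only [numDeg, if_true]
        congr 1
        push_cast
        ring

/-! #### The potentials -/

/-- The pointwise co-potential `∑ₖ (-1)ᵏ / (2k+1)! α ∧₂ₖ β`. -/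
def potKK : FormsOn V →ₗ[ℝ] FormsOn V →ₗ[ℝ] FormsOn V :=
  ∑ k ∈ Finset.range (n + 1), ((-1 : ℝ) ^ k / ((2 * k + 1).factorial : ℝ)) •
    (cwHom B hB X (2 * k)).compl₁₂ (degOp n fun p => (p : ℝ)) (degOp n fun p => (p : ℝ))

theorem potKK_apply (α β : FormsOn V) : potKK hB X α β =
    ∑ k ∈ Finset.range (n + 1), ((-1 : ℝ) ^ k / ((2 * k + 1).factorial : ℝ)) •
      cwHom B hB X (2 * k) (degOp n (fun p => (p : ℝ)) α) (degOp n (fun p => (p : ℝ)) β) := by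
  simp [potKK]

/-- In the Leibniz expansion the term with X^b ⌟ X_b ⌟ β vanishes, and the other one raises the
order from 2k to 2k + 1. Taking π through the hook turns it into π - 1. -/
theorem sum_hook_potKK (hs : B.IsSymm) (α β : FormsOn V) :
    ∑ b, hook (B.dualBasis hB X b) (potKK hB X α (hook (X b) β)) =
      oddSum hB X (degOp n (fun p => (p : ℝ)) α) (degOp n (fun p => (p : ℝ) - 1) β) := by
  have hd : ∀ b, degOp n (fun p => (p : ℝ)) (hook (X b) β) =
      hook (X b) (degOp n (fun p => (p : ℝ) - 1) β) := by
    intro b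
    rw [hook_degOp X]
    push_cast
    simp only [add_sub_cancel_right]
  simp only [potKK_apply, map_sum, map_smul, oddSum_apply, hd]
  rw [Finset.sum_comm]
  refine Finset.sum_congr rfl fun k _ => ?_
  rw [← Finset.smul_sum]
  congr 1
  simp only [hook_cwHom, pow_mul, neg_one_sq, one_pow, one_smul, Finset.sum_add_distrib]
  rw [← map_sum, sum_hook_hook hB X hs, map_zero, add_zero, cwHom_succ_swap hB X hs]

theorem potKK_swap (hs : B.IsSymm) {α β : FormsOn V} (hα : gradeInv α = -α)
    (hβ : gradeInv β = -β) : potKK hB X β α = -potKK hB X α β := by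
  have h : ∀ {γ : FormsOn V}, gradeInv γ = -γ → gradeInv (degOp n (fun p => (p : ℝ)) γ) =
      -degOp n (fun p => (p : ℝ)) γ := by
    intro γ hγ
    rw [gradeInv_degOp X, hγ, map_neg]
  simp only [potKK_apply, ← Finset.sum_neg_distrib]
  refine Finset.sum_congr rfl fun k _ => ?_
  rw [cwHom_comm' hB X hs] <;> simp [pow_mul, h hα, h hβ]

/-- The pointwise potential `∑ₖ (-1)ᵏ / (2k+1)! ((π - 2k)⁻¹ π α) ∧₂ₖ₊₁ ((n - π) β)`. -/
def potKM : FormsOn V →ₗ[ℝ] FormsOn V →ₗ[ℝ] FormsOn V :=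
  ∑ k ∈ Finset.range (n + 1), ((-1 : ℝ) ^ k / ((2 * k + 1).factorial : ℝ)) •
    (cwHom B hB X (2 * k + 1)).compl₁₂ (degOp n fun p => ((p : ℝ) - 2 * k)⁻¹ * p)
      (degOp n fun p => (n : ℝ) - p)

theorem potKM_apply (α β : FormsOn V) : potKM hB X α β =
    ∑ k ∈ Finset.range (n + 1), ((-1 : ℝ) ^ k / ((2 * k + 1).factorial : ℝ)) •
      cwHom B hB X (2 * k + 1) (degOp n (fun p => ((p : ℝ) - 2 * k)⁻¹ * p) α)
        (degOp n (fun p => (n : ℝ) - p) β) := by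
  simp [potKM]

/-- Insert π = e^a ∧ X_a ⌟ in (πα) ∧_k β: the contractions hitting e^a account for k α ∧_k β, and
the rest is the left side up to sign. -/
theorem sum_oneForm_mul_cwHom_hook (k : ℕ) (α β : FormsOn V) :
    ∑ a, oneForm (B (B.dualBasis hB X a)) * cwHom B hB X k (hook (X a) α) β =
      (-1 : ℝ) ^ k • cwHom B hB X k (degOp n (fun p => (p : ℝ) - k) α) β := by
  have h1 : cwHom B hB X k (degOp n (fun p => (p : ℝ)) α) β =
      (-1 : ℝ) ^ k • (∑ a, oneForm (B (B.dualBasis hB X a)) *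
        cwHom B hB X k (hook (X a) α) β) + (k : ℝ) • cwHom B hB X k α β := by
    rw [← sum_oneForm_mul_hook hB X, map_sum, LinearMap.sum_apply]
    simp only [cwHom_oneForm_mul_left_aux, Finset.sum_add_distrib, ← Finset.smul_sum]
    congr 1
    cases k with
    | zero => simp
    | succ k => rw [cwHom_succ]; rfl
  have h2 : degOp n (fun p => (p : ℝ) - k) α = degOp n (fun p => (p : ℝ)) α - (k : ℝ) • α := by
    refine form_ext fun p => ?_
    rw [map_sub, map_smul, homPart_degOp X, homPart_degOp X, sub_smul]
  rw [h2, map_sub, map_smul, LinearMap.sub_apply, LinearMap.smul_apply, h1, add_sub_cancel_right,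
    smul_smul, ← mul_pow]
  simp

/-- The part with e^a ∧ e_a vanishes, so a contraction must hit e_a. This costs a factor 2k + 1,
which lowers the factorial, and the remaining e^a ∧ (X_a ⌟ α) ∧_{2k} yields π - 2k. The inverse in
the potential is there to cancel it; on odd degrees it is not zero. -/
theorem sum_oneForm_mul_potKM_right (hs : B.IsSymm) {α : FormsOn V} (hα : gradeInv α = -α)
    (β : FormsOn V) :
    ∑ a, oneForm (B (B.dualBasis hB X a)) * potKM hB X α (oneForm (B (X a)) * β) =
      evenSum hB X (degOp n (fun p => (p : ℝ)) α) (degOp n (fun p => (n : ℝ) - p - 1) β) := by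
  have hd : ∀ a, degOp n (fun p => (n : ℝ) - p) (oneForm (B (X a)) * β) =
      oneForm (B (X a)) * (degOp n (fun p => (n : ℝ) - p - 1) β) := by
    intro a
    rw [degOp_oneForm_mul X]
    push_cast
    simp only [sub_add_eq_sub_sub]
  simp only [potKM_apply, hd, Finset.mul_sum, evenSum_apply]
  rw [Finset.sum_comm]
  refine Finset.sum_congr rfl fun k _ => ?_
  simp only [mul_smul_comm, cwHom_oneForm_mul_right hB X hs, mul_add, smul_add,
    Finset.sum_add_distrib, ← Finset.smul_sum]
  rw [sum_oneForm_mul_oneForm_mul hB X hs, smul_zero, zero_add, sum_oneForm_mul_cwHom_hook,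
    degOp_degOp X, pow_mul, neg_one_sq, one_pow, one_smul, smul_smul]
  have h1 : degOp n (fun p => ((p : ℝ) - (2 * k : ℕ)) * (((p : ℝ) - 2 * k)⁻¹ * p)) α =
      degOp n (fun p => (p : ℝ)) α := by
    refine degOp_congr X fun p => ?_
    rcases Nat.even_or_odd p with hp | hp
    · exact Or.inl (homPart_eq_zero_of_even hα hp)
    · right
      have : (p : ℝ) - 2 * k ≠ 0 := by
        rw [sub_ne_zero]
        intro h
        have h' : p = 2 * k := by exact_mod_cast h
        rw [h'] at hp
        exact (Nat.not_odd_iff_even.mpr (even_two_mul k)) hp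
      push_cast
      field_simp
  rw [h1]
  congr 1
  rw [Nat.factorial_succ, Nat.cast_mul, Nat.cast_succ]
  have h2 : ((2 * k : ℕ) : ℝ) + 1 ≠ 0 := by positivity
  have h3 : ((2 * k).factorial : ℝ) ≠ 0 := by positivity
  field_simp

/-- Here the order stays 2k + 1 and the wedge product yields -(π - 2k - 1). The inverse in the
potential, shifted by the hook, cancels it, being applied to even degrees only. -/
theorem sum_oneForm_mul_potKM_left {α : FormsOn V} (hα : gradeInv α = α) (β : FormsOn V) :
    ∑ a, oneForm (B (B.dualBasis hB X a)) * potKM hB X (hook (X a) α) β =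
      -oddSum hB X (degOp n (fun p => (p : ℝ) - 1) α) (degOp n (fun p => (n : ℝ) - p) β) := by
  simp only [potKM_apply, Finset.mul_sum, oddSum_apply, ← Finset.sum_neg_distrib]
  rw [Finset.sum_comm]
  refine Finset.sum_congr rfl fun k _ => ?_
  have hd : ∀ a, degOp n (fun p => ((p : ℝ) - 2 * k)⁻¹ * p) (hook (X a) α) =
      hook (X a) (degOp n (fun p => ((p : ℝ) - 1 - 2 * k)⁻¹ * ((p : ℝ) - 1)) α) := by
    intro a
    rw [hook_degOp X]
    push_cast
    simp only [add_sub_cancel_right]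
  simp only [hd, mul_smul_comm, ← Finset.smul_sum]
  rw [sum_oneForm_mul_cwHom_hook, degOp_degOp X, Odd.neg_one_pow ⟨k, rfl⟩, neg_one_smul, smul_neg]
  congr 4
  refine degOp_congr X fun p => ?_
  rcases Nat.even_or_odd p with hp | hp
  · right
    have : (p : ℝ) - 1 - 2 * k ≠ 0 := by
      rw [sub_sub, sub_ne_zero]
      intro h
      have h' : p = 1 + 2 * k := by exact_mod_cast h
      rw [h'] at hp
      exact (Nat.not_even_iff_odd.mpr ⟨k, add_comm _ _⟩) hp
    have h2 : (p : ℝ) - (2 * k + 1 : ℕ) = (p : ℝ) - 1 - 2 * k := by push_cast; ring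
    rw [h2]
    field_simp
  · exact Or.inl (homPart_eq_zero_of_odd hα hp)

/-- The pointwise co-potential
`∑ₖ (-1)ᵏ / (2k+1)! (n - π - 2k)⁻¹ (((n - π) α) ∧₂ₖ₊₁ ((n - π) β))`. -/
def potMM : FormsOn V →ₗ[ℝ] FormsOn V →ₗ[ℝ] FormsOn V :=
  ∑ k ∈ Finset.range (n + 1), ((-1 : ℝ) ^ k / ((2 * k + 1).factorial : ℝ)) •
    ((cwHom B hB X (2 * k + 1)).compl₁₂ (degOp n fun p => (n : ℝ) - p)
      (degOp n fun p => (n : ℝ) - p)).compr₂ (degOp n fun p => ((n : ℝ) - p - 2 * k)⁻¹)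

theorem potMM_apply (α β : FormsOn V) : potMM hB X α β =
    ∑ k ∈ Finset.range (n + 1), ((-1 : ℝ) ^ k / ((2 * k + 1).factorial : ℝ)) •
      degOp n (fun p => ((n : ℝ) - p - 2 * k)⁻¹) (cwHom B hB X (2 * k + 1)
        (degOp n (fun p => (n : ℝ) - p) α) (degOp n (fun p => (n : ℝ) - p) β)) := by
  simp [potMM]

theorem potMM_swap (hs : B.IsSymm) {α β : FormsOn V} (hα : gradeInv α = α)
    (hβ : gradeInv β = β) : potMM hB X β α = -potMM hB X α β := by
  have h : ∀ {γ : FormsOn V}, gradeInv γ = γ → gradeInv (degOp n (fun p => (n : ℝ) - p) γ) =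
      degOp n (fun p => (n : ℝ) - p) γ := by
    intro γ hγ
    rw [gradeInv_degOp X, hγ]
  simp only [potMM_apply, ← Finset.sum_neg_distrib]
  refine Finset.sum_congr rfl fun k _ => ?_
  rw [cwHom_comm' hB X hs] <;> simp [pow_succ, pow_mul, h hα, h hβ]

theorem sum_hook_potMM (hs : B.IsSymm) {α : FormsOn V} (hα : gradeInv α = α) (β : FormsOn V)
    (hden : ∀ r s k : ℕ, homPart r (degOp n (fun p => (n : ℝ) - p) α) ≠ 0 →
      homPart s (degOp n (fun p => (n : ℝ) - p - 1) β) ≠ 0 →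
      (n : ℤ) - ((r : ℤ) + (s + 1 : ℕ) - 2 * (2 * k + 1)) - 2 * k ≠ 0) :
    ∑ a, hook (B.dualBasis hB X a) (potMM hB X α (oneForm (B (X a)) * β)) =
      oddSum hB X (degOp n (fun p => (n : ℝ) - p) α)
        (degOp n (fun p => (n : ℝ) - p - 1) β) := by
  set α' := degOp n (fun p => (n : ℝ) - p) α with hα'
  set β' := degOp n (fun p => (n : ℝ) - p - 1) β with hβ'
  have hη : gradeInv α' = α' := by rw [hα', gradeInv_degOp X, hα]
  have hd : ∀ a, degOp n (fun p => (n : ℝ) - p) (oneForm (B (X a)) * β) =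
      oneForm (B (X a)) * β' := by
    intro a
    rw [degOp_oneForm_mul X]
    push_cast
    simp only [sub_add_eq_sub_sub, hβ']
  simp only [potMM_apply, hd, map_sum, map_smul, oddSum_apply]
  rw [Finset.sum_comm]
  refine Finset.sum_congr rfl fun k _ => ?_
  rw [← Finset.smul_sum]
  congr 1
  simp only [hook_degOp X, ← hα']
  rw [← map_sum]
  -- X^a ⌟ e_a ∧ contributes n - π. If a contraction hits e_a instead, X^a ⌟ must act on `β'`, as
  -- X^a ⌟ X_a ⌟ vanishes; this gives 2k + 1 times the product, with a minus sign from η(X_a ⌟ α').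
  have h1 : ∑ a, hook (B.dualBasis hB X a) (cwHom B hB X (2 * k + 1) α' (oneForm (B (X a)) * β')) =
      degOp n (fun p => (n : ℝ) - p - (2 * k + 1)) (cwHom B hB X (2 * k + 1) α' β') := by
    simp only [cwHom_oneForm_mul_right hB X hs, hη, map_add, map_smul, Finset.sum_add_distrib,
      ← Finset.smul_sum, hook_cwHom, pow_mul, neg_one_sq, one_pow, one_smul, gradeInv_hook,
      map_neg, LinearMap.neg_apply, Finset.sum_neg_distrib]
    rw [sum_hook_oneForm_mul_swap hB X hs, ← LinearMap.sum_apply, ← map_sum,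
      sum_hook_hook hB X hs, map_zero, LinearMap.zero_apply, zero_add, ← cwHom_succ]
    refine form_ext fun p => ?_
    rw [map_add, map_smul, map_neg, homPart_degOp X, homPart_degOp X]
    push_cast
    module
  rw [h1, degOp_degOp X]
  conv_rhs => rw [← degOp_one X (cwHom B hB X (2 * k + 1) α' β')]
  refine degOp_congr X fun p => ?_
  -- The inverse is taken in degree `p + 1`, before the hook. Where the denominator is zero the
  -- inverse is zero by convention and nothing cancels; there the degree `p` part of the product has
  -- to vanish, which `hden` ensures. The `s + 1` in `hden` is the degree of e_a ∧ β'.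
  by_cases h0 : (n : ℝ) - (p + 1 : ℕ) - 2 * k = 0
  · left
    refine homPart_cwHom_eq_zero hB X p _ _ _ fun r s hrs => ?_
    by_contra hcon
    rw [not_or] at hcon
    refine hden r s k hcon.1 hcon.2 ?_
    have h2 : (n : ℤ) - (p + 1 : ℕ) - 2 * k = 0 := by exact_mod_cast h0
    push_cast at h2 ⊢
    have h3 : (r : ℤ) + s = p + 2 * (2 * k + 1) := by exact_mod_cast hrs
    linarith
  · right
    have h2 : (n : ℝ) - p - (2 * k + 1) = (n : ℝ) - (p + 1 : ℕ) - 2 * k := by push_cast; ring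
    rw [h2]
    exact inv_mul_cancel₀ h0

/-! #### The second order condition -/

/-- Left and right multiplication are written through wedge products and hooks. Double wedges and
double hooks contract to zero, the mixed terms give (n - π) - π, and bringing e_a to the left of α
costs η, hence (-1)^π. -/
theorem sum_ι_mul_mul_ι (hs : B.IsSymm) (α : FormsOn V) :
    ∑ a, CliffordAlgebra.ι _ (B (B.dualBasis hB X a)) * toCliff hB α *
      CliffordAlgebra.ι _ (B (X a)) =
      toCliff hB (degOp n (fun p => ((n : ℝ) - 2 * p) * (-1) ^ p) α) := by
  have h1 : ∀ v w, CliffordAlgebra.ι _ (B v) * toCliff hB α * CliffordAlgebra.ι _ (B w) =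
      toCliff hB (oneForm (B v) * (oneForm (B w) * gradeInv α) -
        oneForm (B v) * hook w (gradeInv α) + (hook v (oneForm (B w) * gradeInv α)) -
        hook v (hook w (gradeInv α))) := by
    intro v w
    simp only [map_add, map_sub, toCliff_oneForm_mul hB hs, toCliff_hook hB hs, toCliff_gradeInv]
    have h2 : toCliff hB α * CliffordAlgebra.ι _ (B w) =
        cliffOp 1 (B w) (CliffordAlgebra.involute (toCliff hB α)) -
          cliffOp (-1) (B w) (CliffordAlgebra.involute (toCliff hB α)) := by
      simp only [cliffOp_apply, CliffordAlgebra.involute_involute]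
      module
    rw [mul_assoc, h2, ι_mul_eq_cliffOp 1, map_sub, map_sub]
    abel
  simp only [h1]
  rw [← map_sum]
  congr 1
  simp only [Finset.sum_add_distrib, Finset.sum_sub_distrib]
  rw [sum_oneForm_mul_oneForm_mul hB X hs, sum_oneForm_mul_hook, sum_hook_hook hB X hs,
    sum_hook_oneForm_mul_swap hB X hs, gradeInv_eq_degOp X, degOp_degOp X, degOp_degOp X]
  refine form_ext fun p => ?_
  simp only [map_sub, map_add, homPart_degOp X, map_zero]
  module

theorem sum_ι_mul_ι (hs : B.IsSymm) :
    ∑ a, CliffordAlgebra.ι (cometric B hB) (B (B.dualBasis hB X a)) *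
      CliffordAlgebra.ι (cometric B hB) (B (X a)) = algebraMap ℝ _ (n : ℝ) := by
  have h := sum_ι_mul_mul_ι hB X hs (1 : FormsOn V)
  have h1 : toCliff hB (1 : FormsOn V) = 1 := by
    rw [toCliff, LinearEquiv.symm_apply_eq]
    simp
  have h2 : degOp n (fun p => ((n : ℝ) - 2 * p) * (-1) ^ p) (1 : FormsOn V) =
      (n : ℝ) • (1 : FormsOn V) := by
    refine form_ext fun p => ?_
    rw [homPart_degOp X, map_smul, ← map_one (algebraMap ℝ (FormsOn V)), homPart_algebraMap]
    split_ifs with h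
    · subst h; simp
    · simp
  rw [h2, map_smul, h1] at h
  rw [Algebra.algebraMap_eq_smul_one]
  simpa only [mul_one] using h

/-- The operator `∑ₐ eᵃ · eₐ` of two-sided Clifford multiplication. -/
def sandwich (n : ℕ) : FormsOn V →ₗ[ℝ] FormsOn V :=
  degOp n (fun p => ((n : ℝ) - 2 * p) * (-1) ^ p)

/-- With these parities α^a = ½ (e^a α + α e^a) in either class, and the four products contract to
`sandwich` or to n. The right side no longer involves a frame or the classes, so its covariant
derivative is accessible. -/
theorem sum_commHom_formOp (hs : B.IsSymm) (σ τ : Bool) {α β : FormsOn V}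
    (hα : gradeInv α = boolSign σ • α) (hβ : gradeInv β = boolSign τ • β) :
    ∑ a, commHom B hB (formOp B σ (B.dualBasis hB X a) α) (formOp B τ (X a) β) =
      (1 / 4 : ℝ) • (commHom B hB (sandwich n α) β + commHom B hB α (sandwich n β) +
        sandwich n (commHom B hB α β) + (n : ℝ) • commHom B hB α β) := by
  have hop : ∀ (σ : Bool) (v : V) (α : FormsOn V), gradeInv α = boolSign σ • α →
      toCliff hB (formOp B σ v α) = (1 / 2 : ℝ) • (CliffordAlgebra.ι _ (B v) * toCliff hB α +
        toCliff hB α * CliffordAlgebra.ι _ (B v)) := by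
    intro σ v α h
    rw [toCliff_formOp hB hs, cliffOp_apply, ← toCliff_gradeInv, h, map_smul, smul_mul_assoc,
      smul_smul, boolSign_mul_self, one_smul]
  have hsw : ∀ x : CliffordAlgebra (cometric B hB),
      ∑ a, CliffordAlgebra.ι _ (B (X a)) * x * CliffordAlgebra.ι _ (B (B.dualBasis hB X a)) =
      ∑ a, CliffordAlgebra.ι _ (B (B.dualBasis hB X a)) * x * CliffordAlgebra.ι _ (B (X a)) := by
    intro x
    have h := sum_cliffOp_swap hB X hs ((LinearMap.mul ℝ (CliffordAlgebra (cometric B hB))).compl₁₂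
      ((LinearMap.mulRight ℝ x).comp (CliffordAlgebra.ι (cometric B hB)))
      (CliffordAlgebra.ι (cometric B hB)))
    simpa using h
  have hT : ∀ γ : FormsOn V, toCliff hB (sandwich n γ) =
      ∑ a, CliffordAlgebra.ι _ (B (B.dualBasis hB X a)) * toCliff hB γ *
        CliffordAlgebra.ι _ (B (X a)) := fun γ => (sum_ι_mul_mul_ι hB X hs γ).symm
  have hn' : ∑ a, CliffordAlgebra.ι (cometric B hB) (B (X a)) *
        CliffordAlgebra.ι (cometric B hB) (B (B.dualBasis hB X a)) =
      ∑ a, CliffordAlgebra.ι (cometric B hB) (B (B.dualBasis hB X a)) *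
        CliffordAlgebra.ι (cometric B hB) (B (X a)) := by
    have := hsw 1
    simpa only [mul_one] using this
  set x := toCliff hB α with hx
  set y := toCliff hB β with hy
  apply (toCliff hB).injective
  have h1 : ∀ u v : V, (1 / 2 : ℝ) • (CliffordAlgebra.ι (cometric B hB) (B u) * x +
        x * CliffordAlgebra.ι _ (B u)) * ((1 / 2 : ℝ) • (CliffordAlgebra.ι _ (B v) * y +
        y * CliffordAlgebra.ι _ (B v))) =
      (1 / 4 : ℝ) • ((CliffordAlgebra.ι _ (B u) * x * CliffordAlgebra.ι _ (B v)) * y +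
        CliffordAlgebra.ι _ (B u) * (x * y) * CliffordAlgebra.ι _ (B v) +
        x * (CliffordAlgebra.ι _ (B u) * CliffordAlgebra.ι _ (B v)) * y +
        x * (CliffordAlgebra.ι _ (B u) * y * CliffordAlgebra.ι _ (B v))) := by
    intro u v
    rw [smul_mul_smul_comm, show (1 / 2 : ℝ) * (1 / 2) = 1 / 4 by norm_num]
    congr 1
    simp only [add_mul, mul_add, mul_assoc]
    abel
  have h2 : ∀ u v : V, (1 / 2 : ℝ) • (CliffordAlgebra.ι (cometric B hB) (B u) * y +
        y * CliffordAlgebra.ι _ (B u)) * ((1 / 2 : ℝ) • (CliffordAlgebra.ι _ (B v) * x +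
        x * CliffordAlgebra.ι _ (B v))) =
      (1 / 4 : ℝ) • ((CliffordAlgebra.ι _ (B u) * y * CliffordAlgebra.ι _ (B v)) * x +
        CliffordAlgebra.ι _ (B u) * (y * x) * CliffordAlgebra.ι _ (B v) +
        y * (CliffordAlgebra.ι _ (B u) * CliffordAlgebra.ι _ (B v)) * x +
        y * (CliffordAlgebra.ι _ (B u) * x * CliffordAlgebra.ι _ (B v))) := by
    intro u v
    rw [smul_mul_smul_comm, show (1 / 2 : ℝ) * (1 / 2) = 1 / 4 by norm_num]
    congr 1
    simp only [add_mul, mul_add, mul_assoc]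
    abel
  simp only [map_sum (toCliff hB), map_add (toCliff hB), map_sub (toCliff hB),
    map_smul (toCliff hB), commHom_apply, toCliff_cliffHom, hop σ _ α hα, hop τ _ β hβ, ← hx, ← hy,
    h1, h2, map_sub (sandwich n)]
  simp only [Finset.sum_sub_distrib, ← Finset.smul_sum, Finset.sum_add_distrib,
    ← Finset.mul_sum, ← Finset.sum_mul, hsw, hn']
  rw [sum_ι_mul_ι hB X hs]
  simp only [hT, ← hx, ← hy, toCliff_cliffHom, mul_assoc x, mul_assoc y, ← Algebra.smul_def,
    mul_smul_comm]
  module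

end Pointwise

end KillingYano

namespace KillingYano

/-! ### Componentwise calculus of fields of forms on `ℝⁿ` -/

section Calculus

variable {n : ℕ}

/-- Differentiability of a field of forms at a point. -/
def FormDiffAt (W : Model n → FormsOn (Model n)) (y : Model n) : Prop :=
  ∀ I, DifferentiableAt ℝ (fun z => (formBasis n).repr (W z) I) y

variable {W W₁ W₂ : Model n → FormsOn (Model n)} {y : Model n}

theorem FormDiffAt.congr (h : FormDiffAt W₁ y) (he : W₂ =ᶠ[nhds y] W₁) : FormDiffAt W₂ y :=
  fun I => (h I).congr_of_eventuallyEq (he.fun_comp fun w => (formBasis n).repr w I)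

theorem partialForm_congr (he : W₂ =ᶠ[nhds y] W₁) (v : Model n) :
    partialForm W₂ y v = partialForm W₁ y v := by
  refine Finset.sum_congr rfl fun I _ => ?_
  have h : (fun z => (formBasis n).repr (W₂ z) I) =ᶠ[nhds y] fun z => (formBasis n).repr (W₁ z) I :=
    he.fun_comp fun w => (formBasis n).repr w I
  rw [h.fderiv_eq]

theorem repr_partialForm (v : Model n) (I : Finset (Fin n)) :
    (formBasis n).repr (partialForm W y v) I =
      fderiv ℝ (fun z => (formBasis n).repr (W z) I) y v := by
  rw [partialForm, (formBasis n).repr_sum_self]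

theorem FormDiffAt.sum {ι : Type*} {s : Finset ι} {W : ι → Model n → FormsOn (Model n)}
    (h : ∀ i ∈ s, FormDiffAt (W i) y) : FormDiffAt (fun z => ∑ i ∈ s, W i z) y := by
  intro I
  simp only [map_sum, Finsupp.coe_finsetSum, Finset.sum_apply]
  exact DifferentiableAt.fun_sum fun i hi => h i hi I

theorem partialForm_sum {ι : Type*} {s : Finset ι} {W : ι → Model n → FormsOn (Model n)}
    (h : ∀ i ∈ s, FormDiffAt (W i) y) (v : Model n) :
    partialForm (fun z => ∑ i ∈ s, W i z) y v = ∑ i ∈ s, partialForm (W i) y v := by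
  refine (formBasis n).ext_elem fun I => ?_
  simp only [repr_partialForm, map_sum, Finsupp.coe_finsetSum, Finset.sum_apply]
  rw [fderiv_fun_sum fun i hi => h i hi I]
  simp

theorem FormDiffAt.smul {f : Model n → ℝ} (hf : DifferentiableAt ℝ f y) (h : FormDiffAt W y) :
    FormDiffAt (fun z => f z • W z) y := by
  intro I
  simp only [map_smul, Finsupp.smul_apply, smul_eq_mul]
  exact hf.mul (h I)

theorem partialForm_smul {f : Model n → ℝ} (hf : DifferentiableAt ℝ f y) (h : FormDiffAt W y)
    (v : Model n) : partialForm (fun z => f z • W z) y v =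
      fderiv ℝ f y v • W y + f y • partialForm W y v := by
  refine (formBasis n).ext_elem fun I => ?_
  simp only [repr_partialForm, map_smul, map_add, Finsupp.smul_apply, Finsupp.add_apply,
    smul_eq_mul]
  rw [fderiv_fun_mul hf (h I)]
  simp only [add_apply, smul_apply, smul_eq_mul]
  ring

theorem formDiffAt_const (w : FormsOn (Model n)) : FormDiffAt (fun _ => w) y :=
  fun _ => differentiableAt_const _

theorem partialForm_const (w : FormsOn (Model n)) (v : Model n) :
    partialForm (fun _ => w) y v = 0 := by
  simp [partialForm]

theorem apply_eq_sum_repr {E : Type*} [AddCommGroup E] [Module ℝ E]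
    (L : FormsOn (Model n) →ₗ[ℝ] E) (w : FormsOn (Model n)) :
    L w = ∑ I, (formBasis n).repr w I • L (formBasis n I) := by
  conv_lhs => rw [← (formBasis n).sum_repr w]
  simp only [map_sum, map_smul]

theorem FormDiffAt.bilin (F : FormsOn (Model n) →ₗ[ℝ] FormsOn (Model n) →ₗ[ℝ] FormsOn (Model n))
    (h₁ : FormDiffAt W₁ y) (h₂ : FormDiffAt W₂ y) : FormDiffAt (fun z => F (W₁ z) (W₂ z)) y := by
  have h : (fun z => F (W₁ z) (W₂ z)) = fun z => ∑ I, (formBasis n).repr (W₁ z) I •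
      ∑ J, (formBasis n).repr (W₂ z) J • F (formBasis n I) (formBasis n J) := by
    funext z
    rw [apply_eq_sum_repr F, LinearMap.sum_apply]
    refine Finset.sum_congr rfl fun I _ => ?_
    rw [LinearMap.smul_apply, apply_eq_sum_repr (F _)]
  rw [h]
  exact FormDiffAt.sum fun I _ => (FormDiffAt.sum fun J _ => (formDiffAt_const _).smul (h₂ J)).smul
    (h₁ I)

theorem FormDiffAt.linear (L : FormsOn (Model n) →ₗ[ℝ] FormsOn (Model n))
    (h : FormDiffAt W y) : FormDiffAt (fun z => L (W z)) y := by
  have h1 : (fun z => L (W z)) = fun z => ∑ I, (formBasis n).repr (W z) I • L (formBasis n I) :=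
    funext fun z => apply_eq_sum_repr L _
  rw [h1]
  exact FormDiffAt.sum fun I _ => (formDiffAt_const _).smul (h I)

theorem partialForm_linear (L : FormsOn (Model n) →ₗ[ℝ] FormsOn (Model n))
    (h : FormDiffAt W y) (v : Model n) :
    partialForm (fun z => L (W z)) y v = L (partialForm W y v) := by
  have h1 : (fun z => L (W z)) = fun z => ∑ I, (formBasis n).repr (W z) I • L (formBasis n I) :=
    funext fun z => apply_eq_sum_repr L _
  rw [h1, partialForm_sum fun I _ => (formDiffAt_const _).smul (h I), apply_eq_sum_repr L]
  refine Finset.sum_congr rfl fun I _ => ?_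
  rw [partialForm_smul (h I) (formDiffAt_const _), partialForm_const, smul_zero, add_zero,
    repr_partialForm]

theorem partialForm_bilin
    (F : FormsOn (Model n) →ₗ[ℝ] FormsOn (Model n) →ₗ[ℝ] FormsOn (Model n))
    (h₁ : FormDiffAt W₁ y) (h₂ : FormDiffAt W₂ y) (v : Model n) :
    partialForm (fun z => F (W₁ z) (W₂ z)) y v =
      F (partialForm W₁ y v) (W₂ y) + F (W₁ y) (partialForm W₂ y v) := by
  have h : ∀ w w', F w w' = ∑ I, (formBasis n).repr w I • F (formBasis n I) w' := by
    intro w w'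
    rw [apply_eq_sum_repr F, LinearMap.sum_apply]
    rfl
  have h0 : (fun z => F (W₁ z) (W₂ z)) = fun z => ∑ I, (formBasis n).repr (W₁ z) I •
      F (formBasis n I) (W₂ z) := funext fun z => h _ _
  rw [h0, partialForm_sum fun I _ => (h₂.linear _).smul (h₁ I), h (partialForm W₁ y v), h (W₁ y),
    ← Finset.sum_add_distrib]
  refine Finset.sum_congr rfl fun I _ => ?_
  rw [partialForm_smul (h₁ I) (h₂.linear _), partialForm_linear _ h₂, repr_partialForm]

end Calculus

/-! ### The Leibniz rule for contracted wedge products -/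

section Leibniz

variable {n : ℕ}

/-- The derivation `∑_c θᶜ ∧ ∂_c ⌟` of the algebra of forms. -/
def connOp (θ : Fin n → Module.Dual ℝ (Model n)) : FormsOn (Model n) →ₗ[ℝ] FormsOn (Model n) :=
  ∑ c, (LinearMap.mulLeft ℝ (oneForm (θ c))).comp (hook (coordBasis n c))

theorem connOp_apply (θ : Fin n → Module.Dual ℝ (Model n)) (α : FormsOn (Model n)) :
    connOp θ α = ∑ c, oneForm (θ c) * hook (coordBasis n c) α := by
  simp [connOp]

theorem connOp_mul (θ : Fin n → Module.Dual ℝ (Model n)) (α β : FormsOn (Model n)) :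
    connOp θ (α * β) = connOp θ α * β + α * connOp θ β := by
  simp only [connOp_apply, Finset.sum_mul, Finset.mul_sum, ← Finset.sum_add_distrib]
  refine Finset.sum_congr rfl fun c _ => ?_
  rw [hook_mul, mul_add, ← mul_assoc, ← mul_assoc, ← mul_assoc, oneForm_mul_gradeInv]

/-- The commutator of the connection with a coordinate hook is a connection coefficient term, to be
compensated later by the derivative of the inverse metric. -/
theorem hook_connOp (θ : Fin n → Module.Dual ℝ (Model n)) (a : Fin n) (α : FormsOn (Model n)) :
    hook (coordBasis n a) (connOp θ α) =
      ∑ c, θ c (coordBasis n a) • hook (coordBasis n c) α +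
        connOp θ (hook (coordBasis n a) α) := by
  simp only [connOp_apply, map_sum, hook_oneForm_mul, ← Finset.sum_add_distrib]
  refine Finset.sum_congr rfl fun c _ => ?_
  rw [hook_hook_anticomm (coordBasis n c), mul_neg, sub_eq_add_neg]

/-- The contracted wedge product in coordinates, for a matrix of inverse metric components. -/
def cwMat (H : Matrix (Fin n) (Fin n) ℝ) :
    ℕ → FormsOn (Model n) →ₗ[ℝ] FormsOn (Model n) →ₗ[ℝ] FormsOn (Model n)
  | 0 => LinearMap.mul ℝ (FormsOn (Model n))
  | k + 1 => ∑ a, ∑ b, H a b • (cwMat H k).compl₁₂ (hook (coordBasis n a)) (hook (coordBasis n b))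

theorem cwMat_zero (H : Matrix (Fin n) (Fin n) ℝ) (α β : FormsOn (Model n)) :
    cwMat H 0 α β = α * β := rfl

theorem cwMat_succ (H : Matrix (Fin n) (Fin n) ℝ) (k : ℕ) (α β : FormsOn (Model n)) :
    cwMat H (k + 1) α β = ∑ a, ∑ b,
      H a b • cwMat H k (hook (coordBasis n a) α) (hook (coordBasis n b) β) := by
  simp [cwMat]

variable {H : Model n → Matrix (Fin n) (Fin n) ℝ} {y : Model n}

theorem FormDiffAt.cwMat (hH : ∀ a b, DifferentiableAt ℝ (fun z => H z a b) y) (k : ℕ)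
    {W₁ W₂ : Model n → FormsOn (Model n)} (h₁ : FormDiffAt W₁ y) (h₂ : FormDiffAt W₂ y) :
    FormDiffAt (fun z => cwMat (H z) k (W₁ z) (W₂ z)) y := by
  induction k generalizing W₁ W₂ with
  | zero => exact FormDiffAt.bilin (LinearMap.mul ℝ (FormsOn (Model n))) h₁ h₂
  | succ k ih =>
    simp only [cwMat_succ]
    exact FormDiffAt.sum fun a _ => FormDiffAt.sum fun b _ =>
      (ih (h₁.linear _) (h₂.linear _)).smul (hH a b)

/-- The assumption `hθ` says that `H` is parallel for the connection `θ`. Commuting the derivative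
with the hooks leaves one connection term for each index of `H`; after relabelling (`h5`, `h6`) they
cancel against the derivative of `H`. -/
theorem partialForm_cwMat (hH : ∀ a b, DifferentiableAt ℝ (fun z => H z a b) y) {v : Model n}
    {θ : Fin n → Module.Dual ℝ (Model n)}
    (hθ : ∀ a b, fderiv ℝ (fun z => H z a b) y v =
      -∑ c, (θ a (coordBasis n c) * H y c b + θ b (coordBasis n c) * H y a c)) (k : ℕ)
    {W₁ W₂ : Model n → FormsOn (Model n)} (h₁ : FormDiffAt W₁ y) (h₂ : FormDiffAt W₂ y) :
    partialForm (fun z => cwMat (H z) k (W₁ z) (W₂ z)) y v -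
        connOp θ (cwMat (H y) k (W₁ y) (W₂ y)) =
      cwMat (H y) k (partialForm W₁ y v - connOp θ (W₁ y)) (W₂ y) +
        cwMat (H y) k (W₁ y) (partialForm W₂ y v - connOp θ (W₂ y)) := by
  induction k generalizing W₁ W₂ with
  | zero =>
    have := partialForm_bilin (LinearMap.mul ℝ (FormsOn (Model n))) h₁ h₂ v
    simp only [LinearMap.mul_apply'] at this
    simp only [cwMat_zero, this, connOp_mul, sub_mul, mul_sub]
    abel
  | succ k ih =>
    have hk : ∀ a b, FormDiffAt (fun z => KillingYano.cwMat (H z) k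
        (hook (coordBasis n a) (W₁ z)) (hook (coordBasis n b) (W₂ z))) y :=
      fun a b => FormDiffAt.cwMat hH k (h₁.linear _) (h₂.linear _)
    have hn : ∀ {W : Model n → FormsOn (Model n)}, FormDiffAt W y → ∀ a,
        partialForm (fun z => hook (coordBasis n a) (W z)) y v -
          connOp θ (hook (coordBasis n a) (W y)) =
        hook (coordBasis n a) (partialForm W y v - connOp θ (W y)) +
          ∑ c, θ c (coordBasis n a) • hook (coordBasis n c) (W y) := by
      intro W hW a
      rw [partialForm_linear _ hW, map_sub, hook_connOp]
      abel
    simp only [cwMat_succ, map_sum, map_smul]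
    rw [partialForm_sum fun a _ => FormDiffAt.sum fun b _ => (hk a b).smul (hH a b)]
    have h3 : ∀ a, partialForm (fun z => ∑ b, H z a b • KillingYano.cwMat (H z) k
        (hook (coordBasis n a) (W₁ z)) (hook (coordBasis n b) (W₂ z))) y v =
        ∑ b, (fderiv ℝ (fun z => H z a b) y v • KillingYano.cwMat (H y) k
          (hook (coordBasis n a) (W₁ y)) (hook (coordBasis n b) (W₂ y)) +
          H y a b • partialForm (fun z => KillingYano.cwMat (H z) k
            (hook (coordBasis n a) (W₁ z)) (hook (coordBasis n b) (W₂ z))) y v) := by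
      intro a
      rw [partialForm_sum fun b _ => (hk a b).smul (hH a b)]
      exact Finset.sum_congr rfl fun b _ => partialForm_smul (hH a b) (hk a b) v
    simp only [h3]
    have h4 : ∀ a b, partialForm (fun z => KillingYano.cwMat (H z) k
            (hook (coordBasis n a) (W₁ z)) (hook (coordBasis n b) (W₂ z))) y v =
        connOp θ (KillingYano.cwMat (H y) k
          (hook (coordBasis n a) (W₁ y)) (hook (coordBasis n b) (W₂ y))) +
        (KillingYano.cwMat (H y) k
          (hook (coordBasis n a) (partialForm W₁ y v - connOp θ (W₁ y)))
          (hook (coordBasis n b) (W₂ y)) +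
        KillingYano.cwMat (H y) k (hook (coordBasis n a) (W₁ y))
          (hook (coordBasis n b) (partialForm W₂ y v - connOp θ (W₂ y)))) +
        (∑ c, θ c (coordBasis n a) • KillingYano.cwMat (H y) k
          (hook (coordBasis n c) (W₁ y)) (hook (coordBasis n b) (W₂ y)) +
        ∑ c, θ c (coordBasis n b) • KillingYano.cwMat (H y) k
          (hook (coordBasis n a) (W₁ y)) (hook (coordBasis n c) (W₂ y))) := by
      intro a b
      have := ih (h₁.linear (hook (coordBasis n a))) (h₂.linear (hook (coordBasis n b)))
      rw [hn h₁, hn h₂] at this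
      rw [sub_eq_iff_eq_add.mp this]
      simp only [map_add, LinearMap.add_apply, map_sum, LinearMap.sum_apply, map_smul,
        LinearMap.smul_apply]
      abel
    simp only [h4, smul_add, Finset.sum_add_distrib, hθ]
    have h5 : ∑ a, ∑ b, H y a b • ∑ c, θ c (coordBasis n a) • KillingYano.cwMat (H y) k
          (hook (coordBasis n c) (W₁ y)) (hook (coordBasis n b) (W₂ y)) =
        ∑ a, ∑ b, (∑ c, θ a (coordBasis n c) * H y c b) • KillingYano.cwMat (H y) k
          (hook (coordBasis n a) (W₁ y)) (hook (coordBasis n b) (W₂ y)) := by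
      simp only [Finset.smul_sum, Finset.sum_smul, smul_smul]
      rw [Finset.sum_comm]
      conv_rhs => rw [Finset.sum_comm]
      refine Finset.sum_congr rfl fun b _ => ?_
      rw [Finset.sum_comm]
      exact Finset.sum_congr rfl fun c _ => Finset.sum_congr rfl fun a _ => by rw [mul_comm]
    have h6 : ∑ a, ∑ b, H y a b • ∑ c, θ c (coordBasis n b) • KillingYano.cwMat (H y) k
          (hook (coordBasis n a) (W₁ y)) (hook (coordBasis n c) (W₂ y)) =
        ∑ a, ∑ b, (∑ c, θ b (coordBasis n c) * H y a c) • KillingYano.cwMat (H y) k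
          (hook (coordBasis n a) (W₁ y)) (hook (coordBasis n b) (W₂ y)) := by
      simp only [Finset.smul_sum, Finset.sum_smul, smul_smul]
      refine Finset.sum_congr rfl fun a _ => ?_
      rw [Finset.sum_comm]
      exact Finset.sum_congr rfl fun c _ => Finset.sum_congr rfl fun b _ => by rw [mul_comm]
    rw [h5, h6]
    simp only [neg_smul, Finset.sum_neg_distrib, add_smul]
    simp only [Finset.sum_add_distrib]
    abel

end Leibniz

end KillingYano

namespace KillingYano

/-! ### Metric compatibility of the Christoffel symbols -/

section Christoffel

variable {n : ℕ} {G : Model n → Matrix (Fin n) (Fin n) ℝ} {y : Model n}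

theorem differentiableAt_det {A : Model n → Matrix (Fin n) (Fin n) ℝ}
    (hA : ∀ a b, DifferentiableAt ℝ (fun z => A z a b) y) :
    DifferentiableAt ℝ (fun z => (A z).det) y := by
  simp only [Matrix.det_apply']
  refine DifferentiableAt.fun_sum fun σ _ => DifferentiableAt.const_mul ?_ _
  exact (HasFDerivAt.finsetProd fun i _ => (hA (σ i) i).hasFDerivAt).differentiableAt

theorem differentiableAt_inv_matrix (hG : ∀ a b, DifferentiableAt ℝ (fun z => G z a b) y)
    (hdet : (G y).det ≠ 0) (a b : Fin n) : DifferentiableAt ℝ (fun z => (G z)⁻¹ a b) y := by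
  simp only [Matrix.inv_def, Ring.inverse_eq_inv', Matrix.smul_apply, Matrix.adjugate_apply,
    smul_eq_mul]
  refine ((differentiableAt_det hG).inv hdet).mul (differentiableAt_det fun i j => ?_)
  simp only [Matrix.updateRow_apply]
  split_ifs
  · exact differentiableAt_const _
  · exact hG i j

theorem fderiv_eq_sum_partialScalar (f : Model n → ℝ) (v : Model n) :
    fderiv ℝ f y v = ∑ a, v a * partialScalar a f y := by
  conv_lhs => rw [← (coordBasis n).sum_repr v]
  simp [partialScalar, coordBasis]

/-- The connection one-forms `v ↦ vᵃ Γᶜₐᵦ dxᵇ` of the coordinate frame. -/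
def connForm (G : Model n → Matrix (Fin n) (Fin n) ℝ) (y v : Model n) (c : Fin n) :
    Module.Dual ℝ (Model n) :=
  ∑ a, ∑ b, (v a * christoffel G y c a b) • (coordBasis n).coord b

theorem nablaCoord_eq (W : Model n → FormsOn (Model n)) (v : Model n) :
    nablaCoord G W y v = partialForm W y v - connOp (connForm G y v) (W y) := by
  rw [nablaCoord, connOp_apply]
  rfl

theorem connForm_apply (v : Model n) (c b : Fin n) :
    connForm G y v c (coordBasis n b) = ∑ a, v a * christoffel G y c a b := by
  simp [connForm, Finsupp.single_apply]

/-- Lowering the upper index removes the inverse metric from the Christoffel symbols. -/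
theorem sum_mul_connForm (hdet : (G y).det ≠ 0) (v : Model n) (d b : Fin n) :
    ∑ c, G y d c * connForm G y v c (coordBasis n b) =
      ∑ a, v a * ((1 / 2) * (partialScalar a (fun z => G z d b) y +
        partialScalar b (fun z => G z a d) y - partialScalar d (fun z => G z a b) y)) := by
  have hinv : G y * (G y)⁻¹ = 1 := Matrix.mul_nonsing_inv _ (isUnit_iff_ne_zero.mpr hdet)
  simp only [connForm_apply, christoffel, Finset.mul_sum]
  rw [Finset.sum_comm]
  refine Finset.sum_congr rfl fun a _ => ?_
  rw [Finset.sum_comm]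
  rw [Finset.sum_congr rfl fun e _ => (?_ : _ = (G y * (G y)⁻¹) d e * (v a * ((1 / 2) *
    (partialScalar a (fun z => G z e b) y + partialScalar b (fun z => G z a e) y -
      partialScalar e (fun z => G z a b) y))))]
  · simp [hinv, Matrix.one_apply]
  · rw [Matrix.mul_apply, Finset.sum_mul]
    exact Finset.sum_congr rfl fun c _ => by ring

theorem fderiv_metric (hsymm : ∀ z a b, G z a b = G z b a) (hdet : (G y).det ≠ 0) (v : Model n)
    (a b : Fin n) : fderiv ℝ (fun z => G z a b) y v =
      ∑ c, (connForm G y v c (coordBasis n a) * G y c b +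
        G y a c * connForm G y v c (coordBasis n b)) := by
  rw [Finset.sum_add_distrib, sum_mul_connForm hdet]
  have h : ∑ c, connForm G y v c (coordBasis n a) * G y c b =
      ∑ c, G y b c * connForm G y v c (coordBasis n a) :=
    Finset.sum_congr rfl fun c _ => by rw [hsymm y c b, mul_comm]
  rw [h, sum_mul_connForm hdet, fderiv_eq_sum_partialScalar, ← Finset.sum_add_distrib]
  refine Finset.sum_congr rfl fun c _ => ?_
  have h1 : (fun z => G z b a) = fun z => G z a b := funext fun z => hsymm z b a
  rw [h1]
  ring

/-- Differentiate G⁻¹ G = 1, which holds near `y` because the determinant stays nonzero there, and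
insert metric compatibility in the matrix form dG = Tᵀ G + G T. -/
theorem fderiv_inv_metric (hsymm : ∀ z a b, G z a b = G z b a)
    (hG : ∀ a b, DifferentiableAt ℝ (fun z => G z a b) y) (hdet : (G y).det ≠ 0) (v : Model n)
    (a b : Fin n) : fderiv ℝ (fun z => (G z)⁻¹ a b) y v =
      -∑ c, (connForm G y v a (coordBasis n c) * (G y)⁻¹ c b +
        connForm G y v b (coordBasis n c) * (G y)⁻¹ a c) := by
  have hH := differentiableAt_inv_matrix hG hdet
  set dH : Matrix (Fin n) (Fin n) ℝ := Matrix.of fun a b => fderiv ℝ (fun z => (G z)⁻¹ a b) y v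
    with hdH
  set dG : Matrix (Fin n) (Fin n) ℝ := Matrix.of fun a b => fderiv ℝ (fun z => G z a b) y v
    with hdG
  set T : Matrix (Fin n) (Fin n) ℝ := Matrix.of fun c b => connForm G y v c (coordBasis n b)
    with hT
  have h1 : dG = T.transpose * G y + G y * T := by
    ext i j
    simp only [hdG, hT, Matrix.of_apply, Matrix.add_apply, Matrix.mul_apply,
      Matrix.transpose_apply, fderiv_metric hsymm hdet, Finset.sum_add_distrib]
  have h2 : dH * G y + (G y)⁻¹ * dG = 0 := by
    ext i j
    have hev : (fun z => ∑ c, (G z)⁻¹ i c * G z c j) =ᶠ[nhds y]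
        fun _ => (1 : Matrix (Fin n) (Fin n) ℝ) i j := by
      filter_upwards [(differentiableAt_det hG).continuousAt.eventually_ne hdet] with z hz
      rw [← Matrix.nonsing_inv_mul (G z) (isUnit_iff_ne_zero.mpr hz), Matrix.mul_apply]
    have h3 := congrArg (fun L : Model n →L[ℝ] ℝ => L v) hev.fderiv_eq
    rw [fderiv_fun_sum fun c _ => (hH i c).fun_mul (hG c j)] at h3
    simp only [fderiv_fun_const, Pi.zero_apply, zero_apply, sum_apply] at h3
    simp only [Matrix.add_apply, Matrix.mul_apply, hdH, hdG, Matrix.of_apply, Matrix.zero_apply,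
      ← Finset.sum_add_distrib]
    rw [← h3]
    refine Finset.sum_congr rfl fun c _ => ?_
    rw [fderiv_fun_mul (hH i c) (hG c j)]
    simp only [add_apply, smul_apply, smul_eq_mul]
    ring
  have hGH : G y * (G y)⁻¹ = 1 := Matrix.mul_nonsing_inv _ (isUnit_iff_ne_zero.mpr hdet)
  have hHG : (G y)⁻¹ * G y = 1 := Matrix.nonsing_inv_mul _ (isUnit_iff_ne_zero.mpr hdet)
  have h4 : dH = -(T * (G y)⁻¹ + (G y)⁻¹ * T.transpose) := by
    have h5 := congrArg (· * (G y)⁻¹) h2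
    simp only [add_mul, zero_mul, Matrix.mul_assoc, hGH, mul_one, h1] at h5
    rw [eq_neg_iff_add_eq_zero, ← h5, mul_add, ← Matrix.mul_assoc _ (G y), hHG, one_mul]
    abel
  have h6 := congrFun (congrFun h4 a) b
  simp only [Matrix.neg_apply, Matrix.add_apply, Matrix.mul_apply, Matrix.transpose_apply, hdH,
    hT, Matrix.of_apply] at h6
  rw [h6, Finset.sum_add_distrib]
  refine congrArg _ (congrArg _ (Finset.sum_congr rfl fun c _ => mul_comm _ _))

end Christoffel

end KillingYano

namespace KillingYano

/-! ### Charts -/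

section Charts

variable {n : ℕ} {M : Type*} [TopologicalSpace M] [ChartedSpace (Model n) M]
  [IsManifold (𝓡 n) ∞ M]

theorem isManifold_one (n : ℕ) (M : Type*) [TopologicalSpace M] [ChartedSpace (Model n) M]
    [IsManifold (𝓡 n) ∞ M] : IsManifold (𝓡 n) 1 M := IsManifold.of_le (n := ∞) (by norm_num)

/-- The tangent space at `x` is identified with the model space by the chart at `x` itself, so this
chart has the identity as derivative at its centre. -/
theorem chartDeriv_self (x : M) (v : TangentSpace (𝓡 n) x) : chartDeriv x v = v := by
  have := isManifold_one n M
  rw [chartDeriv, mfderiv_extChartAt_self]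
  rfl

theorem mfderiv_extChartAt_symm (x₀ : M) (y : Model n) :
    mfderiv 𝓘(ℝ, Model n) (𝓡 n) (extChartAt (𝓡 n) x₀).symm y =
      mfderivWithin 𝓘(ℝ, Model n) (𝓡 n) (extChartAt (𝓡 n) x₀).symm (Set.range (𝓡 n)) y := by
  rw [← mfderivWithin_univ, ModelWithCorners.range_eq_univ]

theorem chartInvDeriv_self (x : M) (v : Model n) :
    (chartInvDeriv x (extChartAt (𝓡 n) x x) v : Model n) = v := by
  have := isManifold_one n M
  rw [chartInvDeriv, mfderiv_extChartAt_symm]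
  exact congrArg (fun L : Model n →L[ℝ] Model n => L v) (mfderivWithin_range_extChartAt_symm (I := 𝓡 n) (x := x))

theorem chartInvDeriv_bijective (x₀ : M) {y : Model n} (hy : y ∈ (extChartAt (𝓡 n) x₀).target) :
    Function.Bijective (chartInvDeriv x₀ y) := by
  have := isManifold_one n M
  rw [chartInvDeriv, mfderiv_extChartAt_symm]
  exact (isInvertible_mfderivWithin_extChartAt_symm hy).bijective

variable (g : PseudoRiemannianMetric n M)

theorem contMDiffAt_gram (x₀ : M) (a b : Fin n) :
    ContMDiffAt (𝓡 n) 𝓘(ℝ, ℝ) ∞ (fun p : M => g.inner p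
      ((trivializationAt (Model n) (TangentSpace (𝓡 n)) x₀).localFrame (coordBasis n) a p)
      ((trivializationAt (Model n) (TangentSpace (𝓡 n)) x₀).localFrame (coordBasis n) b p)) x₀ := by
  have hx : x₀ ∈ (trivializationAt (Model n) (TangentSpace (𝓡 n) : M → Type _) x₀).baseSet :=
    FiberBundle.mem_baseSet_trivializationAt' x₀
  have hv : ∀ a, ContMDiffAt (𝓡 n) ((𝓡 n).prod 𝓘(ℝ, Model n)) ∞ (fun p : M =>
      Bundle.TotalSpace.mk' (Model n) p ((trivializationAt (Model n)
        (TangentSpace (𝓡 n)) x₀).localFrame (coordBasis n) a p)) x₀ :=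
    fun a => contMDiffAt_localFrame_of_mem ∞ _ _ a hx
  have : ContMDiffAt (𝓡 n) ((𝓡 n).prod 𝓘(ℝ, ℝ)) ∞
      (fun p : M ↦ Bundle.TotalSpace.mk' ℝ (E := Bundle.Trivial M ℝ) p (g.inner p
      ((trivializationAt (Model n) (TangentSpace (𝓡 n)) x₀).localFrame (coordBasis n) a p)
      ((trivializationAt (Model n) (TangentSpace (𝓡 n)) x₀).localFrame (coordBasis n) b p))) x₀ :=
    ContMDiffAt.clm_bundle_apply₂ (F₁ := Model n) (F₂ := Model n) g.contMDiff.contMDiffAt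
      (hv a) (hv b)
  simp only [Bundle.contMDiffAt_totalSpace] at this
  exact this.2

theorem eventually_target (x : M) :
    ∀ᶠ y in nhds (extChartAt (𝓡 n) x x), y ∈ (extChartAt (𝓡 n) x).target :=
  extChartAt_target_mem_nhds x

/-- The metric is smooth as a section of a bundle, hence so are its components in the local frame of
the trivialization at `x`. That frame is the image of the coordinate basis under the derivative of
the inverse chart (`h4`). -/
theorem differentiableAt_gram (x : M) (a b : Fin n) :
    DifferentiableAt ℝ (fun z => g.gram x z a b) (extChartAt (𝓡 n) x x) := by
  have := isManifold_one n M
  have h1 : ContMDiffAt 𝓘(ℝ, Model n) (𝓡 n) ∞ (extChartAt (𝓡 n) x).symm (extChartAt (𝓡 n) x x) :=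
    (contMDiffOn_extChartAt_symm x).contMDiffAt (extChartAt_target_mem_nhds x)
  have h2 := contMDiffAt_gram g x a b
  have h3 := (h2.comp_of_eq h1 (extChartAt_to_inv x)).contDiffAt.differentiableAt (by simp)
  refine h3.congr_of_eventuallyEq ?_
  filter_upwards [eventually_target x] with y hy
  have hz : (extChartAt (𝓡 n) x).symm y ∈ (chartAt (Model n) x).source := by
    rw [← extChartAt_source (𝓡 n)]
    exact (extChartAt (𝓡 n) x).map_target hy
  have h4 : ∀ c, (trivializationAt (Model n) (TangentSpace (𝓡 n)) x).localFrame (coordBasis n) c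
      ((extChartAt (𝓡 n) x).symm y) = chartInvDeriv x y (coordBasis n c) := by
    intro c
    rw [Bundle.Trivialization.localFrame_apply_of_mem_baseSet _ _ (by simpa using hz)]
    have h5 := TangentBundle.symmL_trivializationAt (I := 𝓡 n) hz
    rw [(extChartAt (𝓡 n) x).right_inv hy, ← mfderiv_extChartAt_symm] at h5
    have h6 := congrArg (fun L => L (coordBasis n c)) h5
    refine Eq.trans ?_ h6
    rw [Bundle.Trivialization.basisAt, Module.Basis.map_apply]
    exact (Bundle.Trivialization.symmL_apply _ (by simpa using hz) _).symm
  simp only [Function.comp_apply, h4]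
  rfl

end Charts

end KillingYano

namespace KillingYano

/-! ### Pull-back of forms -/

section PullBack

variable {V W : Type*} [AddCommGroup V] [Module ℝ V] [AddCommGroup W] [Module ℝ W]
  (f : V →ₗ[ℝ] W)

theorem pullForm_mul (α β : FormsOn W) : pullForm f (α * β) = pullForm f α * pullForm f β :=
  map_mul (ExteriorAlgebra.map f.dualMap) α β

theorem pullForm_algebraMap (r : ℝ) :
    pullForm f (algebraMap ℝ (FormsOn W) r) = algebraMap ℝ (FormsOn V) r :=
  (ExteriorAlgebra.map f.dualMap).commutes r

theorem pullForm_oneForm (θ : Module.Dual ℝ W) :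
    pullForm f (oneForm θ) = oneForm (f.dualMap θ) :=
  ExteriorAlgebra.map_apply_ι _ _

theorem hook_pullForm (v : V) (α : FormsOn W) :
    hook v (pullForm f α) = pullForm f (hook (f v) α) := by
  induction α using forms_induction with
  | algebraMap r => rw [pullForm_algebraMap, hook_algebraMap, hook_algebraMap, map_zero]
  | add x y hx hy => rw [map_add, map_add, hx, hy, map_add, map_add]
  | oneForm_mul θ x h =>
    rw [pullForm_mul, pullForm_oneForm, hook_oneForm_mul, h, hook_oneForm_mul, map_sub, map_smul,
      pullForm_mul, pullForm_oneForm, LinearMap.dualMap_apply]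

theorem homPart_pullForm (p : ℕ) (α : FormsOn W) :
    homPart p (pullForm f α) = pullForm f (homPart p α) := by
  induction α using forms_induction generalizing p with
  | algebraMap r =>
    rw [pullForm_algebraMap, homPart_algebraMap, homPart_algebraMap]
    split_ifs
    · rw [pullForm_algebraMap]
    · rw [map_zero]
  | add x y hx hy => rw [map_add, map_add, hx, hy, map_add, map_add]
  | oneForm_mul θ x h =>
    rw [pullForm_mul, pullForm_oneForm]
    cases p with
    | zero => rw [homPart_oneForm_mul_zero, homPart_oneForm_mul_zero, map_zero]
    | succ p =>
      rw [homPart_oneForm_mul_succ, homPart_oneForm_mul_succ, h, pullForm_mul, pullForm_oneForm]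

theorem pullForm_eq_self {f : V →ₗ[ℝ] V} (h : ∀ v, f v = v) (α : FormsOn V) :
    pullForm f α = α := by
  obtain rfl : f = LinearMap.id := LinearMap.ext h
  exact congrArg (fun L => L α) (ExteriorAlgebra.map_id (R := ℝ) (M := Module.Dual ℝ V))

theorem det_gram_ne_zero {n : ℕ} {B : LinearMap.BilinForm ℝ V} (hB : B.Nondegenerate)
    (Y : Module.Basis (Fin n) ℝ V) : (Matrix.of fun c d => B (Y c) (Y d)).det ≠ 0 := by
  have h := (LinearMap.BilinForm.nondegenerate_iff_det_ne_zero Y).mp hB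
  convert h using 2
  ext c d
  simp [LinearMap.BilinForm.toMatrix_apply]

/-- By basis independence `X` may be replaced by the image of the coordinate basis, whose metric
dual is given by the inverse Gram matrix. Thus one chart expresses the product uniformly around a
point, although the frames chosen at different points are unrelated. -/
theorem pullForm_cwHom {n : ℕ} [FiniteDimensional ℝ W] {B : LinearMap.BilinForm ℝ W}
    (hB : B.Nondegenerate) (hs : B.IsSymm) (X : Module.Basis (Fin n) ℝ W)
    {f : Model n →ₗ[ℝ] W} (hf : Function.Bijective f) (k : ℕ) (α β : FormsOn W) :
    pullForm f (cwHom B hB X k α β) =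
      cwMat (Matrix.of fun c d => B (f (coordBasis n c)) (f (coordBasis n d)))⁻¹ k
        (pullForm f α) (pullForm f β) := by
  induction k generalizing α β with
  | zero => rw [cwHom_zero, cwMat_zero, pullForm_mul]
  | succ k ih =>
    set Y : Module.Basis (Fin n) ℝ W := (coordBasis n).map (LinearEquiv.ofBijective f hf) with hY
    have hY' : ⇑Y = fun c => f (coordBasis n c) := funext fun c => by simp [hY]
    rw [cwHom_succ_basis hB X hs Y, cwMat_succ, map_sum]
    refine Finset.sum_congr rfl fun a _ => ?_
    rw [ih, dualBasis_eq_sum_inv_gram hB Y _ hY', hY', hook_pullForm]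
    have h : ∀ (c : Fin n → ℝ) (γ : FormsOn W),
        hook (∑ b, c b • f (coordBasis n b)) γ = ∑ b, c b • hook (f (coordBasis n b)) γ := by
      intro c γ
      simp only [← hookHom_apply, map_sum, map_smul, LinearMap.sum_apply, LinearMap.smul_apply]
    rw [h, map_sum, map_sum]
    refine Finset.sum_congr rfl fun b _ => ?_
    rw [map_smul, map_smul, ← hook_pullForm f, ← hook_pullForm f]

end PullBack

/-! ### The covariant derivative -/

section Nabla

variable {n : ℕ} {M : Type*} [TopologicalSpace M] [ChartedSpace (Model n) M]
  [IsManifold (𝓡 n) ∞ M]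

/-- Differentiability of a form at a point, in the chart at that point. -/
def DiffForm.DiffAt (φ : DiffForm n M) (x : M) : Prop :=
  FormDiffAt (φ.inChart x) (extChartAt (𝓡 n) x x)

theorem DiffForm.IsSmooth.diffAt {φ : DiffForm n M} (h : φ.IsSmooth) (x : M) : φ.DiffAt x :=
  fun I => (((h x I).contDiffAt (extChartAt_target_mem_nhds x)).differentiableAt (by simp))

theorem inChart_self (φ : DiffForm n M) (x : M) :
    φ.inChart x (extChartAt (𝓡 n) x x) = (φ x : FormsOn (Model n)) := by
  -- The inverse chart returns `x` only up to a propositional equality of base points, so the point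
  -- and the linear map are generalised before substituting.
  have h : ∀ (z : M) (_ : z = x) (L : Model n →ₗ[ℝ] TangentSpace (𝓡 n) z)
      (_ : ∀ v, (L v : Model n) = v), pullForm L (φ z) = (φ x : FormsOn (Model n)) := by
    rintro z rfl L hL
    exact pullForm_eq_self (V := Model n) hL (φ z)
  exact h _ (extChartAt_to_inv x) _ (chartInvDeriv_self x)

variable (g : PseudoRiemannianMetric n M)

theorem nablaX_eq (a : Fin n) (φ : DiffForm n M) (x : M) :
    g.nablaX a φ x = (partialForm (φ.inChart x) (extChartAt (𝓡 n) x x) (coordBasis n a) -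
      connOp (connForm (g.gram x) (extChartAt (𝓡 n) x x) (coordBasis n a)) (φ x) :
        FormsOn (Model n)) := by
  have h : ∀ w : FormsOn (Model n), pullForm (chartDeriv x) w = w :=
    fun w => pullForm_eq_self (V := Model n) (chartDeriv_self x) w
  have h1 : chartDeriv x (PseudoRiemannianMetric.lowerX x a) = coordBasis n a :=
    chartDeriv_self x _
  rw [PseudoRiemannianMetric.nablaX, PseudoRiemannianMetric.nabla, h, h1, nablaCoord_eq,
    inChart_self]

theorem gram_self (x : M) : g.gram x (extChartAt (𝓡 n) x x) =
    Matrix.of fun a b => g.bilin x (coordBasis n a : Model n) (coordBasis n b : Model n) := by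
  have h : ∀ (z : M) (_ : z = x) (L : Model n →ₗ[ℝ] TangentSpace (𝓡 n) z)
      (_ : ∀ v, (L v : Model n) = v) (v w : Model n),
      g.inner z (L v) (L w) = g.bilin x v w := by
    rintro z rfl L hL v w
    exact congrArg₂ (fun a b : TangentSpace (𝓡 n) z => g.inner z a b) (hL v) (hL w)
  ext a b
  exact h _ (extChartAt_to_inv x) _ (chartInvDeriv_self x) _ _

theorem bilin_isSymm (x : M) : (g.bilin x).IsSymm := ⟨fun v w => g.symm x v w⟩

theorem det_gram_ne_zero_of_mem (x : M) {y : Model n} (hy : y ∈ (extChartAt (𝓡 n) x).target) :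
    (g.gram x y).det ≠ 0 := by
  have h := det_gram_ne_zero (g.bilin_nondegenerate ((extChartAt (𝓡 n) x).symm y))
    ((coordBasis n).map (LinearEquiv.ofBijective _ (chartInvDeriv_bijective x hy)))
  simp only [Module.Basis.map_apply, LinearEquiv.ofBijective_apply] at h
  exact h

/-- The metric contracted wedge product at a point, as a bilinear map. -/
abbrev cwAt (x : M) (k : ℕ) : FormsOn (TangentSpace (𝓡 n) x) →ₗ[ℝ]
    FormsOn (TangentSpace (𝓡 n) x) →ₗ[ℝ] FormsOn (TangentSpace (𝓡 n) x) :=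
  cwHom (g.bilin x) (g.bilin_nondegenerate x) (frame x) k

/-- A pointwise linear operation on forms which commutes with covariant differentiation. -/
def IsParallelLin (L : ∀ x : M, FormsOn (TangentSpace (𝓡 n) x) →ₗ[ℝ]
    FormsOn (TangentSpace (𝓡 n) x)) : Prop :=
  ∀ (φ : DiffForm n M) (x : M), φ.DiffAt x → DiffForm.DiffAt (fun z => L z (φ z)) x ∧
    ∀ a, g.nablaX a (fun z => L z (φ z)) x = L x (g.nablaX a φ x)

/-- A pointwise bilinear operation on forms for which the Leibniz rule holds. -/
def IsParallelBilin (F : ∀ x : M, FormsOn (TangentSpace (𝓡 n) x) →ₗ[ℝ]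
    FormsOn (TangentSpace (𝓡 n) x) →ₗ[ℝ] FormsOn (TangentSpace (𝓡 n) x)) : Prop :=
  ∀ (α β : DiffForm n M) (x : M), α.DiffAt x → β.DiffAt x →
    DiffForm.DiffAt (fun z => F z (α z) (β z)) x ∧
    ∀ a, g.nablaX a (fun z => F z (α z) (β z)) x =
      F x (g.nablaX a α x) (β x) + F x (α x) (g.nablaX a β x)

/-- Near the centre of the chart the product is `cwMat` of the inverse metric components, which are
parallel by `fderiv_inv_metric`. At the centre the pull-back is the identity, and `hself` turns the
result back into the metric product. -/
theorem isParallelBilin_cwAt (k : ℕ) : IsParallelBilin g fun x => cwAt g x k := by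
  intro α β x hα hβ
  set y₀ := extChartAt (𝓡 n) x x with hy₀
  have hG := differentiableAt_gram g x
  have hdet : (g.gram x y₀).det ≠ 0 := det_gram_ne_zero_of_mem g x (mem_extChartAt_target x)
  have hsymm : ∀ z a b, g.gram x z a b = g.gram x z b a := fun z a b => g.symm _ _ _
  have hH := differentiableAt_inv_matrix hG hdet
  have hev : DiffForm.inChart (fun z => cwAt g z k (α z) (β z)) x =ᶠ[nhds y₀]
      fun y => cwMat (g.gram x y)⁻¹ k (α.inChart x y) (β.inChart x y) := by
    filter_upwards [eventually_target x] with y hy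
    exact pullForm_cwHom (g.bilin_nondegenerate _) (bilin_isSymm g _) _
      (chartInvDeriv_bijective x hy) k _ _
  have hself : ∀ A B : FormsOn (Model n), cwMat (g.gram x y₀)⁻¹ k A B =
      (cwAt g x k A B : FormsOn (Model n)) := by
    intro A B
    have h := pullForm_cwHom (g.bilin_nondegenerate x) (bilin_isSymm g x) (frame x)
      (f := (LinearMap.id : Model n →ₗ[ℝ] Model n)) Function.bijective_id k A B
    have hid : ∀ w : FormsOn (Model n), pullForm (LinearMap.id : Model n →ₗ[ℝ] Model n) w = w :=
      fun w => pullForm_eq_self (V := Model n) (fun _ => rfl) w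
    rw [gram_self]
    refine Eq.trans ?_ (h.symm.trans (hid _))
    exact congrArg₂ (fun A' B' => cwMat _ k A' B') (hid A).symm (hid B).symm
  refine ⟨FormDiffAt.congr (FormDiffAt.cwMat hH k hα hβ) hev, fun a => ?_⟩
  have h := partialForm_cwMat hH (fderiv_inv_metric hsymm hG hdet (coordBasis n a)) k hα hβ
  rw [nablaX_eq, partialForm_congr hev]
  rw [hself, hself, hself, inChart_self, inChart_self] at h
  refine h.trans ?_
  rw [nablaX_eq, nablaX_eq]
  rfl

theorem nablaX_zero (a : Fin n) : g.nablaX a (0 : DiffForm n M) = 0 := by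
  funext x
  have h : DiffForm.inChart (0 : DiffForm n M) x = fun _ => 0 := by
    exact funext fun y => map_zero (pullForm _)
  rw [nablaX_eq, h, partialForm_const, Pi.zero_apply]
  exact (zero_sub _).trans (neg_eq_zero.mpr (map_zero _))

theorem inChart_sum {ι : Type*} (s : Finset ι) (φ : ι → DiffForm n M) (x : M) :
    DiffForm.inChart (fun z => ∑ i ∈ s, φ i z) x = fun y => ∑ i ∈ s, (φ i).inChart x y :=
  funext fun _ => map_sum (pullForm _) _ _

theorem inChart_smul (c : ℝ) (φ : DiffForm n M) (x : M) :
    DiffForm.inChart (fun z => c • φ z) x = fun y => c • φ.inChart x y :=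
  funext fun _ => map_smul (pullForm _) _ _

theorem DiffForm.DiffAt.sum {ι : Type*} {s : Finset ι} {φ : ι → DiffForm n M} {x : M}
    (h : ∀ i ∈ s, (φ i).DiffAt x) : DiffForm.DiffAt (fun z => ∑ i ∈ s, φ i z) x := by
  rw [DiffForm.DiffAt, inChart_sum]
  exact FormDiffAt.sum h

theorem DiffForm.DiffAt.const_smul (c : ℝ) {φ : DiffForm n M} {x : M} (h : φ.DiffAt x) :
    DiffForm.DiffAt (fun z => c • φ z) x := by
  rw [DiffForm.DiffAt, inChart_smul]
  exact FormDiffAt.smul (differentiableAt_const c) h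

theorem nablaX_sum (a : Fin n) {ι : Type*} {s : Finset ι} {φ : ι → DiffForm n M} {x : M}
    (h : ∀ i ∈ s, (φ i).DiffAt x) :
    g.nablaX a (fun z => ∑ i ∈ s, φ i z) x = ∑ i ∈ s, g.nablaX a (φ i) x := by
  simp only [nablaX_eq]
  rw [inChart_sum, partialForm_sum h]
  refine Eq.trans ?_ (Finset.sum_sub_distrib _ _).symm
  exact congrArg _ (map_sum (connOp _) _ _)

theorem nablaX_const_smul (a : Fin n) (c : ℝ) {φ : DiffForm n M} {x : M} (h : φ.DiffAt x) :
    g.nablaX a (fun z => c • φ z) x = c • g.nablaX a φ x := by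
  simp only [nablaX_eq]
  rw [inChart_smul, partialForm_smul (differentiableAt_const c) h]
  refine Eq.trans ?_ (smul_sub c _ _).symm
  refine congrArg₂ _ ?_ (map_smul (connOp _) _ _)
  rw [fderiv_fun_const]
  exact (congrArg (· + _) (zero_smul ℝ _)).trans (zero_add _)

theorem isParallelLin_homPart (p : ℕ) : IsParallelLin g fun _ : M => homPart p := by
  intro φ x hφ
  have h : DiffForm.inChart (fun z => homPart p (φ z)) x = fun y => homPart p (φ.inChart x y) :=
    funext fun y => (homPart_pullForm _ p _).symm
  have hc : ∀ (θ : Fin n → Module.Dual ℝ (Model n)) (α : FormsOn (Model n)),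
      connOp θ (homPart p α) = homPart p (connOp θ α) := by
    intro θ α
    simp only [connOp_apply, map_sum]
    refine Finset.sum_congr rfl fun c _ => ?_
    cases p with
    | zero => rw [homPart_oneForm_mul_zero, hook_homPart_zero, mul_zero]
    | succ p => rw [homPart_oneForm_mul_succ, homPart_hook]
  refine ⟨?_, fun a => ?_⟩
  · rw [DiffForm.DiffAt, h]
    exact FormDiffAt.linear _ hφ
  · rw [nablaX_eq, nablaX_eq, h, partialForm_linear _ hφ]
    refine Eq.trans ?_ (map_sub (homPart (V := Model n) p) _ _).symm
    exact congrArg _ (hc _ _)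

end Nabla

end KillingYano

namespace KillingYano

/-! ### Parallel operations -/

section Parallel

variable {n : ℕ} {M : Type*} [TopologicalSpace M] [ChartedSpace (Model n) M]
  [IsManifold (𝓡 n) ∞ M] {g : PseudoRiemannianMetric n M}

theorem isParallelLin_sum_smul {ι : Type*} (s : Finset ι) (c : ι → ℝ)
    {L : ι → ∀ x : M, FormsOn (TangentSpace (𝓡 n) x) →ₗ[ℝ] FormsOn (TangentSpace (𝓡 n) x)}
    (h : ∀ i ∈ s, IsParallelLin g (L i)) : IsParallelLin g fun x => ∑ i ∈ s, c i • L i x := by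
  intro φ x hφ
  have hd : ∀ i ∈ s, DiffForm.DiffAt (fun z => c i • L i z (φ z)) x :=
    fun i hi => (h i hi φ x hφ).1.const_smul (c i)
  simp only [LinearMap.sum_apply, LinearMap.smul_apply]
  refine ⟨DiffForm.DiffAt.sum hd, fun a => ?_⟩
  rw [nablaX_sum g a hd]
  refine Finset.sum_congr rfl fun i hi => ?_
  rw [nablaX_const_smul g a _ (h i hi φ x hφ).1, (h i hi φ x hφ).2]

theorem isParallelLin_degOp (f : ℕ → ℝ) : IsParallelLin g fun _ : M => degOp n f :=
  isParallelLin_sum_smul _ f fun p _ => isParallelLin_homPart g p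

theorem isParallelLin_gradeInv : IsParallelLin g fun _ : M => gradeInv.toLinearMap := by
  have h : (fun x : M => (gradeInv (V := TangentSpace (𝓡 n) x)).toLinearMap) =
      fun x : M => degOp n fun p => (-1) ^ p :=
    funext fun x => LinearMap.ext fun w => gradeInv_eq_degOp (frame x) w
  rw [h]
  exact isParallelLin_degOp _

variable {F F₁ F₂ : ∀ x : M, FormsOn (TangentSpace (𝓡 n) x) →ₗ[ℝ]
    FormsOn (TangentSpace (𝓡 n) x) →ₗ[ℝ] FormsOn (TangentSpace (𝓡 n) x)}
  {L L₁ L₂ : ∀ x : M, FormsOn (TangentSpace (𝓡 n) x) →ₗ[ℝ] FormsOn (TangentSpace (𝓡 n) x)}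

theorem isParallelBilin_sum_smul {ι : Type*} (s : Finset ι) (c : ι → ℝ)
    {F : ι → ∀ x : M, FormsOn (TangentSpace (𝓡 n) x) →ₗ[ℝ]
      FormsOn (TangentSpace (𝓡 n) x) →ₗ[ℝ] FormsOn (TangentSpace (𝓡 n) x)}
    (h : ∀ i ∈ s, IsParallelBilin g (F i)) : IsParallelBilin g fun x => ∑ i ∈ s, c i • F i x := by
  intro α β x hα hβ
  have hd : ∀ i ∈ s, DiffForm.DiffAt (fun z => c i • F i z (α z) (β z)) x :=
    fun i hi => (h i hi α β x hα hβ).1.const_smul (c i)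
  simp only [LinearMap.sum_apply, LinearMap.smul_apply]
  refine ⟨DiffForm.DiffAt.sum hd, fun a => ?_⟩
  rw [nablaX_sum g a hd, ← Finset.sum_add_distrib]
  refine Finset.sum_congr rfl fun i hi => ?_
  rw [nablaX_const_smul g a _ (h i hi α β x hα hβ).1, (h i hi α β x hα hβ).2, smul_add]

theorem IsParallelBilin.sub (h₁ : IsParallelBilin g F₁) (h₂ : IsParallelBilin g F₂) :
    IsParallelBilin g fun x => F₁ x - F₂ x := by
  have h := isParallelBilin_sum_smul (g := g) Finset.univ boolSign
    (F := fun i x => bif i then F₁ x else F₂ x) (by rintro (_ | _) _ <;> assumption)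
  have e : ∀ x, F₁ x + (-1 : ℝ) • F₂ x = F₁ x - F₂ x := fun x =>
    LinearMap.ext₂ fun α β => (congrArg (F₁ x α β + ·) (neg_one_smul ℝ (F₂ x α β))).trans
      (sub_eq_add_neg _ _).symm
  simpa [boolSign, e] using h

theorem IsParallelBilin.add (h₁ : IsParallelBilin g F₁) (h₂ : IsParallelBilin g F₂) :
    IsParallelBilin g fun x => F₁ x + F₂ x := by
  have h := isParallelBilin_sum_smul (g := g) Finset.univ (fun _ => 1)
    (F := fun i x => bif i then F₁ x else F₂ x) (by rintro (_ | _) _ <;> assumption)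
  simpa using h

theorem IsParallelBilin.smul (c : ℝ) (h : IsParallelBilin g F) :
    IsParallelBilin g fun x => c • F x := by
  have h := isParallelBilin_sum_smul (g := g) (Finset.univ : Finset Unit) (fun _ => c)
    (F := fun _ => F) (fun _ _ => h)
  simpa using h

theorem IsParallelBilin.flip (h : IsParallelBilin g F) :
    IsParallelBilin g fun x => (F x).flip := by
  intro α β x hα hβ
  refine ⟨(h β α x hβ hα).1, fun a => ?_⟩
  exact ((h β α x hβ hα).2 a).trans (add_comm _ _)

theorem IsParallelBilin.compl₁ (h : IsParallelBilin g F) (h₁ : IsParallelLin g L) :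
    IsParallelBilin g fun x => (F x).comp (L x) := by
  intro α β x hα hβ
  obtain ⟨hd, hn⟩ := h _ β x (h₁ α x hα).1 hβ
  refine ⟨hd, fun a => (hn a).trans ?_⟩
  rw [(h₁ α x hα).2]
  rfl

theorem IsParallelBilin.compl₂ (h : IsParallelBilin g F) (h₁ : IsParallelLin g L) :
    IsParallelBilin g fun x => (F x).compl₂ (L x) :=
  (h.flip.compl₁ h₁).flip

theorem IsParallelBilin.compl₁₂ (h : IsParallelBilin g F) (h₁ : IsParallelLin g L₁)
    (h₂ : IsParallelLin g L₂) : IsParallelBilin g fun x => (F x).compl₁₂ (L₁ x) (L₂ x) :=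
  (h.compl₁ h₁).compl₂ h₂

theorem IsParallelBilin.compr₂ (h : IsParallelBilin g F) (h₁ : IsParallelLin g L) :
    IsParallelBilin g fun x => (F x).compr₂ (L x) := by
  intro α β x hα hβ
  obtain ⟨hd, hn⟩ := h α β x hα hβ
  refine ⟨(h₁ _ x hd).1, fun a => ((h₁ _ x hd).2 a).trans ?_⟩
  rw [hn, map_add]
  rfl

variable (g)

theorem isParallelBilin_potKK : IsParallelBilin g fun x =>
    potKK (g.bilin_nondegenerate x) (frame x) :=
  isParallelBilin_sum_smul _ _ fun k _ =>
    (isParallelBilin_cwAt g (2 * k)).compl₁₂ (isParallelLin_degOp _) (isParallelLin_degOp _)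

theorem isParallelBilin_potKM : IsParallelBilin g fun x =>
    potKM (g.bilin_nondegenerate x) (frame x) :=
  isParallelBilin_sum_smul _ _ fun k _ =>
    (isParallelBilin_cwAt g (2 * k + 1)).compl₁₂ (isParallelLin_degOp _) (isParallelLin_degOp _)

theorem isParallelBilin_potMM : IsParallelBilin g fun x =>
    potMM (g.bilin_nondegenerate x) (frame x) :=
  isParallelBilin_sum_smul _ _ fun k _ =>
    ((isParallelBilin_cwAt g (2 * k + 1)).compl₁₂ (isParallelLin_degOp _)
      (isParallelLin_degOp _)).compr₂ (isParallelLin_degOp _)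

theorem isParallelBilin_cliffHom : IsParallelBilin g fun x =>
    cliffHom (g.bilin x) (g.bilin_nondegenerate x) := by
  have h : (fun x => cliffHom (g.bilin x) (g.bilin_nondegenerate x)) = fun x =>
      evenSum (g.bilin_nondegenerate x) (frame x) -
        (oddSum (g.bilin_nondegenerate x) (frame x)).comp gradeInv.toLinearMap :=
    funext fun x => LinearMap.ext₂ fun α β => cliffHom_eq _ _ (bilin_isSymm g x) α β
  rw [h]
  exact (isParallelBilin_sum_smul _ _ fun k _ => isParallelBilin_cwAt g (2 * k)).sub
    (IsParallelBilin.compl₁ (isParallelBilin_sum_smul _ _ fun k _ =>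
      isParallelBilin_cwAt g (2 * k + 1)) isParallelLin_gradeInv)

theorem isParallelBilin_commHom : IsParallelBilin g fun x =>
    commHom (g.bilin x) (g.bilin_nondegenerate x) :=
  (isParallelBilin_cliffHom g).sub (isParallelBilin_cliffHom g).flip

/-- The contracted commutator `4 [αᵃ, βₐ]` in terms of commutators and the degree operator. -/
def contrComm (x : M) : FormsOn (TangentSpace (𝓡 n) x) →ₗ[ℝ]
    FormsOn (TangentSpace (𝓡 n) x) →ₗ[ℝ] FormsOn (TangentSpace (𝓡 n) x) :=
  let C := commHom (g.bilin x) (g.bilin_nondegenerate x)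
  (1 / 4 : ℝ) • (C.comp (sandwich n) + C.compl₂ (sandwich n) + C.compr₂ (sandwich n) + (n : ℝ) • C)

theorem isParallelBilin_contrComm : IsParallelBilin g (contrComm g) :=
  have h := isParallelBilin_commHom g
  have hs : IsParallelLin g fun _ : M => sandwich n := isParallelLin_degOp _
  IsParallelBilin.smul _ ((((h.compl₁ hs).add (h.compl₂ hs)).add (h.compr₂ hs)).add (h.smul _))

end Parallel

/-! ### Forms whose covariant derivative is determined by a single form -/

section Twistor

variable {n : ℕ} {M : Type*} [TopologicalSpace M] [ChartedSpace (Model n) M]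
  [IsManifold (𝓡 n) ∞ M] (g : PseudoRiemannianMetric n M)

/-- The form `φ` is odd with `∇ₐ φ = Xₐ ⌟ Φ` (for `σ = false`), respectively even with
`∇ₐ φ = eₐ ∧ Φ` (for `σ = true`). -/
structure HasTwistor (σ : Bool) (φ Φ : DiffForm n M) : Prop where
  smooth : φ.IsSmooth
  nabla : ∀ a x, g.nablaX a φ x = formOp (g.bilin x) σ (frame x a) (Φ x)
  gradeInv_left : ∀ x, gradeInv (φ x) = boolSign σ • φ x
  gradeInv_right : ∀ x, gradeInv (Φ x) = -(boolSign σ • Φ x)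

/-- The form `eᵃ ∧ φ` (for `σ = true`), respectively `Xᵃ ⌟ φ` (for `σ = false`). -/
def upper (σ : Bool) (a : Fin n) (φ : DiffForm n M) : DiffForm n M :=
  fun x => formOp (g.bilin x) σ (g.upperX x a) (φ x)

/-- The form `eₐ ∧ φ` (for `σ = true`), respectively `Xₐ ⌟ φ` (for `σ = false`). -/
def lower (σ : Bool) (a : Fin n) (φ : DiffForm n M) : DiffForm n M :=
  fun x => formOp (g.bilin x) σ (frame x a) (φ x)

theorem wedgeUpper_eq (a : Fin n) (φ : DiffForm n M) :
    PseudoRiemannianMetric.wedgeUpper a φ = upper g true a φ := by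
  funext x
  rw [PseudoRiemannianMetric.wedgeUpper, PseudoRiemannianMetric.upperE,
    coord_eq_apply_dualBasis (g.bilin x) (g.bilin_nondegenerate x)]
  rfl

theorem deg_apply (f : ℕ → ℝ) (φ : DiffForm n M) (x : M) :
    DiffForm.deg f φ x = degOp n f (φ x) := by
  simp [DiffForm.deg, degOp, DiffForm.part]

variable {g} {σ τ : Bool} {φ Φ ψ Ψ : DiffForm n M}

/-- Since ∇_a φ has the parity of φ, `contrComm` applied to it is again the contracted commutator.
-/
theorem HasTwistor.gradeInv_nablaX (h : HasTwistor g σ φ Φ) (a : Fin n) (x : M) :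
    gradeInv (g.nablaX a φ x) = boolSign σ • g.nablaX a φ x := by
  rw [h.nabla]
  cases σ
  · rw [formOp_false, gradeInv_hook, h.gradeInv_right]
    simp [boolSign]
  · rw [formOp_true, map_mul, gradeInv_oneForm, h.gradeInv_right]
    simp [boolSign]

theorem contrComm_eq {x : M} {α β : FormsOn (TangentSpace (𝓡 n) x)}
    (hα : gradeInv α = boolSign σ • α) (hβ : gradeInv β = boolSign τ • β) :
    contrComm g x α β = ∑ a, commHom (g.bilin x) (g.bilin_nondegenerate x)
      (formOp (g.bilin x) σ (g.upperX x a) α) (formOp (g.bilin x) τ (frame x a) β) :=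
  (sum_commHom_formOp (g.bilin_nondegenerate x) (frame x) (bilin_isSymm g x) σ τ hα hβ).symm

/-- The contracted commutator vanishes on all of `M`, so it may be differentiated; `contrComm` is
parallel. -/
theorem HasTwistor.contrComm_nablaX (h : HasTwistor g σ φ Φ) (h' : HasTwistor g τ ψ Ψ)
    (hC : ∑ a, g.comm (upper g σ a φ) (lower g τ a ψ) = 0) (b : Fin n) (x : M) :
    contrComm g x (g.nablaX b φ x) (ψ x) + contrComm g x (φ x) (g.nablaX b ψ x) = 0 := by
  rw [← (isParallelBilin_contrComm g φ ψ x (h.smooth.diffAt x) (h'.smooth.diffAt x)).2]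
  have h0 : (fun z => contrComm g z (φ z) (ψ z)) = (0 : DiffForm n M) := by
    rw [← hC]
    funext z
    rw [contrComm_eq (h.gradeInv_left z) (h'.gradeInv_left z), Finset.sum_apply]
    rfl
  rw [h0, nablaX_zero]
  rfl

/-- `φᵃ ∇ₐ ψᵇ + [φᵇ, ψ̃]`. -/
def halfBracket (g : PseudoRiemannianMetric n M) (σ τ : Bool) (φ ψ : DiffForm n M)
    (Ψt : DiffForm n M) (b : Fin n) : DiffForm n M :=
  ∑ a, g.cliff (upper g σ a φ) (upper g τ b (g.nablaX a ψ)) + g.comm (upper g σ b φ) Ψt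

theorem HasTwistor.sum_halfBracket (h : HasTwistor g σ φ Φ) (h' : HasTwistor g τ ψ Ψ) (x : M) :
    ∑ b, formOp (g.bilin x) (σ == τ) (frame x b)
        (halfBracket g σ τ φ ψ (DiffForm.deg (fun p => (numDeg n τ p - 1) / 2) Ψ) b x) =
      (1 / 2 : ℝ) • commHom (g.bilin x) (g.bilin_nondegenerate x) (degOp n (numDeg n σ) (φ x))
        (degOp n (fun p => numDeg n τ p - 1) (Ψ x)) -
      (1 / 2 : ℝ) • ∑ b, cliffHom (g.bilin x) (g.bilin_nondegenerate x)
        (oneForm (g.bilin x (g.upperX x b))) (contrComm g x (φ x) (g.nablaX b ψ x)) := by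
  have h1 := sum_formOp_bracket_degOp (g.bilin_nondegenerate x) (frame x) (bilin_isSymm g x) σ τ
    (h.gradeInv_left x) (h'.gradeInv_right x)
  refine Eq.trans (Finset.sum_congr rfl fun b _ => congrArg _ ?_) (h1.trans ?_)
  · simp only [halfBracket, Pi.add_apply, Finset.sum_apply]
    refine congrArg₂ _ (Finset.sum_congr rfl fun a _ => ?_) ?_
    · rw [← h'.nabla]
      rfl
    · rw [← deg_apply]
      rfl
  · refine congrArg₂ _ rfl (congrArg _ (Finset.sum_congr rfl fun b _ => ?_))
    rw [contrComm_eq (h.gradeInv_left x) (h'.gradeInv_nablaX b x), h'.nabla]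
    rfl

/-- The commutator is antisymmetric and the metric contraction symmetric. -/
theorem contrComm_swap {x : M} {α β : FormsOn (TangentSpace (𝓡 n) x)}
    (hα : gradeInv α = boolSign σ • α) (hβ : gradeInv β = boolSign τ • β) :
    contrComm g x β α = -contrComm g x α β := by
  rw [contrComm_eq hβ hα, contrComm_eq hα hβ, ← Finset.sum_neg_distrib]
  have h := sum_basis_dualBasis_swap (g.bilin_nondegenerate x) (frame x) (bilin_isSymm g x)
    ((commHom (g.bilin x) (g.bilin_nondegenerate x)).compl₁₂ ((formOp (g.bilin x) σ).flip α)
      ((formOp (g.bilin x) τ).flip β))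
  simp only [LinearMap.compl₁₂_apply, LinearMap.flip_apply] at h
  rw [Finset.sum_neg_distrib]
  refine Eq.trans ?_ (congrArg _ h)
  rw [← Finset.sum_neg_distrib]
  exact Finset.sum_congr rfl fun a _ => commHom_swap _ _ _

theorem HasTwistor.sum_bracket (h : HasTwistor g σ φ Φ) (h' : HasTwistor g τ ψ Ψ)
    (hC : ∑ a, g.comm (upper g σ a φ) (lower g τ a ψ) = 0) (x : M) :
    ∑ b, formOp (g.bilin x) (σ == τ) (frame x b)
        (halfBracket g σ τ φ ψ (DiffForm.deg (fun p => (numDeg n τ p - 1) / 2) Ψ) b x -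
          halfBracket g τ σ ψ φ (DiffForm.deg (fun p => (numDeg n σ p - 1) / 2) Φ) b x) =
      (1 / 2 : ℝ) • commHom (g.bilin x) (g.bilin_nondegenerate x) (degOp n (numDeg n σ) (φ x))
        (degOp n (fun p => numDeg n τ p - 1) (Ψ x)) -
      (1 / 2 : ℝ) • commHom (g.bilin x) (g.bilin_nondegenerate x) (degOp n (numDeg n τ) (ψ x))
        (degOp n (fun p => numDeg n σ p - 1) (Φ x)) := by
  have hστ : (σ == τ) = (τ == σ) := by cases σ <;> cases τ <;> rfl
  have h2 := h'.sum_halfBracket h x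
  rw [← hστ] at h2
  -- Antisymmetry combined with the differentiated condition makes the non-algebraic remainders of
  -- the two halves equal, so they drop out of the difference.
  have h3 : ∀ b, contrComm g x (ψ x) (g.nablaX b φ x) = contrComm g x (φ x) (g.nablaX b ψ x) := by
    intro b
    rw [contrComm_swap (h.gradeInv_nablaX b x) (h'.gradeInv_left x)]
    exact neg_eq_of_add_eq_zero_right (h.contrComm_nablaX h' hC b x)
  simp only [h3] at h2
  simp only [map_sub, Finset.sum_sub_distrib]
  rw [h.sum_halfBracket h' x, h2]
  abel

end Twistor

end KillingYano

namespace KillingYano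

/-! ### Killing-Yano and closed conformal Killing-Yano forms -/

section KillingYanoForms

variable {n : ℕ} {M : Type*} [TopologicalSpace M] [ChartedSpace (Model n) M]
  [IsManifold (𝓡 n) ∞ M] {g : PseudoRiemannianMetric n M} {φ : DiffForm n M}

theorem homPart_nablaX (hφ : φ.IsSmooth) (p : ℕ) (a : Fin n) (x : M) :
    homPart p (g.nablaX a φ x) = g.nablaX a (DiffForm.part p φ) x :=
  ((isParallelLin_homPart g p φ x (hφ.diffAt x)).2 a).symm

theorem homPart_nablaX_eq_zero (hφ : φ.IsSmooth) {p : ℕ} (hp : DiffForm.part p φ = 0) (a : Fin n)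
    (x : M) : homPart p (g.nablaX a φ x) = 0 := by
  rw [homPart_nablaX hφ, hp, nablaX_zero]
  rfl

theorem d_apply (φ : DiffForm n M) (x : M) :
    g.d φ x = ∑ a, formOp (g.bilin x) true (g.upperX x a) (g.nablaX a φ x) := by
  simp only [PseudoRiemannianMetric.d, wedgeUpper_eq g, Finset.sum_apply]
  rfl

theorem codiff_apply (φ : DiffForm n M) (x : M) :
    g.codiff φ x = -∑ a, hook (g.upperX x a) (g.nablaX a φ x) := by
  simp only [PseudoRiemannianMetric.codiff, Pi.neg_apply, Finset.sum_apply]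
  rfl

variable (g) in
/-- `π⁻¹ dκ`. -/
def kyPotential (κ : DiffForm n M) : DiffForm n M := DiffForm.deg (fun p => 1 / (p : ℝ)) (g.d κ)

variable (g) in
/-- `-(n - π)⁻¹ δφ`. -/
def ccPotential (φ : DiffForm n M) : DiffForm n M :=
  DiffForm.deg (fun p => -(1 / ((n : ℝ) - p))) (g.codiff φ)

theorem tildeK_eq (κ : DiffForm n M) :
    g.tildeK κ = DiffForm.deg (fun p => (numDeg n false p - 1) / 2) (kyPotential g κ) := by
  funext x
  rw [PseudoRiemannianMetric.tildeK, kyPotential, deg_apply, deg_apply, deg_apply,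
    degOp_degOp (frame x)]
  refine congrArg (fun f => degOp n f (g.d κ x)) (funext fun p => ?_)
  simp only [numDeg, Bool.false_eq_true, if_false]
  ring

theorem tildeM_eq (φ : DiffForm n M) :
    g.tildeM φ = DiffForm.deg (fun p => (numDeg n true p - 1) / 2) (ccPotential g φ) := by
  funext x
  rw [PseudoRiemannianMetric.tildeM, ccPotential, deg_apply, deg_apply, deg_apply,
    degOp_degOp (frame x)]
  refine congrArg (fun f => degOp n f (g.codiff φ x)) (funext fun p => ?_)
  simp only [numDeg, if_true, div_eq_mul_inv, mul_inv]
  ring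

/-- With δκ = 0 the CKY equation reads ∇_a κ = (π + 1)⁻¹ X_a ⌟ dκ; taking the degree operator inside
the hook replaces π + 1 by π. -/
theorem hasTwistor_of_isKY {κ : DiffForm n M} (h : g.IsKY κ) (ho : κ.IsOdd) :
    HasTwistor g false κ (kyPotential g κ) where
  smooth := h.1.1
  nabla a x := by
    have h1 := congrFun (h.1.2 a) x
    simp only [PseudoRiemannianMetric.twistor, Pi.add_apply, Pi.sub_apply, deg_apply, h.2] at h1
    have h2 : g.wedgeLower a (0 : DiffForm n M) x = 0 := mul_zero _
    rw [h2, map_zero, add_zero] at h1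
    rw [sub_eq_zero.mp h1, kyPotential, deg_apply, formOp_false, hook_degOp (frame x)]
    push_cast
    rfl
  gradeInv_left x := by
    simpa [boolSign] using gradeInv_eq_neg_of_odd fun p hp => congrFun (ho p hp) x
  gradeInv_right x := by
    rw [kyPotential, deg_apply, gradeInv_degOp (frame x), d_apply]
    have h1 : ∀ a, gradeInv (g.nablaX a κ x) = -g.nablaX a κ x := fun a =>
      gradeInv_eq_neg_of_odd fun p hp => homPart_nablaX_eq_zero h.1.1 (ho p hp) a x
    simp [formOp_true, gradeInv_oneForm, h1, boolSign]

/-- With dφ = 0 the CKY equation reads ∇_a φ = -(n - π + 1)⁻¹ e_a ∧ δφ; inside the wedge product n -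
π + 1 becomes n - π. -/
theorem hasTwistor_of_isCCKY (h : g.IsCCKY φ) (he : φ.IsEven) :
    HasTwistor g true φ (ccPotential g φ) where
  smooth := h.1.1
  nabla a x := by
    have h1 := congrFun (h.1.2 a) x
    simp only [PseudoRiemannianMetric.twistor, Pi.add_apply, Pi.sub_apply, deg_apply, h.2] at h1
    have h2 : PseudoRiemannianMetric.hookLower a (0 : DiffForm n M) x = 0 := map_zero _
    rw [h2, map_zero, sub_zero] at h1
    rw [eq_neg_of_add_eq_zero_left h1, ccPotential, deg_apply, formOp_true]
    refine (congrArg _ (degOp_oneForm_mul (frame x) _ _ _)).trans ?_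
    rw [← mul_neg]
    refine congrArg _ ?_
    simp only [degOp, LinearMap.sum_apply, LinearMap.smul_apply, neg_smul,
      Finset.sum_neg_distrib]
    push_cast
    simp only [sub_add_eq_sub_sub, sub_add_cancel]
  gradeInv_left x := by
    simpa [boolSign] using gradeInv_eq_self_of_even fun p hp => congrFun (he p hp) x
  gradeInv_right x := by
    rw [ccPotential, deg_apply, gradeInv_degOp (frame x), codiff_apply]
    have h1 : ∀ a, gradeInv (g.nablaX a φ x) = g.nablaX a φ x := fun a =>
      gradeInv_eq_self_of_even fun p hp => homPart_nablaX_eq_zero h.1.1 (he p hp) a x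
    simp [gradeInv_hook, h1, boolSign]

/-! ### Potentials -/

theorem potentialKK_eq (κ lam : DiffForm n M) : g.potentialKK κ lam =
    fun x => potKK (g.bilin_nondegenerate x) (frame x) (κ x) (lam x) := by
  funext x
  simp only [PseudoRiemannianMetric.potentialKK, potKK_apply, Finset.sum_apply, Pi.smul_apply,
    PseudoRiemannianMetric.cwedge, deg_apply, cwHom_apply]

theorem potentialKM_eq (μ φ : DiffForm n M) : g.potentialKM μ φ =
    fun x => potKM (g.bilin_nondegenerate x) (frame x) (μ x) (φ x) := by
  funext x
  simp only [PseudoRiemannianMetric.potentialKM, potKM_apply, Finset.sum_apply, Pi.smul_apply,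
    PseudoRiemannianMetric.cwedge, deg_apply, cwHom_apply]

theorem potentialMM_eq (α β : DiffForm n M) : g.potentialMM α β =
    fun x => potMM (g.bilin_nondegenerate x) (frame x) (α x) (β x) := by
  funext x
  simp only [PseudoRiemannianMetric.potentialMM, potMM_apply, Finset.sum_apply, Pi.smul_apply,
    PseudoRiemannianMetric.cwedge, deg_apply, cwHom_apply]

theorem gradeInv_degOp_of_neg {x : M} {α : FormsOn (TangentSpace (𝓡 n) x)} (f : ℕ → ℝ)
    (h : gradeInv α = -α) : gradeInv (degOp n f α) = -degOp n f α := by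
  rw [gradeInv_degOp (frame x), h, map_neg]

theorem gradeInv_degOp_of_self {x : M} {α : FormsOn (TangentSpace (𝓡 n) x)} (f : ℕ → ℝ)
    (h : gradeInv α = α) : gradeInv (degOp n f α) = degOp n f α := by
  rw [gradeInv_degOp (frame x), h]

theorem HasTwistor.odd {φ Φ : DiffForm n M} (h : HasTwistor g false φ Φ) (x : M) :
    gradeInv (φ x) = -φ x ∧ gradeInv (Φ x) = Φ x := by
  simpa [boolSign] using And.intro (h.gradeInv_left x) (h.gradeInv_right x)

theorem HasTwistor.even {φ Φ : DiffForm n M} (h : HasTwistor g true φ Φ) (x : M) :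
    gradeInv (φ x) = φ x ∧ gradeInv (Φ x) = -Φ x := by
  simpa [boolSign] using And.intro (h.gradeInv_left x) (h.gradeInv_right x)

theorem numDeg_false : numDeg n false = fun p : ℕ => (p : ℝ) := rfl
theorem numDeg_true : numDeg n true = fun p : ℕ => (n : ℝ) - p := rfl

theorem nablaX_potKK {α β A Bf : DiffForm n M} {σ τ : Bool} (h : HasTwistor g σ α A)
    (h' : HasTwistor g τ β Bf) (a : Fin n) (x : M) :
    g.nablaX a (g.potentialKK α β) x =
      potKK (g.bilin_nondegenerate x) (frame x)
          (formOp (g.bilin x) σ (frame x a) (A x)) (β x) +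
        potKK (g.bilin_nondegenerate x) (frame x) (α x)
          (formOp (g.bilin x) τ (frame x a) (Bf x)) := by
  have h1 := (isParallelBilin_potKK g α β x (h.smooth.diffAt x) (h'.smooth.diffAt x)).2 a
  rw [h.nabla a x, h'.nabla a x] at h1
  rw [potentialKK_eq]
  exact h1

theorem nablaX_potKM {α β A Bf : DiffForm n M} {σ τ : Bool} (h : HasTwistor g σ α A)
    (h' : HasTwistor g τ β Bf) (a : Fin n) (x : M) :
    g.nablaX a (g.potentialKM α β) x =
      potKM (g.bilin_nondegenerate x) (frame x)
          (formOp (g.bilin x) σ (frame x a) (A x)) (β x) +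
        potKM (g.bilin_nondegenerate x) (frame x) (α x)
          (formOp (g.bilin x) τ (frame x a) (Bf x)) := by
  have h1 := (isParallelBilin_potKM g α β x (h.smooth.diffAt x) (h'.smooth.diffAt x)).2 a
  rw [h.nabla a x, h'.nabla a x] at h1
  rw [potentialKM_eq]
  exact h1

theorem nablaX_potMM {α β A Bf : DiffForm n M} {σ τ : Bool} (h : HasTwistor g σ α A)
    (h' : HasTwistor g τ β Bf) (a : Fin n) (x : M) :
    g.nablaX a (g.potentialMM α β) x =
      potMM (g.bilin_nondegenerate x) (frame x)
          (formOp (g.bilin x) σ (frame x a) (A x)) (β x) +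
        potMM (g.bilin_nondegenerate x) (frame x) (α x)
          (formOp (g.bilin x) τ (frame x a) (Bf x)) := by
  have h1 := (isParallelBilin_potMM g α β x (h.smooth.diffAt x) (h'.smooth.diffAt x)).2 a
  rw [h.nabla a x, h'.nabla a x] at h1
  rw [potentialMM_eq]
  exact h1

/-- Antisymmetry of the potential brings both terms of its derivative to the shape of
`sum_hook_potKK`. The resulting odd sums are the halves of the odd-even commutators left over in
`HasTwistor.sum_bracket`. -/
theorem codiff_potentialKK {κ lam K L : DiffForm n M} (h : HasTwistor g false κ K)
    (h' : HasTwistor g false lam L)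
    (hC : ∑ a, g.comm (upper g false a κ) (lower g false a lam) = 0) (x : M) :
    g.codiff (g.potentialKK κ lam) x = -∑ b, formOp (g.bilin x) true (frame x b)
      (halfBracket g false false κ lam
          (DiffForm.deg (fun p => (numDeg n false p - 1) / 2) L) b x -
        halfBracket g false false lam κ
          (DiffForm.deg (fun p => (numDeg n false p - 1) / 2) K) b x) := by
  have h1 := h.sum_bracket h' hC x
  have hs := bilin_isSymm g x
  obtain ⟨hκ, hK⟩ := h.odd x
  obtain ⟨hl, hL⟩ := h'.odd x
  rw [commHom_odd_even (g.bilin_nondegenerate x) (frame x) hs (gradeInv_degOp_of_neg _ hκ)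
    (gradeInv_degOp_of_self _ hL), commHom_odd_even (g.bilin_nondegenerate x) (frame x) hs
    (gradeInv_degOp_of_neg _ hl) (gradeInv_degOp_of_self _ hK), numDeg_false] at h1
  rw [codiff_apply]
  refine congrArg _ (Eq.trans ?_ h1.symm)
  have h2 : ∀ a, g.nablaX a (g.potentialKK κ lam) x =
      potKK (g.bilin_nondegenerate x) (frame x) (κ x) (hook (frame x a) (L x)) -
        potKK (g.bilin_nondegenerate x) (frame x) (lam x) (hook (frame x a) (K x)) := by
    intro a
    have ho : gradeInv (hook (frame x a) (K x)) = -hook (frame x a) (K x) := by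
      rw [gradeInv_hook, hK]
    rw [nablaX_potKK h h', formOp_false, formOp_false,
      potKK_swap (g.bilin_nondegenerate x) (frame x) hs hl ho]
    abel
  have h3 := sum_hook_potKK (g.bilin_nondegenerate x) (frame x) hs (κ x) (L x)
  have h4 := sum_hook_potKK (g.bilin_nondegenerate x) (frame x) hs (lam x) (K x)
  simp only [h2, map_sub, Finset.sum_sub_distrib]
  refine (congrArg₂ _ h3 h4).trans ?_
  simp only [smul_smul]
  norm_num

/-- The two terms of the derivative are of different nature: differentiating φ gives an even sum,
matching a commutator of odd forms, and differentiating μ gives an odd sum, matching a commutator of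
even forms. -/
theorem d_potentialKM {μ φ N Φ : DiffForm n M} (h : HasTwistor g false μ N)
    (h' : HasTwistor g true φ Φ)
    (hC : ∑ a, g.comm (upper g false a μ) (lower g true a φ) = 0) (x : M) :
    g.d (g.potentialKM μ φ) x = ∑ b, formOp (g.bilin x) false (frame x b)
      (halfBracket g false true μ φ
          (DiffForm.deg (fun p => (numDeg n true p - 1) / 2) Φ) b x -
        halfBracket g true false φ μ
          (DiffForm.deg (fun p => (numDeg n false p - 1) / 2) N) b x) := by
  have h1 := h.sum_bracket h' hC x
  have hs := bilin_isSymm g x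
  obtain ⟨hμ, hN⟩ := h.odd x
  obtain ⟨hφ, hΦ⟩ := h'.even x
  rw [commHom_odd_odd (g.bilin_nondegenerate x) (frame x) hs (gradeInv_degOp_of_neg _ hμ)
    (gradeInv_degOp_of_neg _ hΦ), commHom_even_even (g.bilin_nondegenerate x) (frame x) hs
    (gradeInv_degOp_of_self _ hφ) (gradeInv_degOp_of_self _ hN),
    oddSum_swap' (g.bilin_nondegenerate x) (frame x) hs _ (gradeInv_degOp_of_self _ hφ),
    gradeInv_degOp_of_self _ hN, numDeg_false, numDeg_true] at h1
  rw [d_apply]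
  refine Eq.trans ?_ h1.symm
  have h3 := sum_oneForm_mul_potKM_right (g.bilin_nondegenerate x) (frame x) hs hμ (Φ x)
  have h4 := sum_oneForm_mul_potKM_left (g.bilin_nondegenerate x) (frame x) hN (φ x)
  have h5 := congrArg₂ (· + ·) h3 h4
  simp only [← Finset.sum_add_distrib, ← mul_add] at h5
  refine Eq.trans (Finset.sum_congr rfl fun a _ => ?_) (h5.trans ?_)
  · exact congrArg _ ((nablaX_potKM h h' a x).trans (add_comm _ _))
  · module

theorem codiff_potentialMM {α β A Bf : DiffForm n M} (h : HasTwistor g true α A)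
    (h' : HasTwistor g true β Bf)
    (hC : ∑ a, g.comm (upper g true a α) (lower g true a β) = 0) (x : M)
    (hden : ∀ r s k : ℕ, homPart r (degOp n (fun p => (n : ℝ) - p) (α x)) ≠ 0 →
      homPart s (degOp n (fun p => (n : ℝ) - p - 1) (Bf x)) ≠ 0 →
      (n : ℤ) - ((r : ℤ) + (s + 1 : ℕ) - 2 * (2 * k + 1)) - 2 * k ≠ 0)
    (hden' : ∀ r s k : ℕ, homPart r (degOp n (fun p => (n : ℝ) - p) (β x)) ≠ 0 →
      homPart s (degOp n (fun p => (n : ℝ) - p - 1) (A x)) ≠ 0 →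
      (n : ℤ) - ((r : ℤ) + (s + 1 : ℕ) - 2 * (2 * k + 1)) - 2 * k ≠ 0) :
    g.codiff (g.potentialMM α β) x = ∑ b, formOp (g.bilin x) true (frame x b)
      (halfBracket g true true α β
          (DiffForm.deg (fun p => (numDeg n true p - 1) / 2) Bf) b x -
        halfBracket g true true β α
          (DiffForm.deg (fun p => (numDeg n true p - 1) / 2) A) b x) := by
  have h1 := h.sum_bracket h' hC x
  have hs := bilin_isSymm g x
  obtain ⟨hα, hA⟩ := h.even x
  obtain ⟨hβ, hB⟩ := h'.even x
  have hc : ∀ {γ δ : FormsOn (TangentSpace (𝓡 n) x)}, gradeInv γ = γ → gradeInv δ = -δ →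
      commHom (g.bilin x) (g.bilin_nondegenerate x) γ δ =
        -((2 : ℝ) • oddSum (g.bilin_nondegenerate x) (frame x) γ δ) := by
    intro γ δ hγ hδ
    rw [commHom_swap, commHom_odd_even (g.bilin_nondegenerate x) (frame x) hs hδ hγ,
      oddSum_swap (g.bilin_nondegenerate x) (frame x) hs γ hδ]
  rw [hc (gradeInv_degOp_of_self _ hα) (gradeInv_degOp_of_neg _ hB),
    hc (gradeInv_degOp_of_self _ hβ) (gradeInv_degOp_of_neg _ hA), numDeg_true] at h1
  rw [codiff_apply]
  refine Eq.trans ?_ h1.symm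
  have h2 : ∀ a, g.nablaX a (g.potentialMM α β) x =
      potMM (g.bilin_nondegenerate x) (frame x) (α x)
          (oneForm (g.bilin x (frame x a)) * Bf x) -
        potMM (g.bilin_nondegenerate x) (frame x) (β x)
          (oneForm (g.bilin x (frame x a)) * A x) := by
    intro a
    have ho : gradeInv (oneForm (g.bilin x (frame x a)) * A x) =
        oneForm (g.bilin x (frame x a)) * A x := by
      rw [map_mul, gradeInv_oneForm, hA, neg_mul_neg]
    rw [nablaX_potMM h h', formOp_true, formOp_true,
      potMM_swap (g.bilin_nondegenerate x) (frame x) hs hβ ho]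
    abel
  have h3 := sum_hook_potMM (g.bilin_nondegenerate x) (frame x) hs hα (Bf x) hden
  have h4 := sum_hook_potMM (g.bilin_nondegenerate x) (frame x) hs hβ (A x) hden'
  simp only [h2, map_sub, Finset.sum_sub_distrib]
  refine (congrArg Neg.neg (congrArg₂ _ h3 h4)).trans ?_
  module

/-! ### Denominators -/

theorem DenominatorsNonvanishing.symm {α β : DiffForm n M} (h : DenominatorsNonvanishing α β) :
    DenominatorsNonvanishing β α := by
  intro p q k hp hq
  have := h q p k hq hp
  omega

theorem part_deg (f : ℕ → ℝ) (p : ℕ) (φ : DiffForm n M) :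
    DiffForm.part p (DiffForm.deg f φ) = f p • DiffForm.part p φ := by
  funext x
  rw [DiffForm.part, deg_apply, homPart_degOp (frame x)]
  rfl

/-- If the part of φ of degree s + 1 vanishes, so does its derivative, which is e_a ∧ Φ_s.
Contracting with X^a gives (n - s) Φ_s = 0. Thus the condition on the degrees of the forms controls
the degrees of the Φ as well. -/
theorem homPart_ccPotential_ne_zero (h : g.IsCCKY φ) (he : φ.IsEven) {s : ℕ} {x : M}
    (hs : homPart s (degOp n (fun p => (n : ℝ) - p - 1) (ccPotential g φ x)) ≠ 0) :
    DiffForm.part (s + 1) (DiffForm.deg (fun r => (n : ℝ) - r) φ) ≠ 0 := by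
  rw [homPart_degOp (frame x)] at hs
  rw [part_deg]
  obtain ⟨hc, hs⟩ := smul_ne_zero_iff.mp hs
  refine smul_ne_zero (by push_cast; rwa [← sub_sub]) fun h0 => hs ?_
  have h1 : ∀ a, oneForm (g.bilin x (frame x a)) * homPart s (ccPotential g φ x) = 0 := by
    intro a
    rw [← homPart_oneForm_mul_succ, ← formOp_true, ← (hasTwistor_of_isCCKY h he).nabla]
    exact homPart_nablaX_eq_zero h.1.1 h0 a x
  have h2 := sum_hook_oneForm_mul_swap (g.bilin_nondegenerate x) (frame x) (bilin_isSymm g x)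
    (homPart s (ccPotential g φ x))
  simp only [h1, map_zero, Finset.sum_const_zero] at h2
  have h3 := congrArg (homPart s) h2
  rw [map_zero, homPart_degOp (frame x), homPart_homPart, if_pos rfl] at h3
  -- For s = n the contraction says nothing, but then the coefficient 1 / (n - s) in `ccPotential`
  -- is 1 / 0 = 0.
  rcases smul_eq_zero.mp h3.symm with h4 | h4
  · rw [ccPotential, deg_apply, homPart_degOp (frame x), h4]
    simp
  · exact h4

theorem DenominatorsNonvanishing.pointwise {α β : DiffForm n M}
    (hd : DenominatorsNonvanishing α β) (h : g.IsCCKY β) (he : β.IsEven) (x : M) (r s k : ℕ)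
    (hr : homPart r (degOp n (fun p => (n : ℝ) - p) (α x)) ≠ 0)
    (hs : homPart s (degOp n (fun p => (n : ℝ) - p - 1) (ccPotential g β x)) ≠ 0) :
    (n : ℤ) - ((r : ℤ) + (s + 1 : ℕ) - 2 * (2 * k + 1)) - 2 * k ≠ 0 := by
  refine hd r (s + 1) k (fun h0 => hr ?_) (homPart_ccPotential_ne_zero h he hs)
  rw [← deg_apply]
  exact congrFun h0 x

/-- For even p and q the denominator has the parity of n. -/
theorem denominatorsNonvanishing_of_odd {α β : DiffForm n M} (hα : α.IsEven) (hβ : β.IsEven)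
    (hn : Odd n) : DenominatorsNonvanishing α β := by
  intro p q k hp hq
  have h : ∀ {p : ℕ} {φ : DiffForm n M}, φ.IsEven →
      DiffForm.part p (DiffForm.deg (fun r => (n : ℝ) - r) φ) ≠ 0 → Even p := by
    intro p φ hφ hp
    by_contra hc
    exact hp (by rw [part_deg, hφ p (Nat.not_even_iff_odd.mp hc), smul_zero])
  obtain ⟨a, ha⟩ := h hα hp
  obtain ⟨b, hb⟩ := h hβ hq
  obtain ⟨c, hc⟩ := hn
  omega

/-- The denominator equals (n - p - q) + 2k + 2 and is positive. -/
theorem denominatorsNonvanishing_of_le {α β : DiffForm n M}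
    (h : ∀ p q : ℕ, DiffForm.part p α ≠ 0 → DiffForm.part q β ≠ 0 → p + q ≤ n) :
    DenominatorsNonvanishing α β := by
  intro p q k hp hq
  rw [part_deg] at hp hq
  have := h p q (smul_ne_zero_iff.mp hp).2 (smul_ne_zero_iff.mp hq).2
  omega

/-! ### Brackets -/

theorem hookUpper_eq (a : Fin n) (φ : DiffForm n M) : g.hookUpper a φ = upper g false a φ := rfl

theorem comm_swap (α β : DiffForm n M) : g.comm α β = -g.comm β α := (neg_sub _ _).symm

theorem bracketKK_eq (κ lam : DiffForm n M) : g.bracketKK κ lam =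
    DiffForm.deg (fun p => 1 / (p : ℝ)) (∑ b, g.wedgeLower b
      (halfBracket g false false κ lam (g.tildeK lam) b -
        halfBracket g false false lam κ (g.tildeK κ) b)) := by
  rw [PseudoRiemannianMetric.bracketKK]
  refine congrArg _ (Finset.sum_congr rfl fun b _ => congrArg _ ?_)
  simp only [halfBracket, hookUpper_eq, Finset.sum_sub_distrib,
    comm_swap (g.tildeK κ) (upper g false b lam)]
  abel

theorem bracketKM_eq (μ φ : DiffForm n M) : g.bracketKM μ φ =
    DiffForm.deg (fun p => 1 / ((n : ℝ) - p)) (∑ b, PseudoRiemannianMetric.hookLower b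
      (halfBracket g false true μ φ (g.tildeM φ) b -
        halfBracket g true false φ μ (g.tildeK μ) b)) := by
  rw [PseudoRiemannianMetric.bracketKM]
  refine congrArg _ (Finset.sum_congr rfl fun b _ => congrArg _ ?_)
  simp only [halfBracket, hookUpper_eq, wedgeUpper_eq g, Finset.sum_sub_distrib]
  abel

theorem bracketMM_eq (α β : DiffForm n M) : g.bracketMM α β =
    DiffForm.deg (fun p => 1 / (p : ℝ)) (∑ b, g.wedgeLower b
      (halfBracket g true true α β (g.tildeM β) b -
        halfBracket g true true β α (g.tildeM α) b)) := by
  rw [PseudoRiemannianMetric.bracketMM]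
  refine congrArg _ (Finset.sum_congr rfl fun b _ => congrArg _ ?_)
  simp only [halfBracket, wedgeUpper_eq g, Finset.sum_sub_distrib]
  abel

theorem codiff_potentialKK_eq {κ lam : DiffForm n M} (hκ : g.IsKY κ) (hκo : κ.IsOdd)
    (hl : g.IsKY lam) (hlo : lam.IsOdd)
    (hC : ∑ a, g.comm (g.hookUpper a κ) (PseudoRiemannianMetric.hookLower a lam) = 0) :
    g.codiff (g.potentialKK κ lam) = -∑ b, g.wedgeLower b
      (halfBracket g false false κ lam (g.tildeK lam) b -
        halfBracket g false false lam κ (g.tildeK κ) b) := by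
  funext x
  rw [codiff_potentialKK (hasTwistor_of_isKY hκ hκo) (hasTwistor_of_isKY hl hlo) hC, Pi.neg_apply,
    Finset.sum_apply, tildeK_eq, tildeK_eq]
  rfl

theorem d_potentialKM_eq {μ φ : DiffForm n M} (hμ : g.IsKY μ) (hμo : μ.IsOdd)
    (hφ : g.IsCCKY φ) (hφe : φ.IsEven)
    (hC : ∑ a, g.comm (g.hookUpper a μ) (g.wedgeLower a φ) = 0) :
    g.d (g.potentialKM μ φ) = ∑ b, PseudoRiemannianMetric.hookLower b
      (halfBracket g false true μ φ (g.tildeM φ) b -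
        halfBracket g true false φ μ (g.tildeK μ) b) := by
  funext x
  rw [d_potentialKM (hasTwistor_of_isKY hμ hμo) (hasTwistor_of_isCCKY hφ hφe) hC,
    Finset.sum_apply, tildeK_eq, tildeM_eq]
  rfl

theorem codiff_potentialMM_eq {α β : DiffForm n M} (hα : g.IsCCKY α) (hαe : α.IsEven)
    (hβ : g.IsCCKY β) (hβe : β.IsEven)
    (hC : ∑ a, g.comm (PseudoRiemannianMetric.wedgeUpper a α) (g.wedgeLower a β) = 0)
    (hd : DenominatorsNonvanishing α β) :
    g.codiff (g.potentialMM α β) = ∑ b, g.wedgeLower b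
      (halfBracket g true true α β (g.tildeM β) b -
        halfBracket g true true β α (g.tildeM α) b) := by
  simp only [wedgeUpper_eq g] at hC
  funext x
  rw [codiff_potentialMM (hasTwistor_of_isCCKY hα hαe) (hasTwistor_of_isCCKY hβ hβe) hC x
    (hd.pointwise hβ hβe x) (hd.symm.pointwise hα hαe x), Finset.sum_apply, tildeM_eq, tildeM_eq]
  rfl

/-- Ensures that the prefactor 1/π never meets degree 0, where it would be 1 / 0 = 0. -/
theorem part_zero_sum_wedgeLower (ψ : Fin n → DiffForm n M) :
    DiffForm.part 0 (∑ b, g.wedgeLower b (ψ b)) = 0 := by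
  funext x
  rw [DiffForm.part, Finset.sum_apply, map_sum]
  exact Finset.sum_eq_zero fun b _ => homPart_oneForm_mul_zero _ _

/-- A part of degree n would come from degree n + 1; this makes the prefactor 1/(n - π) legitimate.
-/
theorem part_top_sum_hookLower (ψ : Fin n → DiffForm n M) :
    DiffForm.part n (∑ b, PseudoRiemannianMetric.hookLower b (ψ b)) = 0 := by
  funext x
  rw [DiffForm.part, Finset.sum_apply, map_sum]
  refine Finset.sum_eq_zero fun b _ => ?_
  rw [PseudoRiemannianMetric.hookLower, homPart_hook,
    homPart_eq_zero_of_lt (frame x) (Nat.lt_succ_self n), map_zero]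

theorem deg_neg (f : ℕ → ℝ) (φ : DiffForm n M) :
    DiffForm.deg f (-φ) = -DiffForm.deg f φ := by
  funext x
  simp only [deg_apply, Pi.neg_apply, map_neg]

theorem part_neg (p : ℕ) (φ : DiffForm n M) : DiffForm.part p (-φ) = -DiffForm.part p φ :=
  funext fun _ => map_neg _ _

end KillingYanoForms

end KillingYano
end

/-! ### The three brackets and their potentials -/

open KillingYano
theorem mainTheorem6 {n : ℕ} {M : Type*} [TopologicalSpace M] [ChartedSpace (Model n) M]
    [IsManifold (𝓡 n) ∞ M] (g : PseudoRiemannianMetric n M) :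
    -- two odd KY forms
    (∀ κ lam : DiffForm n M, g.IsKY κ → κ.IsOdd → g.IsKY lam → lam.IsOdd →
      ∑ a, g.comm (g.hookUpper a κ) (PseudoRiemannianMetric.hookLower a lam) = 0 →
      g.bracketKK κ lam
          = -DiffForm.deg (fun p => 1 / (p : ℝ)) (g.codiff (g.potentialKK κ lam)) ∧
        DiffForm.part 0 (g.codiff (g.potentialKK κ lam)) = 0) ∧
    -- an odd KY form and an even CCKY form
    (∀ μ φ : DiffForm n M, g.IsKY μ → μ.IsOdd → g.IsCCKY φ → φ.IsEven →
      ∑ a, g.comm (g.hookUpper a μ) (g.wedgeLower a φ) = 0 →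
      g.bracketKM μ φ
          = DiffForm.deg (fun p => 1 / ((n : ℝ) - p)) (g.d (g.potentialKM μ φ)) ∧
        DiffForm.part n (g.d (g.potentialKM μ φ)) = 0) ∧
    -- two even CCKY forms
    (∀ α β : DiffForm n M, g.IsCCKY α → α.IsEven → g.IsCCKY β → β.IsEven →
      ∑ a, g.comm (PseudoRiemannianMetric.wedgeUpper a α) (g.wedgeLower a β) = 0 →
      (DenominatorsNonvanishing α β →
        g.bracketMM α β
            = DiffForm.deg (fun p => 1 / (p : ℝ)) (g.codiff (g.potentialMM α β)) ∧
          DiffForm.part 0 (g.codiff (g.potentialMM α β)) = 0) ∧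
      (Odd n → DenominatorsNonvanishing α β) ∧
      ((∀ p q : ℕ, DiffForm.part p α ≠ 0 → DiffForm.part q β ≠ 0 → p + q ≤ n) →
        DenominatorsNonvanishing α β)) := by
  refine ⟨fun κ lam hκ hκo hl hlo hC => ?_, fun μ φ hμ hμo hφ hφe hC => ?_,
    fun α β hα hαe hβ hβe hC => ⟨fun hd => ?_, denominatorsNonvanishing_of_odd hαe hβe,
      denominatorsNonvanishing_of_le⟩⟩
  · rw [codiff_potentialKK_eq hκ hκo hl hlo hC, bracketKK_eq, deg_neg, neg_neg, part_neg,
      part_zero_sum_wedgeLower, neg_zero]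
    exact ⟨rfl, rfl⟩
  · rw [d_potentialKM_eq hμ hμo hφ hφe hC, bracketKM_eq]
    exact ⟨rfl, part_top_sum_hookLower _⟩
  · rw [codiff_potentialMM_eq hα hαe hβ hβe hC hd, bracketMM_eq]
    exact ⟨rfl, part_zero_sum_wedgeLower _⟩
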